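/- **Setting.** Let $H\in C^\infty([-1,1])$ be even with $H(0)=1=\max H$, $H(\pm1)=0$, $H>0$ on $(-1,1)$, and $H''(0)<0<H''(1)$. Put $k=\frac1\pi\sqrt{|H''(0)|\,H''(1)}$, $\kappa=1/k$, $\mathrm S=[-\kappa,\kappa]$, and let $T>0$. For $\varepsilon>0$ let $g_\varepsilon=Z_\varepsilon^{-1}e^{-H/\varepsilon}$ with $Z_\varepsilon=\int_{-1}^1e^{-H/\varepsilon}\,d\xi$, let $\gamma_\varepsilon=g_\varepsilon\,d\xi$ on $[-1,1]$, $\tau_\varepsilon=\frac1{2\kappa}\int_{-1}^1\frac{d\xi}{g_\varepsilon(\xi)}$, $\hat s_\varepsilon(\xi)=\int_0^\xi\frac{d\eta}{\tau_\varepsilon g_\varepsilon(\eta)}$ (a bijection $[-1,1]\to\mathrm S$), and let $\hat\gamma_\varepsilon=(\hat s_\varepsilon)_\#\gamma_\varepsilon$ be the push-forward. **Functionals.** Use the conventions $0\log0=0$, $0^2/0=0$, and $w^2/0=+\infty$ for $w\neq0$. * For $u\ge0$ on $\mathrm S$: $\hat{\mathcal E}_\varepsilon(u)=\int_{\mathrm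 S}u\log u\,d\hat\gamma_\varepsilon-m\log m$ with $m=\int_{\mathrm S}u\,d\hat\gamma_\varepsilon$. For numbers $u^\pm\ge0$: $\mathcal E_0(u^\pm)=\frac12(u^+\log u^++u^-\log u^-)-m\log m$ with $m=\frac12(u^++u^-)$. * For $0\le\hat u\in C^1([0,T]\times\mathrm S)$: $$\hat{\mathcal J}_\varepsilon(\hat u)=\int_0^T\Big(\frac12\int_{\mathrm S}\frac{\hat w^2}{\hat u}\,ds+2\int_{\mathrm S}|\partial_s\sqrt{\hat u}|^2\,ds\Big)dt\in[0,\infty],$$ where $\hat w\in L^1((0,T)\times\mathrm S)$ is the (unique) solution of $\partial_t(\hat u\hat\gamma_\varepsilon)+\partial_s\hat w=0$ in $\mathcal D'((0,T)\times\mathbb R)$, with $\hat u\hat\gamma_\varepsilon$ and $\hat w$ extended by $0$ outside $\mathrm S$; $\hat{\mathcal J}_\varepsilon(\hat u)=+\infty$ if there is no such $\hat w$. * For $w\in\mathbb R$, $u^\pm\ge0$: $$M(w;u^\pm)=\inf\Big\{\int_{-\kappa}^{\kappa}\frac{w^2}{2u}+\frac{(u')^2}{2u}\,ds:\ 0\le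 u\in H^1(-\kappa,\kappa),\ u(\pm\kappa)=u^\pm\Big\}\in[0,\infty].$$ * For $u^\pm:[0,T]\to\mathbb R$: $\mathcal J_0(u^\pm)=\int_0^TM(w(t);u^\pm(t))\,dt$ with $w=\frac12\dot u^-=-\frac12\dot u^+$ if $u^\pm$ are absolutely continuous and nonnegative with $\dot u^-=-\dot u^+$ a.e.; otherwise $\mathcal J_0(u^\pm)=+\infty$. **Theorem (recovery sequence).** Let $u^\pm$ be absolutely continuous on $[0,T]$ with $\mathcal J_0(u^\pm)<\infty$. Then there is a family $(\hat u_\varepsilon)_{\varepsilon>0}$ of nonnegative functions $\hat u_\varepsilon\in C^1([0,T]\times\mathrm S)$ such that, as $\varepsilon\downarrow0$, $$\hat u_\varepsilon(\cdot,\pm\kappa)\to u^\pm\ \text{ in }L^1(0,T),\qquad \hat{\mathcal E}_\varepsilon(\hat u_\varepsilon(0))\to\mathcal E_0(u^\pm(0)),\qquad \hat{\mathcal E}_\varepsilon(\hat u_\varepsilon(T))\to\mathcal E_0(u^\pm(T)),\qquad \hat{\mathcal J}_\varepsilon(\hat u_\varepsilon)\to\mathcal J_0(u^\pm).$$ -/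

import Mathlib

open MeasureTheory Set Filter Topology
open scoped ENNReal ContDiff

noncomputable section

namespace Kramers

/-- The potential on `[-1, 1]`: smooth, even, maximal at `0` with value `1`, minimal exactly at the
two wells `±1` with value `0`, and nondegenerate at `0` and `1`. -/
structure IsDoubleWell (H : ℝ → ℝ) : Prop where
  smooth : ContDiffOn ℝ ∞ H (Icc (-1) 1)
  even : ∀ ξ ∈ Icc (-1 : ℝ) 1, H (-ξ) = H ξ
  at_zero : H 0 = 1
  at_one : H 1 = 0
  le_one : ∀ ξ ∈ Icc (-1 : ℝ) 1, H ξ ≤ 1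
  pos : ∀ ξ ∈ Ioo (-1 : ℝ) 1, 0 < H ξ
  curv_zero : iteratedDerivWithin 2 H (Icc (-1) 1) 0 < 0
  curv_one : 0 < iteratedDerivWithin 2 H (Icc (-1) 1) 1

/-- The reaction rate `k = √(|H''(0)| H''(1)) / π`. -/
def rate (H : ℝ → ℝ) : ℝ :=
  Real.sqrt (|iteratedDerivWithin 2 H (Icc (-1) 1) 0| * iteratedDerivWithin 2 H (Icc (-1) 1) 1)
    / Real.pi

/-- The half-length `κ = 1 / k` of the rescaled interval `S = [-κ, κ]`. -/
def kappa (H : ℝ → ℝ) : ℝ := 1 / rate H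

/-- The normalisation constant `Z_ε` of the stationary measure. -/
def partitionFn (H : ℝ → ℝ) (ε : ℝ) : ℝ := ∫ ξ in (-1 : ℝ)..1, Real.exp (-(H ξ) / ε)

/-- The Lebesgue density `g_ε` of `γ_ε`. -/
def gDensity (H : ℝ → ℝ) (ε ξ : ℝ) : ℝ := (partitionFn H ε)⁻¹ * Real.exp (-(H ξ) / ε)

/-- The stationary probability measure `γ_ε = g_ε 𝓛¹` on `[-1, 1]`. -/
def gammaMeasure (H : ℝ → ℝ) (ε : ℝ) : Measure ℝ :=
  (volume.restrict (Icc (-1) 1)).withDensity fun ξ => ENNReal.ofReal (gDensity H ε ξ)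

/-- The time scale `τ_ε = (2κ)⁻¹ ∫_{-1}^{1} dξ / g_ε(ξ)`. -/
def tau (H : ℝ → ℝ) (ε : ℝ) : ℝ :=
  1 / (2 * kappa H) * ∫ ξ in (-1 : ℝ)..1, 1 / gDensity H ε ξ

/-- The rescaling of space `ŝ_ε : [-1, 1] → [-κ, κ]`. -/
def sHat (H : ℝ → ℝ) (ε ξ : ℝ) : ℝ := ∫ η in (0 : ℝ)..ξ, 1 / (tau H ε * gDensity H ε η)

/-- The rescaled stationary measure, the push-forward of `γ_ε` under `ŝ_ε`. -/
def gammaHat (H : ℝ → ℝ) (ε : ℝ) : Measure ℝ := (gammaMeasure H ε).map (sHat H ε)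

/-- The free energy `∫ u log u dγ̂_ε - m log m`, with `m = ∫ u dγ̂_ε`, of the measure `u γ̂_ε`
(recall that `Real.log 0 = 0`, so that `0 log 0 = 0`). -/
def energyHat (H : ℝ → ℝ) (ε : ℝ) (u : ℝ → ℝ) : ℝ :=
  (∫ s, u s * Real.log (u s) ∂gammaHat H ε)
    - (∫ s, u s ∂gammaHat H ε) * Real.log (∫ s, u s ∂gammaHat H ε)

/-- The limit energy of the measure `½ u⁻ δ₋ + ½ u⁺ δ₊`. -/
def energyZero (um up : ℝ) : ℝ :=
  (up * Real.log up + um * Real.log um) / 2 - (um + up) / 2 * Real.log ((um + up) / 2)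

/-- The quotient `w² / u` in `[0, ∞]` for `u ≥ 0`, with `0² / 0 = 0` and `w² / 0 = ∞` if `w ≠ 0`. -/
def sqDiv (w u : ℝ) : ℝ≥0∞ := ENNReal.ofReal (w ^ 2) / ENNReal.ofReal u

/-- The pair `(ρ̂, ŵ 𝓛²)` with `ρ̂(t) = û(t, ·) γ̂` is an admissible solution of the continuity equation
`∂ₜ ρ̂ + ∂ₛ ŵ = 0` in `𝒟'((0,T) × ℝ)`, with `ρ̂` and `ŵ` extended by zero outside `[-κ, κ]`. The test
functions need not vanish at `s = ±κ`, so there is no flux through the end points. -/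
structure ContinuityEquation (κ T : ℝ) (γ : Measure ℝ) (u w : ℝ → ℝ → ℝ) : Prop where
  nonneg : ∀ t ∈ Icc 0 T, ∀ s ∈ Icc (-κ) κ, 0 ≤ u t s
  integrable_density : ∀ t ∈ Icc 0 T, Integrable (u t) γ
  weakly_continuous : ∀ φ : ℝ → ℝ, Continuous φ →
    ContinuousOn (fun t => ∫ s in Icc (-κ) κ, φ s * u t s ∂γ) (Icc 0 T)
  integrable_flux : IntegrableOn (Function.uncurry w) (Icc 0 T ×ˢ Icc (-κ) κ)
  weak_eq : ∀ φ : ℝ × ℝ → ℝ, ContDiff ℝ ∞ φ → HasCompactSupport φ →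
    tsupport φ ⊆ Ioo 0 T ×ˢ (univ : Set ℝ) →
    (∫ t in Icc 0 T, ∫ s in Icc (-κ) κ, deriv (fun r => φ (r, s)) t * u t s ∂γ)
      + (∫ t in Icc 0 T, ∫ s in Icc (-κ) κ, deriv (fun r => φ (t, r)) s * w t s) = 0

/-- The rescaled dissipation functional
`Ĵ_ε = ∫₀ᵀ (½ ∫_S ŵ² / û ds + 2 ∫_S |∂ₛ √û|² ds) dt` of the curve `t ↦ û(t, ·) γ̂_ε`, where `û` is `C¹`
on `[0, T] × S` and `ŵ` is the flux of the continuity equation. The flux is unique up to null sets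
if it exists, so that the infimum is the value at the flux, and it is `∞` if there is none.

For a nonnegative `C¹` function `û` the classical derivative of `√û` (whose default value is `0`)
agrees almost everywhere with the weak one. -/
def dissipationHat (H : ℝ → ℝ) (T ε : ℝ) (u : ℝ → ℝ → ℝ) : ℝ≥0∞ :=
  ⨅ (w : ℝ → ℝ → ℝ) (_ : ContinuityEquation (kappa H) T (gammaHat H ε) u w),
    ∫⁻ t in Icc 0 T,
      (2⁻¹ * (∫⁻ s in Icc (-kappa H) (kappa H), sqDiv (w t s) (u t s))
        + 2 * ∫⁻ s in Icc (-kappa H) (kappa H),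
            ENNReal.ofReal ((deriv (fun r => Real.sqrt (u t r)) s) ^ 2))

/-- `u` is (the continuous representative of) an element of `H¹(-κ, κ)`. -/
def IsH1 (κ : ℝ) (u : ℝ → ℝ) : Prop :=
  AbsolutelyContinuousOnInterval u (-κ) κ ∧ MemLp (deriv u) 2 (volume.restrict (Icc (-κ) κ))

/-- The function `M(w, u^±)`: the infimum of `∫_{-κ}^{κ} (w² / (2 u) + u'² / (2 u)) ds` over all
nonnegative `u ∈ H¹(-κ, κ)` with `u(±κ) = u^±`. -/
def M (κ w um up : ℝ) : ℝ≥0∞ :=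
  ⨅ (u : ℝ → ℝ) (_ : IsH1 κ u ∧ (∀ s ∈ Icc (-κ) κ, 0 ≤ u s) ∧ u (-κ) = um ∧ u κ = up),
    ∫⁻ s in Icc (-κ) κ, (sqDiv w (u s) / 2 + sqDiv (deriv u s) (u s) / 2)

open Classical in
/-- The limit functional `J₀(u^±) = ∫₀ᵀ M(w(t), u^±(t)) dt` with `w = ½ u̇⁻ = -½ u̇⁺`; it is `∞` unless
`u^±` are nonnegative and absolutely continuous with `u̇⁻ = -u̇⁺`. -/
def dissipationZero (H : ℝ → ℝ) (T : ℝ) (um up : ℝ → ℝ) : ℝ≥0∞ :=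
  if AbsolutelyContinuousOnInterval um 0 T ∧ AbsolutelyContinuousOnInterval up 0 T ∧
      (∀ t ∈ Icc 0 T, 0 ≤ um t ∧ 0 ≤ up t) ∧
      (∀ᵐ t ∂(volume.restrict (Icc 0 T)), deriv um t = -deriv up t)
  then ∫⁻ t in Icc 0 T, M (kappa H) (deriv um t / 2) (um t) (up t)
  else ∞

end Kramers

end

/-! The infimum in `M` is attained by an explicit quadratic polynomial in `s`: the affine
interpolation of the boundary values plus a multiple `ρ` of `bump` (`M_eq_optCost`). The proof is a
calibration: the first integral of the Euler-Lagrange equation makes an affine minorant of the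
convex integrand, taken at the minimiser, an exact derivative plus a term independent of the
competitor (`optCost_add_le`).

Since `u⁺ + u⁻` is conserved, one can write `u^± = m ± b` with `m` constant. The optimal profiles
then form a curve in a family that is affine in the two coefficients `b t` and `ρ t`, and `J₀` is
the space-time integral of `costDensity` along this curve, with flux `b' / 2`.

The same family serves as ansatz for positive `ε`, with the constant corrected so that the mass with
respect to `γ̂_ε` is exactly `m`. Conservation of mass lets the continuity equation be solved by
means over the half lines to the left of `s` (`IsConcentrating.continuityEquation`); this flux is
the only one (`ContinuityEquation.flux_unique`), so the infimum in `dissipationHat` can be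
evaluated. The measures `γ̂_ε` are even and concentrate at the end points
(`IsDoubleWell.isConcentrating`), hence behave like half a unit mass at each, and the flux tends to
`b' / 2` in the interior. If `b` and `ρ` are `C¹` and the profile is bounded below by a positive
constant, all quantities converge by dominated convergence (`IsDoubleWell.tendsto_limitData`).

In general `b` is only absolutely continuous, `ρ` only locally integrable, and the profile may
vanish. Both coefficients are mollified in time with the same kernel and a constant `δ n > 0` is
added (`IsPath.exists_approx`). The profile is affine in the coefficients and the cost is jointly
convex and 1-homogeneous, so Jensen's inequality bounds the mollified cost by the original one up to
two short time layers; lower semicontinuity gives the reverse bound. A diagonal choice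
(`exists_diagonal`) combines the limits in `n` and in `ε`. -/

namespace Kramers

/-! ### Convexity and semicontinuity of the cost density -/

theorem sqDiv_of_pos {u : ℝ} (w : ℝ) (hu : 0 < u) : sqDiv w u = ENNReal.ofReal (w ^ 2 / u) := by
  rw [sqDiv, ENNReal.ofReal_div_of_pos hu]

theorem sqDiv_zero_left (u : ℝ) : sqDiv 0 u = 0 := by
  simp [sqDiv]

theorem sqDiv_zero_right {w : ℝ} (hw : w ≠ 0) : sqDiv w 0 = (⊤ : ℝ≥0∞) := by
  have : ENNReal.ofReal (w ^ 2) ≠ 0 := by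
    simpa using pow_pos (abs_pos.2 hw) 2 |>.ne'
  simp [sqDiv, ENNReal.div_zero, this]

theorem sqDiv_neg (w u : ℝ) : sqDiv (-w) u = sqDiv w u := by
  simp [sqDiv]

theorem sqDiv_mul {c : ℝ} (hc : 0 ≤ c) (w u : ℝ) :
    sqDiv (c * w) (c * u) = ENNReal.ofReal c * sqDiv w u := by
  rcases hc.eq_or_lt with rfl | hc
  · simp [sqDiv]
  · have h0 : ENNReal.ofReal c ≠ 0 := by simpa using hc
    have h1 : (c * w) ^ 2 = c * (c * w ^ 2) := by ring
    rw [sqDiv, sqDiv, h1, ENNReal.ofReal_mul hc.le, ENNReal.ofReal_mul hc.le,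
      ENNReal.ofReal_mul hc.le, ENNReal.mul_div_mul_left _ _ h0 ENNReal.ofReal_ne_top, mul_div_assoc]

/-- The quotient `w² / u` is the supremum of its affine minorants: each of them lies below. -/
theorem ofReal_affine_le_sqDiv {u : ℝ} (hu : 0 ≤ u) (w ψ : ℝ) :
    ENNReal.ofReal (2 * w * ψ - u * ψ ^ 2) ≤ sqDiv w u := by
  rcases hu.eq_or_lt with rfl | hu
  · rcases eq_or_ne w 0 with rfl | hw
    · simp
    · simp [sqDiv_zero_right hw]
  · rw [sqDiv_of_pos w hu]
    apply ENNReal.ofReal_le_ofReal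
    rw [le_div_iff₀ hu]
    nlinarith [sq_nonneg (w - u * ψ)]

/-- The quotient `w² / u` is the supremum of its affine minorants: it is the least upper bound. -/
theorem sqDiv_le_of_forall_affine_le {u : ℝ} (hu : 0 ≤ u) (w : ℝ) {X : ℝ≥0∞}
    (hX : ∀ ψ : ℝ, ENNReal.ofReal (2 * w * ψ - u * ψ ^ 2) ≤ X) : sqDiv w u ≤ X := by
  rcases hu.eq_or_lt with rfl | hu
  · rcases eq_or_ne w 0 with rfl | hw
    · simp [sqDiv_zero_left]
    · suffices X = ⊤ by simp [this]
      refine ENNReal.eq_top_of_forall_nnreal_le fun r => ?_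
      -- At `u = 0` the minorant is the linear function `2 w ψ` of `ψ`, which takes every value `r`.
      have := hX (r / (2 * w))
      have h2 : 2 * w * (r / (2 * w)) - 0 * (r / (2 * w)) ^ 2 = (r : ℝ) := by field_simp; ring
      rwa [h2, ENNReal.ofReal_coe_nnreal] at this
  · rw [sqDiv_of_pos w hu]
    -- The concave function `2 w ψ - u ψ²` is maximal at `ψ = w / u`, with value `w² / u`.
    convert hX (w / u) using 2
    field_simp
    ring

theorem measurable_sqDiv : Measurable fun p : ℝ × ℝ => sqDiv p.1 p.2 := by
  unfold sqDiv
  fun_prop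

theorem _root_.Measurable.sqDiv {α : Type*} [MeasurableSpace α] {f g : α → ℝ} (hf : Measurable f)
    (hg : Measurable g) : Measurable fun x => Kramers.sqDiv (f x) (g x) :=
  measurable_sqDiv.comp (hf.prodMk hg)

/-- A supremum of continuous functions is lower semicontinuous; the case `u₀ = 0` needs no separate
treatment. -/
theorem sqDiv_le_liminf {ι : Type*} {l : Filter ι} [l.NeBot] {w u : ι → ℝ} {w₀ u₀ : ℝ}
    (hw : Tendsto w l (𝓝 w₀)) (hu : Tendsto u l (𝓝 u₀)) (hpos : ∀ i, 0 ≤ u i) :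
    sqDiv w₀ u₀ ≤ liminf (fun i => sqDiv (w i) (u i)) l := by
  have hu₀ : 0 ≤ u₀ := ge_of_tendsto' hu hpos
  refine sqDiv_le_of_forall_affine_le hu₀ _ fun ψ => ?_
  have ht : Tendsto (fun i => ENNReal.ofReal (2 * w i * ψ - u i * ψ ^ 2)) l
      (𝓝 (ENNReal.ofReal (2 * w₀ * ψ - u₀ * ψ ^ 2))) :=
    ENNReal.tendsto_ofReal (((hw.const_mul 2).mul_const ψ).sub (hu.mul_const _))
  rw [← ht.liminf_eq]
  exact liminf_le_liminf (Eventually.of_forall fun i => ofReal_affine_le_sqDiv (hpos i) _ _)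

theorem ofReal_integral_le_lintegral_ofReal {α : Type*} [MeasurableSpace α] {μ : Measure α}
    {f : α → ℝ} (hf : Integrable f μ) :
    ENNReal.ofReal (∫ x, f x ∂μ) ≤ ∫⁻ x, ENNReal.ofReal (f x) ∂μ := by
  rw [integral_eq_lintegral_pos_part_sub_lintegral_neg_part hf]
  refine (ENNReal.ofReal_le_ofReal (sub_le_self _ ENNReal.toReal_nonneg)).trans ?_
  exact ENNReal.ofReal_toReal_le

/-- Jensen's inequality for the convex and homogeneous function `w² / u`. -/
theorem sqDiv_integral_le {α : Type*} [MeasurableSpace α] {μ : Measure α} {f g : α → ℝ}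
    (hf : Integrable f μ) (hg : Integrable g μ) (hpos : ∀ x, 0 ≤ g x) :
    sqDiv (∫ x, f x ∂μ) (∫ x, g x ∂μ) ≤ ∫⁻ x, sqDiv (f x) (g x) ∂μ := by
  refine sqDiv_le_of_forall_affine_le (integral_nonneg hpos) _ fun ψ => ?_
  have h : 2 * (∫ x, f x ∂μ) * ψ - (∫ x, g x ∂μ) * ψ ^ 2
      = ∫ x, (2 * f x * ψ - g x * ψ ^ 2) ∂μ := by
    rw [integral_sub ((hf.const_mul 2).mul_const ψ) (hg.mul_const _), integral_mul_const,
      integral_mul_const, integral_const_mul]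
  rw [h]
  refine (ofReal_integral_le_lintegral_ofReal
    (((hf.const_mul 2).mul_const ψ).sub (hg.mul_const _))).trans ?_
  exact lintegral_mono fun x => ofReal_affine_le_sqDiv (hpos x) _ _

/-- The integrand `w² / (2 u) + p² / (2 u)` of the dissipation. -/
noncomputable def costDensity (w p u : ℝ) : ℝ≥0∞ := sqDiv w u / 2 + sqDiv p u / 2

theorem costDensity_of_pos (w p : ℝ) {u : ℝ} (hu : 0 < u) :
    costDensity w p u = ENNReal.ofReal ((w ^ 2 + p ^ 2) / (2 * u)) := by
  have h2 : (2 : ℝ≥0∞) = ENNReal.ofReal 2 := by simp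
  rw [costDensity, sqDiv_of_pos _ hu, sqDiv_of_pos _ hu, h2, ← ENNReal.ofReal_div_of_pos two_pos,
    ← ENNReal.ofReal_div_of_pos two_pos, ← ENNReal.ofReal_add (by positivity) (by positivity)]
  congr 1
  field_simp

theorem _root_.Measurable.costDensity {α : Type*} [MeasurableSpace α] {f g h : α → ℝ}
    (hf : Measurable f) (hg : Measurable g) (hh : Measurable h) :
    Measurable fun x => Kramers.costDensity (f x) (g x) (h x) :=
  ((hf.sqDiv hh).div_const 2).add ((hg.sqDiv hh).div_const 2)

/-- Homogeneity allows the weight of a mollifying kernel to be moved inside the cost before Jensen's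
inequality is applied, and out again afterwards. -/
theorem costDensity_mul {c : ℝ} (hc : 0 ≤ c) (w p u : ℝ) :
    costDensity (c * w) (c * p) (c * u) = ENNReal.ofReal c * costDensity w p u := by
  simp only [costDensity, sqDiv_mul hc, mul_add, mul_div_assoc]

/-- The calibration inequality: `ψ` and `φ` will be the ratios of flux and slope to the optimal
profile. -/
theorem ofReal_affine_le_costDensity {u : ℝ} (hu : 0 ≤ u) (w p ψ φ : ℝ) :
    ENNReal.ofReal (w * ψ + p * φ - u * ((ψ ^ 2 + φ ^ 2) / 2)) ≤ costDensity w p u := by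
  have h2 : (2 : ℝ≥0∞) = ENNReal.ofReal 2 := by simp
  have key : w * ψ + p * φ - u * ((ψ ^ 2 + φ ^ 2) / 2)
      = (2 * w * ψ - u * ψ ^ 2) / 2 + (2 * p * φ - u * φ ^ 2) / 2 := by ring
  rw [key, costDensity]
  refine ENNReal.ofReal_add_le.trans (add_le_add ?_ ?_)
  · rw [ENNReal.ofReal_div_of_pos two_pos, ← h2]
    exact ENNReal.div_le_div_right (ofReal_affine_le_sqDiv hu _ _) _
  · rw [ENNReal.ofReal_div_of_pos two_pos, ← h2]
    exact ENNReal.div_le_div_right (ofReal_affine_le_sqDiv hu _ _) _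

/-- Merging the two quotients into one passes semicontinuity on without adding lower limits. -/
theorem costDensity_eq_sqDiv (w p u : ℝ) :
    costDensity w p u = sqDiv (Real.sqrt ((w ^ 2 + p ^ 2) / 2)) u := by
  have h2 : (2 : ℝ≥0∞) = ENNReal.ofReal 2 := by simp
  rw [costDensity, sqDiv, sqDiv, sqDiv, Real.sq_sqrt (by positivity),
    ENNReal.ofReal_div_of_pos two_pos, ENNReal.ofReal_add (by positivity) (by positivity), ← h2]
  simp only [div_eq_mul_inv]
  ring

theorem costDensity_le_liminf {w p u : ℕ → ℝ} {w₀ p₀ u₀ : ℝ}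
    (hw : Tendsto w atTop (𝓝 w₀)) (hp : Tendsto p atTop (𝓝 p₀)) (hu : Tendsto u atTop (𝓝 u₀))
    (hpos : ∀ i, 0 ≤ u i) :
    costDensity w₀ p₀ u₀ ≤ liminf (fun i => costDensity (w i) (p i) (u i)) atTop := by
  simp only [costDensity_eq_sqDiv]
  exact sqDiv_le_liminf
    ((Real.continuous_sqrt.tendsto _).comp (((hw.pow 2).add (hp.pow 2)).div_const 2)) hu hpos

theorem costDensity_integral_le {α : Type*} [MeasurableSpace α] {μ : Measure α} {w p u : α → ℝ}
    (hw : Integrable w μ) (hp : Integrable p μ) (hu : Integrable u μ) (hpos : ∀ x, 0 ≤ u x) :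
    costDensity (∫ x, w x ∂μ) (∫ x, p x ∂μ) (∫ x, u x ∂μ)
      ≤ ∫⁻ x, costDensity (w x) (p x) (u x) ∂μ := by
  refine le_trans (add_le_add (ENNReal.div_le_div_right (sqDiv_integral_le hw hu hpos) _)
    (ENNReal.div_le_div_right (sqDiv_integral_le hp hu hpos) _)) ?_
  have h2 : ∀ f : α → ℝ≥0∞, (∫⁻ x, f x ∂μ) / 2 = ∫⁻ x, f x / 2 ∂μ := fun f => by
    simp only [div_eq_mul_inv]
    rw [lintegral_mul_const' _ _ (by simp)]
  rw [h2, h2]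
  exact le_lintegral_add _ _

/-! ### The explicit minimiser of `M` -/

/-- The bump `(κ² - s²) / (2κ²)`, which vanishes at `s = ±κ`. -/
noncomputable def bump (κ s : ℝ) : ℝ := (κ ^ 2 - s ^ 2) / (2 * κ ^ 2)

/-- The quadratic profile with boundary values `m ± b` and curvature `-ρ / κ²`. -/
noncomputable def profile (κ m b ρ s : ℝ) : ℝ := m + b * (s / κ) + ρ * bump κ s

/-- The derivative of `profile` in the space variable. -/
noncomputable def profileSlope (κ b ρ s : ℝ) : ℝ := b / κ - ρ * s / κ ^ 2

theorem hasDerivAt_profile (κ m b ρ s : ℝ) :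
    HasDerivAt (profile κ m b ρ) (profileSlope κ b ρ s) s := by
  have h2 := ((hasDerivAt_id' s).pow 2).const_sub (κ ^ 2)
  refine ((((hasDerivAt_id' s).div_const κ).const_mul b |>.const_add m).add
    ((h2.div_const (2 * κ ^ 2)).const_mul ρ)).congr_deriv ?_
  rw [profileSlope]
  simp only [Nat.cast_ofNat, Nat.add_one_sub_one, pow_one, mul_one]
  ring

theorem deriv_profile (κ m b ρ : ℝ) : deriv (profile κ m b ρ) = profileSlope κ b ρ :=
  funext fun s => (hasDerivAt_profile κ m b ρ s).deriv

theorem contDiff_profile (κ m b ρ : ℝ) : ContDiff ℝ ∞ (profile κ m b ρ) := by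
  unfold profile bump
  fun_prop

theorem profile_right {κ : ℝ} (hκ : 0 < κ) (m b ρ : ℝ) : profile κ m b ρ κ = m + b := by
  simp [profile, bump, hκ.ne']

theorem profile_left {κ : ℝ} (hκ : 0 < κ) (m b ρ : ℝ) : profile κ m b ρ (-κ) = m - b := by
  simp [profile, bump, hκ.ne', sub_eq_add_neg]

/-- The coefficient of `bump` in the minimiser of `M (w; um, up)`. -/
noncomputable def optCoeff (κ w um up : ℝ) : ℝ :=
  Real.sqrt (um * up + κ ^ 2 * w ^ 2) - (um + up) / 2

/-- The minimiser of `M (w; um, up)`. -/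
noncomputable def optProfile (κ w um up : ℝ) : ℝ → ℝ :=
  profile κ ((um + up) / 2) ((up - um) / 2) (optCoeff κ w um up)

/-- The derivative of the minimiser of `M (w; um, up)`. -/
noncomputable def optSlope (κ w um up : ℝ) : ℝ → ℝ :=
  profileSlope κ ((up - um) / 2) (optCoeff κ w um up)

theorem hasDerivAt_optProfile (κ w um up s : ℝ) :
    HasDerivAt (optProfile κ w um up) (optSlope κ w um up s) s :=
  hasDerivAt_profile _ _ _ _ _

/-- The dissipation rate of the minimiser of `M (w; um, up)`. -/
noncomputable def optCost (κ w um up : ℝ) : ℝ≥0∞ :=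
  ∫⁻ s in Icc (-κ) κ, costDensity w (optSlope κ w um up s) (optProfile κ w um up s)

theorem optProfile_eq {κ : ℝ} (hκ : 0 < κ) (w um up s : ℝ) :
    optProfile κ w um up s = (up * (κ + s) ^ 2 + um * (κ - s) ^ 2
      + 2 * Real.sqrt (um * up + κ ^ 2 * w ^ 2) * (κ ^ 2 - s ^ 2)) / (4 * κ ^ 2) := by
  rw [optProfile, profile, bump, optCoeff]
  field_simp
  ring

theorem optProfile_nonneg {κ : ℝ} (hκ : 0 < κ) (w : ℝ) {um up s : ℝ} (hum : 0 ≤ um)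
    (hup : 0 ≤ up) (hs : s ∈ Icc (-κ) κ) : 0 ≤ optProfile κ w um up s := by
  rw [optProfile_eq hκ]
  have : 0 ≤ κ ^ 2 - s ^ 2 := by nlinarith [hs.1, hs.2]
  positivity

theorem optProfile_pos {κ : ℝ} (hκ : 0 < κ) (w : ℝ) {um up s : ℝ} (hum : 0 < um)
    (hup : 0 < up) (hs : s ∈ Icc (-κ) κ) : 0 < optProfile κ w um up s := by
  rw [optProfile_eq hκ]
  have h1 : 0 ≤ κ ^ 2 - s ^ 2 := by nlinarith [hs.1, hs.2]
  have h2 : 0 ≤ κ + s := by linarith [hs.1]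
  have h3 : 0 ≤ κ - s := by linarith [hs.2]
  have h4 : 0 < up * (κ + s) ^ 2 + um * (κ - s) ^ 2 := by
    rcases h2.eq_or_lt with h | h
    · have : 0 < κ - s := by linarith
      positivity
    · positivity
  positivity

theorem optProfile_right {κ : ℝ} (hκ : 0 < κ) (w um up : ℝ) : optProfile κ w um up κ = up := by
  rw [optProfile, profile_right hκ]
  ring

theorem optProfile_left {κ : ℝ} (hκ : 0 < κ) (w um up : ℝ) : optProfile κ w um up (-κ) = um := by
  rw [optProfile, profile_left hκ]
  ring

/-- The first integral of the Euler-Lagrange equation of `M`. -/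
theorem optSlope_sq {κ : ℝ} (hκ : 0 < κ) (w : ℝ) {um up : ℝ} (hum : 0 ≤ um) (hup : 0 ≤ up) (s : ℝ) :
    optSlope κ w um up s ^ 2
      = w ^ 2 + 2 * (-optCoeff κ w um up / κ ^ 2) * optProfile κ w um up s := by
  have hR : Real.sqrt (um * up + κ ^ 2 * w ^ 2) ^ 2 = um * up + κ ^ 2 * w ^ 2 :=
    Real.sq_sqrt (by positivity)
  rw [optProfile_eq hκ, optSlope, profileSlope, optCoeff]
  generalize Real.sqrt (um * up + κ ^ 2 * w ^ 2) = R at hR ⊢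
  field_simp
  linear_combination 16 * κ ^ 2 * hR

theorem lintegral_Icc_eq_ofReal_intervalIntegral {a b : ℝ} (hab : a ≤ b) {f : ℝ → ℝ}
    (hf : ContinuousOn f (Icc a b)) (h0 : ∀ s ∈ Icc a b, 0 ≤ f s) :
    ∫⁻ s in Icc a b, ENNReal.ofReal (f s) = ENNReal.ofReal (∫ s in a..b, f s) := by
  rw [intervalIntegral.integral_of_le hab, ← integral_Icc_eq_integral_Ioc,
    ofReal_integral_eq_lintegral_ofReal hf.integrableOn_Icc]
  exact (ae_restrict_mem measurableSet_Icc).mono h0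

theorem continuous_optProfile (κ w um up : ℝ) : Continuous (optProfile κ w um up) :=
  (contDiff_profile _ _ _ _).continuous

theorem continuous_optSlope (κ w um up : ℝ) : Continuous (optSlope κ w um up) := by
  unfold optSlope profileSlope
  fun_prop

/-- Calibration by the optimal profile `Q`, whose boundary values are raised by `δ` so that `Q` is
positive and `φ = Q' / Q` is smooth. The mismatch with the boundary values of the competitor has a
favourable sign because `φ` is decreasing. -/
theorem optCost_add_le {κ : ℝ} (hκ : 0 < κ) (w : ℝ) {um up δ : ℝ} (hum : 0 ≤ um) (hup : 0 ≤ up)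
    (hδ : 0 < δ) {v : ℝ → ℝ} (hv : AbsolutelyContinuousOnInterval v (-κ) κ)
    (hv0 : ∀ s ∈ Icc (-κ) κ, 0 ≤ v s) (hvm : v (-κ) = um) (hvp : v κ = up) :
    optCost κ w (um + δ) (up + δ) ≤ ∫⁻ s in Icc (-κ) κ, costDensity w (deriv v s) (v s) := by
  have hle : -κ ≤ κ := by linarith
  have hN : 0 < um + δ := by linarith
  have hP : 0 < up + δ := by linarith
  set Q := optProfile κ w (um + δ) (up + δ) with hQ
  set Q' := optSlope κ w (um + δ) (up + δ) with hQ'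
  set E := -optCoeff κ w (um + δ) (up + δ) / κ ^ 2 with hE
  have hQpos : ∀ s ∈ Icc (-κ) κ, 0 < Q s := fun s hs => optProfile_pos hκ w hN hP hs
  have hQd : ∀ s, HasDerivAt Q (Q' s) s := fun s => hasDerivAt_optProfile _ _ _ _ _
  have hQ'd : ∀ s, HasDerivAt Q' E s := fun s => by
    refine (((hasDerivAt_id' s).const_mul _).div_const _ |>.const_sub _).congr_deriv ?_
    rw [hE]
    ring
  have hsq : ∀ s, Q' s ^ 2 = w ^ 2 + 2 * E * Q s := fun s => optSlope_sq hκ w hN.le hP.le s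
  have hQc : Continuous Q := continuous_optProfile _ _ _ _
  have hne : ∀ s ∈ Icc (-κ) κ, Q s ≠ 0 := fun s hs => (hQpos s hs).ne'
  -- the multiplier
  set φ : ℝ → ℝ := fun s => Q' s / Q s with hφ
  -- The quotient rule gives `E / Q - Q'² / Q²`, and the first integral replaces `2 E Q` by `Q'² -
  -- w²`.
  have hφd : ∀ s ∈ Icc (-κ) κ, HasDerivAt φ (-((w ^ 2 + Q' s ^ 2) / (2 * Q s ^ 2))) s := by
    intro s hs
    refine ((hQ'd s).div (hQd s) (hne s hs)).congr_deriv ?_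
    have h0 := hne s hs
    have h1 := hsq s
    field_simp
    linear_combination (-1 : ℝ) * h1
  have hφc : ContinuousOn φ (Icc (-κ) κ) := fun s hs => (hφd s hs).continuousAt.continuousWithinAt
  have hφac : AbsolutelyContinuousOnInterval φ (-κ) κ := by
    apply ContDiffOn.absolutelyContinuousOnInterval
    rw [uIcc_of_le hle]
    apply ContDiffOn.div _ _ hne
    · exact ContDiff.contDiffOn (by rw [hQ']; unfold optSlope profileSlope; fun_prop)
    · exact ((contDiff_profile _ _ _ _).of_le (by norm_cast)).contDiffOn
  have hφanti : φ κ ≤ φ (-κ) := by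
    have : AntitoneOn φ (Icc (-κ) κ) := by
      apply antitoneOn_of_deriv_nonpos (convex_Icc _ _) hφc
      · intro s hs
        exact (hφd s (interior_subset hs)).differentiableAt.differentiableWithinAt
      · intro s hs
        have hs' := interior_subset hs
        rw [(hφd s hs').deriv]
        have := hQpos s hs'
        rw [neg_nonpos]
        positivity
    exact this ⟨le_rfl, hle⟩ ⟨hle, le_rfl⟩ hle
  have hQ'ac : AbsolutelyContinuousOnInterval Q' (-κ) κ := by
    apply ContDiffOn.absolutelyContinuousOnInterval
    exact ContDiff.contDiffOn (by rw [hQ']; unfold optSlope profileSlope; fun_prop)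
  -- the value at the optimal profile
  have hL : optCost κ w (um + δ) (up + δ)
      = ENNReal.ofReal (∫ s in (-κ)..κ, (w * (w / Q s) + E)) := by
    rw [optCost, ← lintegral_Icc_eq_ofReal_intervalIntegral hle]
    · refine setLIntegral_congr_fun measurableSet_Icc fun s hs => ?_
      have h0 := hQpos s hs
      rw [costDensity_of_pos _ _ h0]
      congr 1
      have := hsq s
      rw [hsq]
      field_simp
      ring
    · exact ((continuousOn_const.mul (continuousOn_const.div hQc.continuousOn hne))).add
        continuousOn_const
    · intro s hs
      have h0 := hQpos s hs
      have : w * (w / Q s) + E = (w ^ 2 + Q' s ^ 2) / (2 * Q s) := by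
        rw [hsq]
        field_simp
        ring
      rw [this]
      positivity
  have hvφ := hv.fun_mul hφac
  have hint : IntervalIntegrable (fun s => w * (w / Q s)) volume (-κ) κ := by
    apply ContinuousOn.intervalIntegrable
    rw [uIcc_of_le hle]
    exact continuousOn_const.mul (continuousOn_const.div hQc.continuousOn hne)
  have hR : ENNReal.ofReal (∫ s in (-κ)..κ, (w * (w / Q s) + deriv (fun r => v r * φ r) s))
      ≤ ∫⁻ s in Icc (-κ) κ, costDensity w (deriv v s) (v s) := by
    rw [intervalIntegral.integral_of_le hle, ← integral_Icc_eq_integral_Ioc]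
    have hi := hint.add hvφ.intervalIntegrable_deriv
    rw [intervalIntegrable_iff_integrableOn_Icc_of_le hle] at hi
    refine (ofReal_integral_le_lintegral_ofReal hi).trans ?_
    refine setLIntegral_mono_ae' measurableSet_Icc ?_
    filter_upwards [hv.ae_differentiableAt] with s hd hs
    rw [uIcc_of_le hle] at hd
    have h1 : deriv (fun r => v r * φ r) s = deriv v s * φ s
        + v s * (-((w ^ 2 + Q' s ^ 2) / (2 * Q s ^ 2))) :=
      ((hd hs).hasDerivAt.mul (hφd s hs)).deriv
    -- With slopes `w / Q` and `φ` the affine minorant equals `w² / Q + (v φ)'`: the derivative of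
    -- `φ` absorbs the term proportional to `v`.
    refine le_trans (le_of_eq ?_)
      (ofReal_affine_le_costDensity (hv0 s hs) w (deriv v s) (w / Q s) (φ s))
    congr 1
    rw [h1, hφ]
    have := hne s hs
    field_simp
    ring
  rw [hL]
  refine (ENNReal.ofReal_le_ofReal ?_).trans hR
  rw [intervalIntegral.integral_add hint (by simp),
    intervalIntegral.integral_add hint hvφ.intervalIntegrable_deriv, hvφ.integral_deriv_eq_sub]
  have hE' : ∫ _ in (-κ)..κ, E = Q' κ - Q' (-κ) := by
    rw [← hQ'ac.integral_deriv_eq_sub]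
    exact intervalIntegral.integral_congr fun s _ => (hQ'd s).deriv.symm
  have e1 : Q' κ = (up + δ) * φ κ := by
    have := optProfile_right hκ w (um + δ) (up + δ)
    rw [hφ]; simp only []
    rw [hQ, this]; field_simp
  have e2 : Q' (-κ) = (um + δ) * φ (-κ) := by
    have := optProfile_left hκ w (um + δ) (up + δ)
    rw [hφ]; simp only []
    rw [hQ, this]; field_simp
  rw [hE', e1, e2, hvm, hvp]
  -- The two sides differ by `δ (φ κ - φ (-κ))`, which is nonpositive.
  nlinarith

theorem tendsto_optCoeff {κ : ℝ} {w um up : ℕ → ℝ} {w₀ um₀ up₀ : ℝ}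
    (hw : Tendsto w atTop (𝓝 w₀)) (hum : Tendsto um atTop (𝓝 um₀))
    (hup : Tendsto up atTop (𝓝 up₀)) :
    Tendsto (fun i => optCoeff κ (w i) (um i) (up i)) atTop (𝓝 (optCoeff κ w₀ um₀ up₀)) :=
  ((Real.continuous_sqrt.tendsto _).comp ((hum.mul hup).add ((hw.pow 2).const_mul _))).sub
    ((hum.add hup).div_const 2)

theorem tendsto_profile {κ : ℝ} {m b ρ : ℕ → ℝ} {m₀ b₀ ρ₀ : ℝ}
    (hm : Tendsto m atTop (𝓝 m₀)) (hb : Tendsto b atTop (𝓝 b₀))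
    (hρ : Tendsto ρ atTop (𝓝 ρ₀)) (s : ℝ) :
    Tendsto (fun i => profile κ (m i) (b i) (ρ i) s) atTop (𝓝 (profile κ m₀ b₀ ρ₀ s)) :=
  (hm.add (hb.mul_const _)).add (hρ.mul_const _)

theorem tendsto_profileSlope {κ : ℝ} {b ρ : ℕ → ℝ} {b₀ ρ₀ : ℝ} (hb : Tendsto b atTop (𝓝 b₀))
    (hρ : Tendsto ρ atTop (𝓝 ρ₀)) (s : ℝ) :
    Tendsto (fun i => profileSlope κ (b i) (ρ i) s) atTop (𝓝 (profileSlope κ b₀ ρ₀ s)) :=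
  (hb.div_const _).sub ((hρ.mul_const _).div_const _)

/-- The preceding bound holds for every `δ > 0`; the minimisers converge pointwise as `δ → 0`, and
Fatou's lemma passes to the limit even if `um` or `up` vanishes. -/
theorem optCost_le_lintegral {κ : ℝ} (hκ : 0 < κ) (w : ℝ) {um up : ℝ} (hum : 0 ≤ um) (hup : 0 ≤ up)
    {v : ℝ → ℝ} (hv : AbsolutelyContinuousOnInterval v (-κ) κ)
    (hv0 : ∀ s ∈ Icc (-κ) κ, 0 ≤ v s) (hvm : v (-κ) = um) (hvp : v κ = up) :
    optCost κ w um up ≤ ∫⁻ s in Icc (-κ) κ, costDensity w (deriv v s) (v s) := by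
  set δ : ℕ → ℝ := fun n => 1 / ((n : ℝ) + 1)
  have hδ : ∀ n, 0 < δ n := fun n => Nat.one_div_pos_of_nat
  have hδ0 : Tendsto δ atTop (𝓝 0) := tendsto_one_div_add_atTop_nhds_zero_nat
  have hum' : Tendsto (fun n => um + δ n) atTop (𝓝 um) := by simpa using hδ0.const_add um
  have hup' : Tendsto (fun n => up + δ n) atTop (𝓝 up) := by simpa using hδ0.const_add up
  have hρ := tendsto_optCoeff (κ := κ) (tendsto_const_nhds (x := w)) hum' hup'
  have hb := (hup'.sub hum').div_const 2
  have hm := (hum'.add hup').div_const 2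
  have h1 : optCost κ w um up ≤ ∫⁻ s in Icc (-κ) κ, liminf (fun n => costDensity w
      (optSlope κ w (um + δ n) (up + δ n) s) (optProfile κ w (um + δ n) (up + δ n) s)) atTop := by
    refine setLIntegral_mono' measurableSet_Icc fun s hs => ?_
    refine costDensity_le_liminf tendsto_const_nhds (tendsto_profileSlope hb hρ s)
      (tendsto_profile hm hb hρ s) fun n => ?_
    exact (optProfile_pos hκ w (by linarith [hδ n]) (by linarith [hδ n]) hs).le
  refine h1.trans ((lintegral_liminf_le fun n => ?_).trans ?_)
  · exact measurable_const.costDensity (continuous_optSlope _ _ _ _).measurable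
      (continuous_optProfile _ _ _ _).measurable
  · refine liminf_le_of_frequently_le' (Eventually.frequently (Eventually.of_forall fun n => ?_))
    exact optCost_add_le hκ w hum hup (hδ n) hv hv0 hvm hvp

/-- The infimum in the definition of `M` is attained at the quadratic profile. -/
theorem M_eq_optCost {κ : ℝ} (hκ : 0 < κ) (w : ℝ) {um up : ℝ} (hum : 0 ≤ um) (hup : 0 ≤ up) :
    M κ w um up = optCost κ w um up := by
  apply le_antisymm
  · refine iInf₂_le_of_le (optProfile κ w um up) ⟨⟨?_, ?_⟩, fun s hs => ?_, ?_, ?_⟩ ?_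
    · exact (((contDiff_profile _ _ _ _).of_le (by norm_cast)).contDiffOn).absolutelyContinuousOnInterval
    · rw [optProfile, deriv_profile]
      have hc : Continuous (optSlope κ w um up) := continuous_optSlope κ w um up
      obtain ⟨C, hC⟩ := (isCompact_Icc (a := -κ) (b := κ)).exists_bound_of_continuousOn
        hc.continuousOn
      exact MemLp.of_bound hc.aestronglyMeasurable C
        ((ae_restrict_mem measurableSet_Icc).mono hC)
    · exact optProfile_nonneg hκ w hum hup hs
    · exact optProfile_left hκ _ _ _
    · exact optProfile_right hκ _ _ _
    · rw [optProfile, deriv_profile]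
      exact le_rfl
  · exact le_iInf₂ fun v hv =>
      optCost_le_lintegral hκ w hum hup hv.1.1 hv.2.1 hv.2.2.1 hv.2.2.2

/-- Without flux, the dissipation rate of the minimiser is finite. -/
theorem optCost_zero_lt_top {κ : ℝ} (hκ : 0 < κ) {um up : ℝ} (hum : 0 ≤ um) (hup : 0 ≤ up) :
    optCost κ 0 um up < ⊤ := by
  have hle : ∀ s ∈ Icc (-κ) κ, costDensity 0 (optSlope κ 0 um up s) (optProfile κ 0 um up s)
      ≤ ENNReal.ofReal |optCoeff κ 0 um up / κ ^ 2| := by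
    intro s hs
    have h := optSlope_sq hκ 0 hum hup s
    rcases (optProfile_nonneg hκ 0 hum hup hs).eq_or_lt with h0 | h0
    -- For `w = 0` the first integral forces the slope to vanish wherever the profile does, so the
    -- convention `0² / 0 = 0` applies.
    · have : optSlope κ 0 um up s = 0 := by
        rw [← h0] at h
        simpa using h
      simp [costDensity, this, sqDiv_zero_left]
    · rw [costDensity_of_pos _ _ h0]
      apply ENNReal.ofReal_le_ofReal
      rw [h, div_le_iff₀ (by positivity)]
      have := neg_abs_le (optCoeff κ 0 um up / κ ^ 2)
      have e : -optCoeff κ 0 um up / κ ^ 2 = -(optCoeff κ 0 um up / κ ^ 2) := neg_div _ _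
      rw [e]
      nlinarith
  refine (setLIntegral_mono' measurableSet_Icc hle).trans_lt ?_
  simp [ENNReal.mul_lt_top_iff]

/-! ### The rescaled stationary measures -/

theorem IsDoubleWell.continuousOn {H : ℝ → ℝ} (hH : IsDoubleWell H) :
    ContinuousOn H (Icc (-1) 1) :=
  hH.smooth.continuousOn

theorem IsDoubleWell.kappa_pos {H : ℝ → ℝ} (hH : IsDoubleWell H) : 0 < kappa H := by
  have h0 := hH.curv_zero
  have h1 := hH.curv_one
  have : 0 < |iteratedDerivWithin 2 H (Icc (-1) 1) 0| := abs_pos.2 h0.ne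
  unfold kappa rate
  positivity

theorem mul_sub_le_intervalIntegral {f : ℝ → ℝ} {a b x y c : ℝ} (hax : a ≤ x) (hxy : x ≤ y)
    (hyb : y ≤ b) (hf : ContinuousOn f (Icc a b)) (h0 : ∀ t ∈ Icc a b, 0 ≤ f t)
    (hc : ∀ t ∈ Icc x y, c ≤ f t) : c * (y - x) ≤ ∫ t in a..b, f t := by
  have hsub : Icc x y ⊆ Icc a b := Icc_subset_Icc hax hyb
  have hab : a ≤ b := hax.trans (hxy.trans hyb)
  have hi : IntervalIntegrable f volume x y := by
    apply ContinuousOn.intervalIntegrable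
    rw [uIcc_of_le hxy]
    exact hf.mono hsub
  calc c * (y - x) = ∫ _ in x..y, c := by simp [mul_comm]
    _ ≤ ∫ t in x..y, f t :=
        intervalIntegral.integral_mono_on hxy (by simp) hi hc
    _ ≤ ∫ t in a..b, f t := by
        apply intervalIntegral.integral_mono_interval hax hxy hyb
        · exact (ae_restrict_mem measurableSet_Ioc).mono fun t ht => h0 t (Ioc_subset_Icc_self ht)
        · apply ContinuousOn.intervalIntegrable
          rwa [uIcc_of_le hab]

theorem IsDoubleWell.continuousOn_exp {H : ℝ → ℝ} (hH : IsDoubleWell H) (ε : ℝ) :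
    ContinuousOn (fun ξ => Real.exp (-(H ξ) / ε)) (Icc (-1) 1) :=
  (hH.continuousOn.neg.div_const ε).rexp

theorem IsDoubleWell.partitionFn_pos {H : ℝ → ℝ} (hH : IsDoubleWell H) (ε : ℝ) :
    0 < partitionFn H ε := by
  apply intervalIntegral.intervalIntegral_pos_of_pos_on
  · apply ContinuousOn.intervalIntegrable
    rw [uIcc_of_le (by norm_num)]
    exact hH.continuousOn_exp ε
  · exact fun ξ _ => Real.exp_pos _
  · norm_num

theorem IsDoubleWell.gDensity_pos {H : ℝ → ℝ} (hH : IsDoubleWell H) (ε ξ : ℝ) :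
    0 < gDensity H ε ξ :=
  mul_pos (inv_pos.2 (hH.partitionFn_pos ε)) (Real.exp_pos _)

theorem IsDoubleWell.continuousOn_gDensity {H : ℝ → ℝ} (hH : IsDoubleWell H) (ε : ℝ) :
    ContinuousOn (gDensity H ε) (Icc (-1) 1) :=
  continuousOn_const.mul (hH.continuousOn_exp ε)

theorem IsDoubleWell.gDensity_neg {H : ℝ → ℝ} (hH : IsDoubleWell H) (ε : ℝ) {ξ : ℝ}
    (hξ : ξ ∈ Icc (-1 : ℝ) 1) : gDensity H ε (-ξ) = gDensity H ε ξ := by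
  rw [gDensity, gDensity, hH.even ξ hξ]

theorem IsDoubleWell.continuousOn_one_div {H : ℝ → ℝ} (hH : IsDoubleWell H) (ε : ℝ) :
    ContinuousOn (fun ξ => 1 / gDensity H ε ξ) (Icc (-1) 1) :=
  continuousOn_const.div (hH.continuousOn_gDensity ε) fun ξ _ => (hH.gDensity_pos ε ξ).ne'

theorem IsDoubleWell.tau_pos {H : ℝ → ℝ} (hH : IsDoubleWell H) (ε : ℝ) : 0 < tau H ε := by
  have := hH.kappa_pos
  refine mul_pos (by positivity) ?_
  apply intervalIntegral.intervalIntegral_pos_of_pos_on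
  · apply ContinuousOn.intervalIntegrable
    rw [uIcc_of_le (by norm_num)]
    exact hH.continuousOn_one_div ε
  · exact fun ξ _ => one_div_pos.2 (hH.gDensity_pos ε ξ)
  · norm_num

/-- The derivative of the rescaling `sHat`. -/
noncomputable def sHatDeriv (H : ℝ → ℝ) (ε ξ : ℝ) : ℝ := 1 / (tau H ε * gDensity H ε ξ)

theorem IsDoubleWell.sHatDeriv_pos {H : ℝ → ℝ} (hH : IsDoubleWell H) (ε ξ : ℝ) :
    0 < sHatDeriv H ε ξ :=
  one_div_pos.2 (mul_pos (hH.tau_pos ε) (hH.gDensity_pos ε ξ))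

theorem IsDoubleWell.continuousOn_sHatDeriv {H : ℝ → ℝ} (hH : IsDoubleWell H) (ε : ℝ) :
    ContinuousOn (sHatDeriv H ε) (Icc (-1) 1) :=
  continuousOn_const.div (continuousOn_const.mul (hH.continuousOn_gDensity ε)) fun ξ _ =>
    (mul_pos (hH.tau_pos ε) (hH.gDensity_pos ε ξ)).ne'

theorem IsDoubleWell.intervalIntegrable_sHatDeriv {H : ℝ → ℝ} (hH : IsDoubleWell H) (ε : ℝ)
    {a b : ℝ} (ha : a ∈ Icc (-1 : ℝ) 1) (hb : b ∈ Icc (-1 : ℝ) 1) :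
    IntervalIntegrable (sHatDeriv H ε) volume a b :=
  ((hH.continuousOn_sHatDeriv ε).mono (by
    rw [← uIcc_of_le (show (-1 : ℝ) ≤ 1 by norm_num)] at ha hb ⊢
    exact uIcc_subset_uIcc ha hb)).intervalIntegrable

theorem IsDoubleWell.sHat_sub {H : ℝ → ℝ} (hH : IsDoubleWell H) (ε : ℝ)
    {a b : ℝ} (ha : a ∈ Icc (-1 : ℝ) 1) (hb : b ∈ Icc (-1 : ℝ) 1) :
    sHat H ε b - sHat H ε a = ∫ ξ in a..b, sHatDeriv H ε ξ :=
  have h0 : (0 : ℝ) ∈ Icc (-1 : ℝ) 1 := by norm_num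
  intervalIntegral.integral_interval_sub_left
    (hH.intervalIntegrable_sHatDeriv ε h0 hb) (hH.intervalIntegrable_sHatDeriv ε h0 ha)

theorem IsDoubleWell.monotoneOn_sHat {H : ℝ → ℝ} (hH : IsDoubleWell H) (ε : ℝ) :
    MonotoneOn (sHat H ε) (Icc (-1) 1) := fun a ha b hb hab => by
  rw [← sub_nonneg, hH.sHat_sub ε ha hb]
  exact intervalIntegral.integral_nonneg hab fun ξ _ => (hH.sHatDeriv_pos ε ξ).le

theorem IsDoubleWell.sHat_neg {H : ℝ → ℝ} (hH : IsDoubleWell H) (ε : ℝ) {ξ : ℝ}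
    (hξ : ξ ∈ Icc (-1 : ℝ) 1) : sHat H ε (-ξ) = -sHat H ε ξ := by
  have h : sHat H ε (-ξ) = ∫ η in (0 : ℝ)..(-ξ), sHatDeriv H ε (-η) := by
    refine intervalIntegral.integral_congr fun η hη => ?_
    have hη' : η ∈ Icc (-1 : ℝ) 1 := by
      have h0 : (0 : ℝ) ∈ uIcc (-1 : ℝ) 1 := by rw [uIcc_of_le] <;> norm_num
      have h1 : -ξ ∈ uIcc (-1 : ℝ) 1 := by
        rw [uIcc_of_le (by norm_num)]; constructor <;> linarith [hξ.1, hξ.2]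
      rw [← uIcc_of_le (by norm_num : (-1 : ℝ) ≤ 1)]
      exact uIcc_subset_uIcc h0 h1 hη
    simp only [sHatDeriv, hH.gDensity_neg ε hη']
  rw [h, intervalIntegral.integral_comp_neg (sHatDeriv H ε), neg_zero, neg_neg,
    intervalIntegral.integral_symm]
  rfl

/-- The normalisation of `tau` fixes the total length `2κ`, and oddness of `sHat` splits it evenly.
-/
theorem IsDoubleWell.sHat_one {H : ℝ → ℝ} (hH : IsDoubleWell H) (ε : ℝ) :
    sHat H ε 1 = kappa H := by
  have hτ := hH.tau_pos ε
  have hκ := hH.kappa_pos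
  have h1 : (1 : ℝ) ∈ Icc (-1 : ℝ) 1 := by norm_num
  have h2 : (-1 : ℝ) ∈ Icc (-1 : ℝ) 1 := by norm_num
  have h3 := hH.sHat_sub ε h2 h1
  rw [hH.sHat_neg ε h1] at h3
  have h4 : ∫ ξ in (-1 : ℝ)..1, sHatDeriv H ε ξ = 2 * kappa H := by
    have h5 : ∀ ξ, sHatDeriv H ε ξ = (tau H ε)⁻¹ * (1 / gDensity H ε ξ) := fun ξ => by
      rw [sHatDeriv, one_div, mul_inv, one_div]
    simp only [h5]
    rw [intervalIntegral.integral_const_mul]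
    have h6 : ∫ ξ in (-1 : ℝ)..1, 1 / gDensity H ε ξ = 2 * kappa H * tau H ε := by
      rw [tau]; field_simp
    rw [h6]
    field_simp
  linarith

theorem IsDoubleWell.sHat_mem {H : ℝ → ℝ} (hH : IsDoubleWell H) (ε : ℝ) {ξ : ℝ}
    (hξ : ξ ∈ Icc (-1 : ℝ) 1) : sHat H ε ξ ∈ Icc (-kappa H) (kappa H) := by
  have h1 : (1 : ℝ) ∈ Icc (-1 : ℝ) 1 := by norm_num
  have h2 : (-1 : ℝ) ∈ Icc (-1 : ℝ) 1 := by norm_num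
  rw [← hH.sHat_one ε, ← hH.sHat_neg ε h1]
  exact ⟨hH.monotoneOn_sHat ε h2 hξ hξ.1, hH.monotoneOn_sHat ε hξ h1 hξ.2⟩

theorem IsDoubleWell.aemeasurable_sHat {H : ℝ → ℝ} (hH : IsDoubleWell H) (ε : ℝ) :
    AEMeasurable (sHat H ε) (gammaMeasure H ε) := by
  have h : AEMeasurable (sHat H ε) (volume.restrict (Icc (-1) 1)) :=
    aemeasurable_restrict_of_monotoneOn measurableSet_Icc (hH.monotoneOn_sHat ε)
  exact h.mono_ac (withDensity_absolutelyContinuous _ _)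

theorem ae_mem_gammaMeasure (H : ℝ → ℝ) (ε : ℝ) :
    ∀ᵐ ξ ∂gammaMeasure H ε, ξ ∈ Icc (-1 : ℝ) 1 :=
  (withDensity_absolutelyContinuous _ _).ae_le (ae_restrict_mem measurableSet_Icc)

theorem IsDoubleWell.isProbabilityMeasure_gammaMeasure {H : ℝ → ℝ} (hH : IsDoubleWell H) (ε : ℝ) :
    IsProbabilityMeasure (gammaMeasure H ε) := by
  refine ⟨?_⟩
  rw [gammaMeasure, withDensity_apply _ MeasurableSet.univ, Measure.restrict_univ,
    lintegral_Icc_eq_ofReal_intervalIntegral (by norm_num) (hH.continuousOn_gDensity ε)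
      fun ξ _ => (hH.gDensity_pos ε ξ).le]
  have h := (hH.partitionFn_pos ε).ne'
  simp only [gDensity]
  rw [intervalIntegral.integral_const_mul, ← partitionFn, inv_mul_cancel₀ h, ENNReal.ofReal_one]

theorem IsDoubleWell.isProbabilityMeasure_gammaHat {H : ℝ → ℝ} (hH : IsDoubleWell H) (ε : ℝ) :
    IsProbabilityMeasure (gammaHat H ε) :=
  have := hH.isProbabilityMeasure_gammaMeasure ε
  Measure.isProbabilityMeasure_map (hH.aemeasurable_sHat ε)

theorem IsDoubleWell.ae_mem_gammaHat {H : ℝ → ℝ} (hH : IsDoubleWell H) (ε : ℝ) :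
    ∀ᵐ s ∂gammaHat H ε, s ∈ Icc (-kappa H) (kappa H) := by
  refine (ae_map_iff (hH.aemeasurable_sHat ε)
    (p := fun s => s ∈ Icc (-kappa H) (kappa H)) measurableSet_Icc).2 ?_
  exact (ae_mem_gammaMeasure H ε).mono fun ξ hξ => hH.sHat_mem ε hξ

theorem IsDoubleWell.map_neg_gammaMeasure {H : ℝ → ℝ} (hH : IsDoubleWell H) (ε : ℝ) :
    (gammaMeasure H ε).map (fun ξ => -ξ) = gammaMeasure H ε := by
  ext A hA
  have hA' : MeasurableSet ((fun ξ : ℝ => -ξ) ⁻¹' A) := measurable_neg hA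
  rw [Measure.map_apply measurable_neg hA, gammaMeasure, withDensity_apply _ hA,
    withDensity_apply _ hA', Measure.restrict_restrict hA, Measure.restrict_restrict hA',
    ← lintegral_indicator (hA.inter measurableSet_Icc),
    ← lintegral_indicator (hA'.inter measurableSet_Icc), ← lintegral_neg_eq_self]
  congr 1
  ext ξ
  have hiff : -ξ ∈ (fun ξ : ℝ => -ξ) ⁻¹' A ∩ Icc (-1) 1 ↔ ξ ∈ A ∩ Icc (-1) 1 := by
    simp only [mem_inter_iff, mem_preimage, neg_neg, mem_Icc]
    constructor <;> rintro ⟨h1, h2, h3⟩ <;> refine ⟨h1, ?_, ?_⟩ <;> linarith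
  by_cases hξ : ξ ∈ A ∩ Icc (-1) 1
  · rw [indicator_of_mem hξ, indicator_of_mem (hiff.2 hξ), hH.gDensity_neg ε hξ.2]
  · rw [indicator_of_notMem hξ, indicator_of_notMem (mt hiff.1 hξ)]

/-- The rescaling is odd, so it carries the evenness of `γ_ε` over to its image. -/
theorem IsDoubleWell.map_neg_gammaHat {H : ℝ → ℝ} (hH : IsDoubleWell H) (ε : ℝ) :
    (gammaHat H ε).map (fun s => -s) = gammaHat H ε := by
  have h1 : (fun s : ℝ => -s) ∘ sHat H ε =ᵐ[gammaMeasure H ε] sHat H ε ∘ fun ξ => -ξ :=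
    (ae_mem_gammaMeasure H ε).mono fun ξ hξ => (hH.sHat_neg ε hξ).symm
  have h2 : AEMeasurable (sHat H ε) ((gammaMeasure H ε).map fun ξ => -ξ) := by
    rw [hH.map_neg_gammaMeasure]
    exact hH.aemeasurable_sHat ε
  rw [gammaHat, AEMeasurable.map_map_of_aemeasurable measurable_neg.aemeasurable
    (hH.aemeasurable_sHat ε), Measure.map_congr h1,
    ← AEMeasurable.map_map_of_aemeasurable h2 measurable_neg.aemeasurable,
    hH.map_neg_gammaMeasure]

theorem tendsto_exp_neg_div_nhdsGT_zero {c : ℝ} (hc : 0 < c) :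
    Tendsto (fun ε : ℝ => Real.exp (-c / ε)) (𝓝[>] 0) (𝓝 0) := by
  have h : Tendsto (fun ε : ℝ => -c / ε) (𝓝[>] 0) atBot := by
    simpa only [div_eq_mul_inv] using
      tendsto_inv_nhdsGT_zero.const_mul_atTop_of_neg (by linarith : -c < 0)
  exact Real.tendsto_exp_atBot.comp h

theorem IsDoubleWell.exists_near_one_lt {H : ℝ → ℝ} (hH : IsDoubleWell H) {c : ℝ} (hc : 0 < c) :
    ∃ a ∈ Ioo (0 : ℝ) 1, ∀ ξ ∈ Icc a 1, H ξ ≤ c := by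
  obtain ⟨δ, hδ, h⟩ := Metric.continuousOn_iff.1 hH.continuousOn 1 (by norm_num) c hc
  refine ⟨max (1 / 2) (1 - δ / 2), ⟨by simp, by simp; constructor <;> linarith⟩, fun ξ hξ => ?_⟩
  have h1 := (le_max_left _ _).trans hξ.1
  have h2 := (le_max_right _ _).trans hξ.1
  have h3 := h ξ ⟨by linarith, hξ.2⟩ (by rw [Real.dist_eq, abs_lt]; constructor <;> linarith [hξ.2])
  rw [hH.at_one, Real.dist_eq, sub_zero] at h3
  exact (lt_of_abs_lt h3).le

theorem IsDoubleWell.exists_near_zero_gt {H : ℝ → ℝ} (hH : IsDoubleWell H) {c : ℝ} (hc : c < 1) :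
    ∃ a ∈ Ioo (0 : ℝ) 1, ∀ ξ ∈ Icc 0 a, c ≤ H ξ := by
  obtain ⟨δ, hδ, h⟩ := Metric.continuousOn_iff.1 hH.continuousOn 0 (by norm_num) (1 - c)
    (by linarith)
  refine ⟨min (1 / 2) (δ / 2), ⟨by simp [hδ], by simp; left; norm_num⟩, fun ξ hξ => ?_⟩
  have h1 := hξ.2.trans (min_le_left _ _)
  have h2 := hξ.2.trans (min_le_right _ _)
  have h3 := h ξ ⟨by linarith [hξ.1], by linarith⟩
    (by rw [Real.dist_eq, abs_lt]; constructor <;> linarith [hξ.1])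
  rw [hH.at_zero, Real.dist_eq] at h3
  linarith [(abs_lt.1 h3).1]

theorem sHatDeriv_eq (H : ℝ → ℝ) (ε ξ : ℝ) :
    sHatDeriv H ε ξ = partitionFn H ε / tau H ε * Real.exp (H ξ / ε) := by
  rw [sHatDeriv, gDensity, neg_div, Real.exp_neg]
  simp only [one_div, mul_inv, inv_inv]
  ring

/-- The rescaling sends the neighbourhoods of the wells close to the end points. -/
theorem IsDoubleWell.tendsto_sHat {H : ℝ → ℝ} (hH : IsDoubleWell H) {a : ℝ}
    (ha : a ∈ Ioo (0 : ℝ) 1) (hHa : ∀ ξ ∈ Icc a 1, H ξ ≤ 1 / 2) :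
    Tendsto (fun ε => sHat H ε a) (𝓝[>] 0) (𝓝 (kappa H)) := by
  obtain ⟨l, hl, hHl⟩ := hH.exists_near_zero_gt (c := 3 / 4) (by norm_num)
  have hκ := hH.kappa_pos
  have h1mem : (1 : ℝ) ∈ Icc (-1 : ℝ) 1 := by norm_num
  have h0mem : (0 : ℝ) ∈ Icc (-1 : ℝ) 1 := by norm_num
  have hamem : a ∈ Icc (-1 : ℝ) 1 := ⟨by linarith [ha.1], ha.2.le⟩
  have hup : ∀ ε, sHat H ε a ≤ kappa H := fun ε => (hH.sHat_mem ε hamem).2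
  have hlow : ∀ ε : ℝ, 0 < ε →
      kappa H - kappa H / l * Real.exp (-(1 / 4) / ε) ≤ sHat H ε a := by
    intro ε hε
    set c := partitionFn H ε / tau H ε with hc
    have hcpos : 0 < c := div_pos (hH.partitionFn_pos ε) (hH.tau_pos ε)
    have hpos : ∀ ξ, 0 ≤ sHatDeriv H ε ξ := fun ξ => (hH.sHatDeriv_pos ε ξ).le
    -- The barrier region `[0, l]` cannot occupy more than the length `κ`, which bounds the
    -- prefactor `c`.
    have h1 : c * Real.exp ((3 / 4) / ε) * (l - 0) ≤ kappa H := by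
      rw [← hH.sHat_one ε, sHat]
      refine mul_sub_le_intervalIntegral le_rfl hl.1.le hl.2.le
        ((hH.continuousOn_sHatDeriv ε).mono (Icc_subset_Icc (by norm_num) le_rfl))
        (fun ξ _ => hpos ξ) fun ξ hξ => ?_
      rw [← sHatDeriv, sHatDeriv_eq]
      have := hHl ξ hξ
      gcongr
    -- On `[a, 1]` the exponent is at most `1 / 2` instead of `3 / 4`, so this part of the rescaled
    -- interval is exponentially short.
    have h2 : kappa H - sHat H ε a ≤ c * Real.exp ((1 / 2) / ε) * (1 - a) := by
      rw [← hH.sHat_one ε, hH.sHat_sub ε hamem h1mem]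
      calc ∫ ξ in a..1, sHatDeriv H ε ξ ≤ ∫ _ in a..1, c * Real.exp ((1 / 2) / ε) := by
            refine intervalIntegral.integral_mono_on ha.2.le
              (hH.intervalIntegrable_sHatDeriv ε hamem h1mem) (by simp) fun ξ hξ => ?_
            rw [sHatDeriv_eq]
            have := hHa ξ hξ
            gcongr
        _ = c * Real.exp ((1 / 2) / ε) * (1 - a) := by
            rw [intervalIntegral.integral_const, smul_eq_mul, mul_comm]
    have h3 : Real.exp ((1 / 2) / ε) = Real.exp ((3 / 4) / ε) * Real.exp (-(1 / 4) / ε) := by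
      rw [← Real.exp_add]
      congr 1
      ring
    have h4 : c * Real.exp ((3 / 4) / ε) ≤ kappa H / l := by
      rw [le_div_iff₀ hl.1]
      simpa using h1
    have h5 : c * Real.exp ((1 / 2) / ε) * (1 - a) ≤ kappa H / l * Real.exp (-(1 / 4) / ε) := by
      rw [h3, ← mul_assoc]
      have h6 : c * Real.exp ((3 / 4) / ε) * Real.exp (-(1 / 4) / ε)
          ≤ kappa H / l * Real.exp (-(1 / 4) / ε) := by gcongr
      refine le_trans (mul_le_of_le_one_right (by positivity) (by linarith [ha.1])) h6
    linarith
  refine tendsto_of_tendsto_of_tendsto_of_le_of_le' ?_ tendsto_const_nhds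
    (eventually_mem_nhdsWithin.mono hlow) (Eventually.of_forall hup)
  simpa using ((tendsto_exp_neg_div_nhdsGT_zero (c := 1 / 4) (by norm_num)).const_mul
    (kappa H / l)).const_sub (kappa H)

/-- A crude Laplace estimate: with `h > 0` the minimum of `H` on `[-a, a]`, the numerator is of
order `exp (-h / ε)`, while the partition function is at least of order `exp (-h / (2ε))` thanks to
a neighbourhood of the well. -/
theorem IsDoubleWell.tendsto_gammaMeasure_Icc {H : ℝ → ℝ} (hH : IsDoubleWell H) {a : ℝ}
    (ha : a ∈ Ioo (0 : ℝ) 1) :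
    Tendsto (fun ε => gammaMeasure H ε (Icc (-a) a)) (𝓝[>] 0) (𝓝 0) := by
  have hsub : Icc (-a) a ⊆ Icc (-1) 1 := Icc_subset_Icc (by linarith [ha.2]) ha.2.le
  obtain ⟨ξ₀, hξ₀, hmin⟩ := isCompact_Icc.exists_isMinOn
    (nonempty_Icc.2 (by linarith [ha.1] : -a ≤ a)) (hH.continuousOn.mono hsub)
  set h := H ξ₀ with hh
  have hpos : 0 < h := hH.pos ξ₀ ⟨by linarith [hξ₀.1, ha.2], by linarith [hξ₀.2, ha.2]⟩
  obtain ⟨c, hc, hHc⟩ := hH.exists_near_one_lt (half_pos hpos)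
  have hle : ∀ ε : ℝ, 0 < ε → gammaMeasure H ε (Icc (-a) a)
      ≤ ENNReal.ofReal (Real.exp (-(h / 2) / ε) / (1 - c) * (2 * a)) := by
    intro ε hε
    have hZ : Real.exp (-(h / 2) / ε) * (1 - c) ≤ partitionFn H ε := by
      refine mul_sub_le_intervalIntegral (by linarith [hc.1]) hc.2.le le_rfl
        (hH.continuousOn_exp ε) (fun ξ _ => (Real.exp_pos _).le) fun ξ hξ => ?_
      have := hHc ξ hξ
      gcongr
    have hg : ∀ ξ ∈ Icc (-a) a, gDensity H ε ξ ≤ Real.exp (-(h / 2) / ε) / (1 - c) := by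
      intro ξ hξ
      have h1 : h ≤ H ξ := hmin hξ
      have hc' : 0 < 1 - c := by linarith [hc.2]
      -- One factor is absorbed by the lower bound of the partition function, the other one gives
      -- the decay.
      have h2 : Real.exp (-(H ξ) / ε) ≤ Real.exp (-(h / 2) / ε) * Real.exp (-(h / 2) / ε) := by
        rw [← Real.exp_add]
        have : -(h / 2) / ε + -(h / 2) / ε = -h / ε := by ring
        rw [this]
        gcongr
      rw [gDensity, inv_mul_eq_div, div_le_div_iff₀ (hH.partitionFn_pos ε) hc']
      have h3 := Real.exp_pos (-(h / 2) / ε)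
      nlinarith
    rw [gammaMeasure, withDensity_apply _ measurableSet_Icc,
      Measure.restrict_restrict measurableSet_Icc, inter_eq_left.2 hsub]
    refine (setLIntegral_mono' measurableSet_Icc
      fun ξ hξ => ENNReal.ofReal_le_ofReal (hg ξ hξ)).trans (le_of_eq ?_)
    rw [setLIntegral_const, Real.volume_Icc, ← ENNReal.ofReal_mul]
    · congr 2; ring
    · have : 0 < 1 - c := by linarith [hc.2]
      positivity
  refine tendsto_of_tendsto_of_tendsto_of_le_of_le' tendsto_const_nhds ?_
    (Eventually.of_forall fun _ => zero_le) (eventually_mem_nhdsWithin.mono hle)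
  have := ((tendsto_exp_neg_div_nhdsGT_zero (half_pos hpos)).div_const (1 - c)).mul_const (2 * a)
  rw [zero_div, zero_mul] at this
  simpa using ENNReal.tendsto_ofReal this

/-- The rescaled stationary measures concentrate at the end points. -/
theorem IsDoubleWell.tendsto_gammaHat_Icc {H : ℝ → ℝ} (hH : IsDoubleWell H) {r : ℝ}
    (hr : r < kappa H) :
    Tendsto (fun ε => gammaHat H ε (Icc (-r) r)) (𝓝[>] 0) (𝓝 0) := by
  obtain ⟨a, ha, hHa⟩ := hH.exists_near_one_lt (c := 1 / 2) (by norm_num)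
  refine tendsto_of_tendsto_of_tendsto_of_le_of_le' tendsto_const_nhds
    (hH.tendsto_gammaMeasure_Icc ha) (Eventually.of_forall fun _ => zero_le) ?_
  filter_upwards [(hH.tendsto_sHat ha hHa).eventually_const_lt hr] with ε hε
  have hamem : a ∈ Icc (-1 : ℝ) 1 := ⟨by linarith [ha.1], ha.2.le⟩
  have hamem' : -a ∈ Icc (-1 : ℝ) 1 := ⟨by linarith [ha.2], by linarith [ha.1]⟩
  rw [gammaHat, Measure.map_apply_of_aemeasurable (hH.aemeasurable_sHat ε) measurableSet_Icc]
  refine measure_mono_ae ?_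
  filter_upwards [ae_mem_gammaMeasure H ε] with ξ hξ hs
  have hs' : sHat H ε ξ ∈ Icc (-r) r := hs
  constructor
  · by_contra hlt
    have := hH.monotoneOn_sHat ε hξ hamem' (not_le.1 hlt).le
    rw [hH.sHat_neg ε hamem] at this
    linarith [hs'.1]
  · by_contra hlt
    have := hH.monotoneOn_sHat ε hamem hξ (not_le.1 hlt).le
    linarith [hs'.2]

/-! ### Even measures concentrating at the end points -/

/-- Even probability measures on `[-κ, κ]` that concentrate at `±κ` as the parameter tends to `0`. -/
structure IsConcentrating (κ : ℝ) (γ : ℝ → Measure ℝ) : Prop where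
  prob : ∀ ε, IsProbabilityMeasure (γ ε)
  ae_mem : ∀ ε, ∀ᵐ s ∂γ ε, s ∈ Icc (-κ) κ
  map_neg : ∀ ε, (γ ε).map (fun s => -s) = γ ε
  tendsto_Icc : ∀ r < κ, Tendsto (fun ε => γ ε (Icc (-r) r)) (𝓝[>] 0) (𝓝 0)

theorem IsDoubleWell.isConcentrating {H : ℝ → ℝ} (hH : IsDoubleWell H) :
    IsConcentrating (kappa H) (gammaHat H) where
  prob := hH.isProbabilityMeasure_gammaHat
  ae_mem := hH.ae_mem_gammaHat
  map_neg := hH.map_neg_gammaHat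
  tendsto_Icc _ hr := hH.tendsto_gammaHat_Icc hr

theorem IsConcentrating.integrable {κ : ℝ} {γ : ℝ → Measure ℝ} (hγ : IsConcentrating κ γ) (ε : ℝ)
    {f : ℝ → ℝ} (hf : Measurable f) {C : ℝ} (hC : ∀ s ∈ Icc (-κ) κ, |f s| ≤ C) :
    Integrable f (γ ε) :=
  have := hγ.prob ε
  Integrable.of_bound hf.aestronglyMeasurable C ((hγ.ae_mem ε).mono hC)

theorem IsConcentrating.integrable_of_continuous {κ : ℝ} {γ : ℝ → Measure ℝ}
    (hγ : IsConcentrating κ γ) (ε : ℝ) {f : ℝ → ℝ} (hf : Continuous f) : Integrable f (γ ε) := by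
  obtain ⟨C, hC⟩ := (isCompact_Icc (a := -κ) (b := κ)).exists_bound_of_continuousOn hf.continuousOn
  exact hγ.integrable ε hf.measurable hC

theorem IsConcentrating.setIntegral {κ : ℝ} {γ : ℝ → Measure ℝ} (hγ : IsConcentrating κ γ) (ε : ℝ)
    (f : ℝ → ℝ) : ∫ s in Icc (-κ) κ, f s ∂γ ε = ∫ s, f s ∂γ ε := by
  rw [Measure.restrict_eq_self_of_ae_mem (hγ.ae_mem ε)]

theorem IsConcentrating.integral_comp_neg {κ : ℝ} {γ : ℝ → Measure ℝ} (hγ : IsConcentrating κ γ)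
    (ε : ℝ) (f : ℝ → ℝ) : ∫ s, f (-s) ∂γ ε = ∫ s, f s ∂γ ε := by
  conv_rhs => rw [← hγ.map_neg ε]
  exact ((MeasurableEquiv.neg ℝ).measurableEmbedding.integral_map f).symm

/-- Evenness allows `f` to be replaced by its even part, which is close to `(Lm + Lp) / 2` near both
end points; the remaining region has vanishing mass and `f` is bounded there. The integrand may
depend on `ε`, and continuity is only needed at `±κ`, so that indicators of half lines are allowed.
-/
theorem IsConcentrating.tendsto_integral {κ : ℝ} {γ : ℝ → Measure ℝ} (hγ : IsConcentrating κ γ)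
    {f : ℝ → ℝ → ℝ} (hf : ∀ ε, Measurable (f ε)) {C Lm Lp : ℝ}
    (hC : ∀ᶠ ε in 𝓝[>] 0, ∀ s ∈ Icc (-κ) κ, |f ε s| ≤ C)
    (hm : Tendsto (Function.uncurry f) (𝓝[>] 0 ×ˢ 𝓝 (-κ)) (𝓝 Lm))
    (hp : Tendsto (Function.uncurry f) (𝓝[>] 0 ×ˢ 𝓝 κ) (𝓝 Lp)) :
    Tendsto (fun ε => ∫ s, f ε s ∂γ ε) (𝓝[>] 0) (𝓝 ((Lm + Lp) / 2)) := by
  rw [Metric.tendsto_nhds]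
  intro η hη
  obtain ⟨pm, hpm, qm, hqm, hfm⟩ := eventually_prod_iff.1 (Metric.tendsto_nhds.1 hm (η / 2)
    (by positivity))
  obtain ⟨pp, hpp, qp, hqp, hfp⟩ := eventually_prod_iff.1 (Metric.tendsto_nhds.1 hp (η / 2)
    (by positivity))
  obtain ⟨δm, hδm, hqm⟩ := Metric.eventually_nhds_iff.1 hqm
  obtain ⟨δp, hδp, hqp⟩ := Metric.eventually_nhds_iff.1 hqp
  set δ := min δm δp with hδdef
  have hδ : 0 < δ := lt_min hδm hδp
  set L := (Lm + Lp) / 2 with hL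
  set r := κ - δ with hr
  have hdecay : Tendsto (fun ε => (C + |L|) * (γ ε).real (Icc (-r) r)) (𝓝[>] 0) (𝓝 0) := by
    have h := (ENNReal.tendsto_toReal ENNReal.zero_ne_top).comp
      (hγ.tendsto_Icc r (by linarith))
    simpa [Measure.real] using h.const_mul (C + |L|)
  filter_upwards [hC, hpm, hpp, hdecay.eventually_lt_const (half_pos hη)] with ε hC hpm hpp hsmall
  have := hγ.prob ε
  set h : ℝ → ℝ := fun s => (f ε s + f ε (-s)) / 2 with hh
  have hif : Integrable (f ε) (γ ε) := hγ.integrable ε (hf ε) hC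
  have hif' : Integrable (fun s => f ε (-s)) (γ ε) := by
    refine hγ.integrable ε ((hf ε).comp measurable_neg) (C := C) fun s hs => hC (-s) ?_
    constructor <;> linarith [hs.1, hs.2]
  have hih : Integrable h (γ ε) := (hif.add hif').div_const 2
  have hint : ∫ s, f ε s ∂γ ε = ∫ s, h s ∂γ ε := by
    simp only [hh]
    rw [integral_div, integral_add hif hif', hγ.integral_comp_neg]
    ring
  have hbound : ∀ s ∈ Icc (-κ) κ,
      |h s - L| ≤ η / 2 + (C + |L|) * (Icc (-r) r).indicator (fun _ => (1 : ℝ)) s := by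
    intro s hs
    by_cases hsr : s ∈ Icc (-r) r
    · rw [indicator_of_mem hsr]
      have h1 := abs_le.1 (hC s hs)
      have h2 := abs_le.1 (hC (-s) ⟨by linarith [hs.2], by linarith [hs.1]⟩)
      have h3 : |h s| ≤ C := by
        rw [abs_le]
        constructor <;> simp only [hh] <;> linarith [h1.1, h1.2, h2.1, h2.2]
      linarith [abs_sub (h s) L]
    · rw [indicator_of_notMem hsr, mul_zero, add_zero]
      have hcase : r < s ∨ s < -r := by
        by_contra hcon
        push Not at hcon
        exact hsr ⟨hcon.2, hcon.1⟩
      have hδm' := min_le_left δm δp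
      have hδp' := min_le_right δm δp
      -- For `s` near `κ` the reflected point is near `-κ`, so both limits enter, with weight one
      -- half each; the case of `s` near `-κ` follows by evenness of `h`.
      have key : ∀ s ∈ Icc (-κ) κ, r < s → |h s - L| ≤ η / 2 := by
        intro s hs hrs
        have h1 := hfp hpp (hqp (y := s) (by
          rw [Real.dist_eq, abs_lt]; constructor <;> linarith [hs.2]))
        have h2 := hfm hpm (hqm (y := -s) (by
          rw [Real.dist_eq, abs_lt]; constructor <;> linarith [hs.2]))
        simp only [Function.uncurry, Real.dist_eq] at h1 h2
        rw [abs_lt] at h1 h2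
        rw [abs_le]
        constructor <;> simp only [hh, hL] <;> linarith [h1.1, h1.2, h2.1, h2.2]
      rcases hcase with hcase | hcase
      · exact key s hs hcase
      · have h1 := key (-s) ⟨by linarith [hs.2], by linarith [hs.1]⟩ (by linarith)
        have h2 : h (-s) = h s := by simp only [hh, neg_neg, add_comm]
        rwa [h2] at h1
  have hind : Integrable (fun s => η / 2 + (C + |L|) * (Icc (-r) r).indicator (fun _ => (1 : ℝ)) s)
      (γ ε) :=
    (integrable_const _).add (((integrable_const _).indicator measurableSet_Icc).const_mul _)
  have hfin : |∫ s, f ε s ∂γ ε - L| ≤ η / 2 + (C + |L|) * (γ ε).real (Icc (-r) r) := by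
    have e1 : ∫ s, f ε s ∂γ ε - L = ∫ s, (h s - L) ∂γ ε := by
      rw [integral_sub hih (integrable_const _), hint]
      simp
    rw [e1]
    refine (abs_integral_le_integral_abs).trans ?_
    refine (integral_mono_ae (hih.sub (integrable_const _)).abs hind
      ((hγ.ae_mem ε).mono hbound)).trans (le_of_eq ?_)
    rw [integral_add (integrable_const _)
      (((integrable_const _).indicator measurableSet_Icc).const_mul _), integral_const_mul,
      integral_indicator_const _ measurableSet_Icc]
    simp
  rw [Real.dist_eq]
  linarith

/-- The mean `∫ bump dγ_ε`. -/
noncomputable def bumpMean (κ : ℝ) (γ : ℝ → Measure ℝ) (ε : ℝ) : ℝ := ∫ s, bump κ s ∂γ ε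

theorem continuous_bump (κ : ℝ) : Continuous (bump κ) := by
  unfold bump
  fun_prop

theorem bump_right (κ : ℝ) : bump κ κ = 0 := by simp [bump]

theorem bump_left (κ : ℝ) : bump κ (-κ) = 0 := by simp [bump]

theorem IsConcentrating.tendsto_integral_of_continuous {κ : ℝ} {γ : ℝ → Measure ℝ}
    (hγ : IsConcentrating κ γ) {f : ℝ → ℝ} (hf : Continuous f) :
    Tendsto (fun ε => ∫ s, f s ∂γ ε) (𝓝[>] 0) (𝓝 ((f (-κ) + f κ) / 2)) := by
  obtain ⟨C, hC⟩ := (isCompact_Icc (a := -κ) (b := κ)).exists_bound_of_continuousOn hf.continuousOn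
  exact hγ.tendsto_integral (f := fun _ => f) (fun _ => hf.measurable)
    (Eventually.of_forall fun _ => hC) ((hf.tendsto _).comp tendsto_snd)
    ((hf.tendsto _).comp tendsto_snd)

theorem IsConcentrating.tendsto_bumpMean {κ : ℝ} {γ : ℝ → Measure ℝ} (hγ : IsConcentrating κ γ) :
    Tendsto (bumpMean κ γ) (𝓝[>] 0) (𝓝 0) := by
  have h := hγ.tendsto_integral_of_continuous (continuous_bump κ)
  rwa [bump_right, bump_left, add_zero, zero_div] at h

theorem IsConcentrating.integral_div_eq_zero {κ : ℝ} {γ : ℝ → Measure ℝ}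
    (hγ : IsConcentrating κ γ) (ε : ℝ) : ∫ s, s / κ ∂γ ε = 0 := by
  have h := hγ.integral_comp_neg ε fun s => s / κ
  simp only [neg_div] at h
  rw [integral_neg] at h
  linarith

theorem IsConcentrating.integral_bump_sub {κ : ℝ} {γ : ℝ → Measure ℝ}
    (hγ : IsConcentrating κ γ) (ε : ℝ) : ∫ s, (bump κ s - bumpMean κ γ ε) ∂γ ε = 0 := by
  have := hγ.prob ε
  rw [integral_sub (hγ.integrable_of_continuous ε (continuous_bump κ)) (integrable_const _)]
  simp [bumpMean]

/-! ### Uniqueness of the flux -/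

theorem hasDerivAt_left_of_contDiff {φ : ℝ × ℝ → ℝ} (hφ : ContDiff ℝ 1 φ) (t s : ℝ) :
    HasDerivAt (fun r => φ (r, s)) (fderiv ℝ φ (t, s) (1, 0)) t := by
  have h1 : HasFDerivAt φ (fderiv ℝ φ (t, s)) (t, s) :=
    (hφ.differentiable one_ne_zero).differentiableAt.hasFDerivAt
  exact h1.comp_hasDerivAt t ((hasDerivAt_id t).prodMk (hasDerivAt_const t s))

theorem continuous_deriv_left {φ : ℝ × ℝ → ℝ} (hφ : ContDiff ℝ 1 φ) :
    Continuous fun p : ℝ × ℝ => deriv (fun r => φ (r, p.2)) p.1 := by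
  have h : (fun p : ℝ × ℝ => deriv (fun r => φ (r, p.2)) p.1)
      = fun p => fderiv ℝ φ p (1, 0) :=
    funext fun p => (hasDerivAt_left_of_contDiff hφ p.1 p.2).deriv
  rw [h]
  exact (hφ.continuous_fderiv one_ne_zero).clm_apply continuous_const

/-- By Weierstrass approximation, vanishing moments force the integral against every continuous
function to vanish. -/
theorem integral_pow_mul_eq_zero_imp {a b : ℝ} {f : ℝ → ℝ} (hf : IntegrableOn f (Icc a b))
    (h : ∀ k : ℕ, ∫ s in Icc a b, s ^ k * f s = 0) : ∀ᵐ s ∂volume.restrict (Icc a b), f s = 0 := by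
  have hmul : ∀ g : ℝ → ℝ, ContinuousOn g (Icc a b) →
      IntegrableOn (fun s => g s * f s) (Icc a b) := fun g hg =>
    hf.continuousOn_mul hg isCompact_Icc
  have hpoly : ∀ p : Polynomial ℝ, ∫ s in Icc a b, p.eval s * f s = 0 := by
    intro p
    simp only [Polynomial.eval_eq_sum_range, Finset.sum_mul]
    rw [integral_finsetSum _ fun k _ => ?_]
    · refine Finset.sum_eq_zero fun k _ => ?_
      simp only [mul_assoc]
      rw [integral_const_mul, h k, mul_zero]
    · exact hmul _ (by fun_prop)
  have hcont : ∀ g : ℝ → ℝ, ContinuousOn g (Icc a b) → ∫ s in Icc a b, g s * f s = 0 := by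
    intro g hg
    have hle : ∀ η > 0, |∫ s in Icc a b, g s * f s| ≤ η * ∫ s in Icc a b, |f s| := by
      intro η hη
      obtain ⟨p, hp⟩ := exists_polynomial_near_of_continuousOn a b g hg η hη
      have e : ∫ s in Icc a b, g s * f s = ∫ s in Icc a b, (g s - p.eval s) * f s := by
        simp only [sub_mul]
        rw [integral_sub (hmul g hg) (hmul _ (by fun_prop)), hpoly, sub_zero]
      rw [e, ← integral_const_mul]
      refine abs_integral_le_integral_abs.trans ?_
      refine setIntegral_mono_on (hmul _ (hg.sub (by fun_prop))).abs (hf.abs.const_mul _)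
        measurableSet_Icc fun s hs => ?_
      rw [abs_mul]
      have := hp s hs
      rw [abs_sub_comm] at this
      gcongr
    have hlim : Tendsto (fun η : ℝ => η * ∫ s in Icc a b, |f s|) (𝓝[>] 0) (𝓝 0) := by
      have : Tendsto (fun η : ℝ => η * ∫ s in Icc a b, |f s|) (𝓝 0)
          (𝓝 (0 * ∫ s in Icc a b, |f s|)) := tendsto_id.mul_const _
      rw [zero_mul] at this
      exact this.mono_left nhdsWithin_le_nhds
    have := ge_of_tendsto hlim (eventually_mem_nhdsWithin.mono hle)
    simpa using this
  rw [ae_restrict_iff' measurableSet_Icc]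
  have hind : Integrable ((Icc a b).indicator f) := hf.integrable_indicator measurableSet_Icc
  have hzero := ae_eq_zero_of_integral_contDiff_smul_eq_zero (μ := volume)
    (f := (Icc a b).indicator f) hind.locallyIntegrable (by
      intro g hg _
      have : (fun s => g s • (Icc a b).indicator f s)
          = (Icc a b).indicator fun s => g s * f s := by
        ext s
        by_cases hs : s ∈ Icc a b <;> simp [hs]
      rw [this, integral_indicator measurableSet_Icc]
      exact hcont g hg.continuous.continuousOn)
  filter_upwards [hzero] with s hs hmem
  rwa [indicator_of_mem hmem] at hs

/-- The test function `a(t) s^(k+1) / (k+1)`, cut off outside `[-κ, κ]`. -/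
noncomputable def momentTest (a : ℝ → ℝ) (k : ℕ) (χ : ContDiffBump (0 : ℝ))
    (p : ℝ × ℝ) : ℝ :=
  a p.1 * (χ p.2 * (p.2 ^ (k + 1) / (k + 1)))

/-- The test function has space derivative `a(t) s^k` on `[-κ, κ]`, so the weak equation expresses
each moment of the flux, tested in time, through the density alone. This uses that test functions
need not vanish at `±κ`. -/
theorem ContinuityEquation.integral_mul_moment {κ T : ℝ} {γ : Measure ℝ} {u w : ℝ → ℝ → ℝ}
    (h : ContinuityEquation κ T γ u w) {a : ℝ → ℝ} (ha : ContDiff ℝ ∞ a)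
    (hac : HasCompactSupport a) (hsupp : tsupport a ⊆ Ioo 0 T) (k : ℕ) {χ : ContDiffBump (0 : ℝ)}
    (hχ : κ < χ.rIn) :
    ∫ t in Icc 0 T, a t * ∫ s in Icc (-κ) κ, s ^ k * w t s
      = -∫ t in Icc 0 T, ∫ s in Icc (-κ) κ,
          deriv (fun r => momentTest a k χ (r, s)) t * u t s ∂γ := by
  have hsub : tsupport (momentTest a k χ) ⊆ tsupport a ×ˢ tsupport χ := by
    refine closure_minimal (fun p hp => ?_) ((isClosed_tsupport a).prod (isClosed_tsupport χ))
    have h1 : a p.1 ≠ 0 := fun h0 => hp (by simp [momentTest, h0])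
    have h2 : χ p.2 ≠ 0 := fun h0 => hp (by simp [momentTest, h0])
    exact ⟨subset_tsupport a h1, subset_tsupport χ h2⟩
  have hcd : ContDiff ℝ ∞ (momentTest a k χ) := by
    have : ContDiff ℝ ∞ χ := χ.contDiff
    unfold momentTest
    fun_prop
  have hcomp : HasCompactSupport (momentTest a k χ) :=
    (hac.isCompact.prod χ.hasCompactSupport.isCompact).of_isClosed_subset
      (isClosed_tsupport _) hsub
  have key := h.weak_eq _ hcd hcomp
    (hsub.trans (prod_mono hsupp (subset_univ _)))
  rw [eq_neg_iff_add_eq_zero, add_comm]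
  refine Eq.trans (congrArg₂ (· + ·) rfl ?_) key
  refine setIntegral_congr_fun measurableSet_Icc fun t _ => ?_
  rw [← integral_const_mul]
  refine setIntegral_congr_fun measurableSet_Icc fun s hs => ?_
  -- The cut-off equals `1` on a neighbourhood of `s`, because `|s| ≤ κ < χ.rIn`; the derivative
  -- therefore does not see it.
  have hev : (fun r => momentTest a k χ (t, r)) =ᶠ[𝓝 s]
      fun r => a t * (r ^ (k + 1) / (k + 1)) := by
    have hmem : s ∈ Metric.ball (0 : ℝ) χ.rIn := by
      rw [Metric.mem_ball, Real.dist_eq, sub_zero, abs_lt]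
      constructor <;> linarith [hs.1, hs.2]
    filter_upwards [Metric.isOpen_ball.mem_nhds hmem] with r hr
    rw [momentTest, χ.one_of_mem_closedBall (Metric.ball_subset_closedBall hr), one_mul]
  have hd : HasDerivAt (fun r : ℝ => a t * (r ^ (k + 1) / ((k : ℝ) + 1))) (a t * s ^ k) s := by
    refine (((hasDerivAt_pow (k + 1) s).div_const ((k : ℝ) + 1)).const_mul (a t)).congr_deriv ?_
    push_cast
    field_simp
  rw [hev.deriv_eq, hd.deriv, mul_assoc]

theorem ContinuityEquation.integrable_moment {κ T : ℝ} {γ : Measure ℝ} {u w : ℝ → ℝ → ℝ}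
    (h : ContinuityEquation κ T γ u w) (k : ℕ) :
    IntegrableOn (fun t => ∫ s in Icc (-κ) κ, s ^ k * w t s) (Icc 0 T) := by
  have h1 : IntegrableOn (fun p : ℝ × ℝ => p.2 ^ k * Function.uncurry w p)
      (Icc 0 T ×ˢ Icc (-κ) κ) :=
    h.integrable_flux.continuousOn_mul (by fun_prop) (isCompact_Icc.prod isCompact_Icc)
  rw [IntegrableOn, Measure.volume_eq_prod, ← Measure.prod_restrict] at h1
  exact h1.integral_prod_left

theorem ContinuityEquation.ae_integrableOn {κ T : ℝ} {γ : Measure ℝ} {u w : ℝ → ℝ → ℝ}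
    (h : ContinuityEquation κ T γ u w) :
    ∀ᵐ t ∂volume.restrict (Icc 0 T), IntegrableOn (w t) (Icc (-κ) κ) := by
  have h1 := h.integrable_flux
  rw [IntegrableOn, Measure.volume_eq_prod, ← Measure.prod_restrict] at h1
  exact h1.prod_right_ae

/-- The flux in the continuity equation is unique up to null sets. -/
theorem ContinuityEquation.flux_unique {κ T : ℝ} {γ : Measure ℝ} {u w₁ w₂ : ℝ → ℝ → ℝ}
    (hκ : 0 < κ) (h₁ : ContinuityEquation κ T γ u w₁) (h₂ : ContinuityEquation κ T γ u w₂) :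
    ∀ᵐ t ∂volume.restrict (Icc 0 T), ∀ᵐ s ∂volume.restrict (Icc (-κ) κ), w₁ t s = w₂ t s := by
  let χ : ContDiffBump (0 : ℝ) := ⟨κ + 1, κ + 2, by linarith, by linarith⟩
  have hχ : κ < χ.rIn := by
    change κ < κ + 1
    linarith
  have hmom : ∀ k : ℕ, ∀ᵐ t ∂volume.restrict (Icc 0 T),
      ∫ s in Icc (-κ) κ, s ^ k * w₁ t s = ∫ s in Icc (-κ) κ, s ^ k * w₂ t s := by
    intro k
    have hi := (h₁.integrable_moment k).sub (h₂.integrable_moment k)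
    have hz := isOpen_Ioo.ae_eq_zero_of_integral_contDiff_smul_eq_zero (U := Ioo 0 T)
      (μ := volume) (f := (fun t => ∫ s in Icc (-κ) κ, s ^ k * w₁ t s)
        - fun t => ∫ s in Icc (-κ) κ, s ^ k * w₂ t s)
      ((hi.mono_set Ioo_subset_Icc_self).locallyIntegrableOn) (by
        intro a ha hac hsupp
        rw [← setIntegral_eq_integral_of_forall_compl_eq_zero (s := Icc 0 T)]
        · have e1 : IntegrableOn (fun t => a t * ∫ s in Icc (-κ) κ, s ^ k * w₁ t s) (Icc 0 T) :=
            (h₁.integrable_moment k).continuousOn_mul ha.continuous.continuousOn isCompact_Icc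
          have e2 : IntegrableOn (fun t => a t * ∫ s in Icc (-κ) κ, s ^ k * w₂ t s) (Icc 0 T) :=
            (h₂.integrable_moment k).continuousOn_mul ha.continuous.continuousOn isCompact_Icc
          simp only [Pi.sub_apply, smul_eq_mul, mul_sub]
          rw [integral_sub e1 e2, h₁.integral_mul_moment ha hac hsupp k hχ,
            h₂.integral_mul_moment ha hac hsupp k hχ, sub_self]
        · intro t ht
          have : a t = 0 := image_eq_zero_of_notMem_tsupport fun h0 =>
            ht (Ioo_subset_Icc_self (hsupp h0))
          simp [this])
    rw [← restrict_Ioo_eq_restrict_Icc (a := (0 : ℝ)) (b := T), ae_restrict_iff' measurableSet_Ioo]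
    filter_upwards [hz] with t ht hmem
    exact sub_eq_zero.1 (ht hmem)
  -- There are only countably many moments, so a single null set of times serves them all.
  filter_upwards [ae_all_iff.2 hmom, h₁.ae_integrableOn, h₂.ae_integrableOn] with t ht hi₁ hi₂
  have hmul : ∀ (k : ℕ) (f : ℝ → ℝ), IntegrableOn f (Icc (-κ) κ) →
      IntegrableOn (fun s => s ^ k * f s) (Icc (-κ) κ) := fun k f hf =>
    hf.continuousOn_mul (by fun_prop) isCompact_Icc
  have hz := integral_pow_mul_eq_zero_imp (hi₁.sub hi₂) fun k => by
    simp only [Pi.sub_apply, mul_sub]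
    rw [integral_sub (hmul k _ hi₁) (hmul k _ hi₂), ht k, sub_self]
  filter_upwards [hz] with s hs
  exact sub_eq_zero.1 hs

/-! ### The recovery profile, its flux and its dissipation -/

/-- The mean of `f` to the left of `s`. -/
noncomputable def leftMean (γ : Measure ℝ) (f : ℝ → ℝ) (s : ℝ) : ℝ := ∫ r in Iio s, f r ∂γ

theorem leftMean_eq (γ : Measure ℝ) (f : ℝ → ℝ) (s : ℝ) :
    leftMean γ f s = ∫ r, (Iio s).indicator f r ∂γ := by
  rw [leftMean, integral_indicator measurableSet_Iio]

theorem measurable_indicator_Iio {f : ℝ → ℝ} (hf : Measurable f) :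
    Measurable fun p : ℝ × ℝ => (Iio p.1).indicator f p.2 := by
  have h : (fun p : ℝ × ℝ => (Iio p.1).indicator f p.2)
      = {p : ℝ × ℝ | p.2 < p.1}.indicator fun p => f p.2 := by
    ext p
    simp [indicator]
  rw [h]
  exact (hf.comp measurable_snd).indicator (measurableSet_lt measurable_snd measurable_fst)

theorem measurable_leftMean (γ : Measure ℝ) [SFinite γ] {f : ℝ → ℝ} (hf : Measurable f) :
    Measurable (leftMean γ f) := by
  have h : leftMean γ f = fun s => ∫ r, (Iio s).indicator f r ∂γ := funext (leftMean_eq γ f)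
  rw [h]
  exact ((measurable_indicator_Iio hf).stronglyMeasurable.integral_prod_right).measurable

theorem abs_leftMean_le {γ : Measure ℝ} [IsProbabilityMeasure γ] {f : ℝ → ℝ} {C : ℝ}
    (hf : ∀ᵐ s ∂γ, |f s| ≤ C) (s : ℝ) : |leftMean γ f s| ≤ C := by
  have h0 : 0 ≤ C := by
    obtain ⟨r, hr⟩ := hf.exists
    exact (abs_nonneg _).trans hr
  have h := norm_setIntegral_le_of_norm_le_const_ae' (s := Iio s) (measure_lt_top γ _)
    (hf.mono fun r hr _ => (Real.norm_eq_abs (f r)).trans_le hr)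
  exact h.trans (mul_le_of_le_one_right h0 measureReal_le_one)

/-- Integration by parts against the left means of a function of mean zero. -/
theorem integral_deriv_mul_leftMean {κ : ℝ} {γ : Measure ℝ} [IsProbabilityMeasure γ]
    (hγ : ∀ᵐ s ∂γ, s ∈ Icc (-κ) κ) {f : ℝ → ℝ} (hf : Continuous f) (hint : Integrable f γ)
    (h0 : ∫ s, f s ∂γ = 0) {φ : ℝ → ℝ} (hφ : ContDiff ℝ 1 φ) :
    ∫ s in Icc (-κ) κ, deriv φ s * leftMean γ f s = -∫ s, φ s * f s ∂γ := by
  have hφ' : Continuous (deriv φ) := hφ.continuous_deriv le_rfl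
  have hprod : Integrable (Function.uncurry fun s r => deriv φ s * (Iio s).indicator f r)
      ((volume.restrict (Icc (-κ) κ)).prod γ) := by
    have h1 : Integrable (fun p : ℝ × ℝ => deriv φ p.1 * f p.2)
        ((volume.restrict (Icc (-κ) κ)).prod γ) :=
      (hφ'.continuousOn.integrableOn_Icc).mul_prod hint
    refine h1.mono ?_ (Eventually.of_forall fun p => ?_)
    · exact ((hφ'.measurable.comp measurable_fst).mul
        (measurable_indicator_Iio hf.measurable)).aestronglyMeasurable
    · simp only [Function.uncurry, norm_mul]
      gcongr
      exact norm_indicator_le_norm_self _ _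
  have hintφ : Integrable (fun s => φ s * f s) γ := by
    obtain ⟨C, hC⟩ := (isCompact_Icc (a := -κ) (b := κ)).exists_bound_of_continuousOn
      hφ.continuous.continuousOn
    exact hint.bdd_mul hφ.continuous.aestronglyMeasurable (hγ.mono hC)
  calc ∫ s in Icc (-κ) κ, deriv φ s * leftMean γ f s
      = ∫ s in Icc (-κ) κ, ∫ r, deriv φ s * (Iio s).indicator f r ∂γ := by
        simp only [leftMean_eq, integral_const_mul]
    _ = ∫ r, (∫ s in Icc (-κ) κ, deriv φ s * (Iio s).indicator f r) ∂γ :=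
        integral_integral_swap hprod
    _ = ∫ r, (φ κ * f r - φ r * f r) ∂γ := by
        refine integral_congr_ae (hγ.mono fun r hr => ?_)
        simp only []
        -- After the exchange of integrals `r` is fixed, and `s` runs over the points to its right.
        have e : ∀ s, deriv φ s * (Iio s).indicator f r
            = (Ioi r).indicator (fun s => deriv φ s) s * f r := by
          intro s
          by_cases hrs : r < s <;> simp [indicator, hrs]
        simp only [e]
        rw [integral_mul_const, integral_indicator measurableSet_Ioi,
          Measure.restrict_restrict measurableSet_Ioi]
        have e2 : Ioi r ∩ Icc (-κ) κ = Ioc r κ := by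
          ext s
          simp only [mem_inter_iff, mem_Ioi, mem_Icc, mem_Ioc]
          constructor
          · rintro ⟨h1, h2, h3⟩
            exact ⟨h1, h3⟩
          · rintro ⟨h1, h2⟩
            exact ⟨h1, by linarith [hr.1], h2⟩
        rw [e2, ← intervalIntegral.integral_of_le hr.2, intervalIntegral.integral_deriv_eq_sub
          (fun s _ => (hφ.differentiable one_ne_zero) s) (hφ'.intervalIntegrable _ _)]
        ring
    _ = -∫ s, φ s * f s ∂γ := by
        -- The boundary term at `κ` carries the total integral of `f`, which is zero.
        rw [integral_sub (hint.const_mul _) hintφ, integral_const_mul, h0]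
        ring

/-- The profile with mean `m` with respect to `γ_ε`, if `μ` is the mean of `bump`. -/
noncomputable def recovery (κ m μ : ℝ) (b ρ : ℝ → ℝ) (t s : ℝ) : ℝ :=
  profile κ (m - ρ t * μ) (b t) (ρ t) s

theorem recovery_eq (κ m μ : ℝ) (b ρ : ℝ → ℝ) (t s : ℝ) :
    recovery κ m μ b ρ t s = m + b t * (s / κ) + ρ t * (bump κ s - μ) := by
  rw [recovery, profile]
  ring

/-- The flux of the recovery profile. -/
noncomputable def recoveryFlux (κ μ : ℝ) (γ : Measure ℝ) (b ρ : ℝ → ℝ) (t s : ℝ) : ℝ :=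
  -(deriv b t * leftMean γ (fun r => r / κ) s + deriv ρ t * leftMean γ (fun r => bump κ r - μ) s)

theorem contDiff_recovery (κ m μ : ℝ) {b ρ : ℝ → ℝ} (hb : ContDiff ℝ 1 b) (hρ : ContDiff ℝ 1 ρ) :
    ContDiff ℝ 1 (Function.uncurry (recovery κ m μ b ρ)) := by
  have h : Function.uncurry (recovery κ m μ b ρ)
      = fun p : ℝ × ℝ => m + b p.1 * (p.2 / κ) + ρ p.1 * (bump κ p.2 - μ) :=
    funext fun p => recovery_eq κ m μ b ρ p.1 p.2
  rw [h]
  unfold bump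
  fun_prop

theorem deriv_recovery_left (κ m μ : ℝ) {b ρ : ℝ → ℝ} (hb : ContDiff ℝ 1 b) (hρ : ContDiff ℝ 1 ρ)
    (t s : ℝ) : deriv (fun r => recovery κ m μ b ρ r s) t
      = deriv b t * (s / κ) + deriv ρ t * (bump κ s - μ) := by
  have h : (fun r => recovery κ m μ b ρ r s)
      = fun r => m + b r * (s / κ) + ρ r * (bump κ s - μ) :=
    funext fun r => recovery_eq κ m μ b ρ r s
  rw [h]
  have hb' := (hb.differentiable one_ne_zero t).hasDerivAt
  have hρ' := (hρ.differentiable one_ne_zero t).hasDerivAt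
  exact (((hb'.mul_const (s / κ)).const_add m).add (hρ'.mul_const _)).deriv

theorem IsConcentrating.integrable_prod {κ : ℝ} {γ : ℝ → Measure ℝ} (hγ : IsConcentrating κ γ)
    (ε T : ℝ) {f : ℝ × ℝ → ℝ} (hf : Continuous f) :
    Integrable f ((volume.restrict (Icc 0 T)).prod (γ ε)) := by
  have := hγ.prob ε
  have h := hf.continuousOn.integrableOn_compact (μ := volume.prod (γ ε))
    ((isCompact_Icc (a := (0 : ℝ)) (b := T)).prod (isCompact_Icc (a := -κ) (b := κ)))
  rwa [IntegrableOn, ← Measure.prod_restrict,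
    Measure.restrict_eq_self_of_ae_mem (hγ.ae_mem ε)] at h

theorem IsConcentrating.integral_recovery {κ : ℝ} {γ : ℝ → Measure ℝ} (hγ : IsConcentrating κ γ)
    (ε m : ℝ) (b ρ : ℝ → ℝ) (t : ℝ) {φ : ℝ → ℝ} (hφ : Continuous φ) :
    ∫ s, φ s * recovery κ m (bumpMean κ γ ε) b ρ t s ∂γ ε
      = m * (∫ s, φ s ∂γ ε) + b t * (∫ s, φ s * (s / κ) ∂γ ε)
        + ρ t * ∫ s, φ s * (bump κ s - bumpMean κ γ ε) ∂γ ε := by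
  have hb := continuous_bump κ
  have i1 := (hγ.integrable_of_continuous ε hφ).const_mul m
  have i2 := (hγ.integrable_of_continuous ε
    (by fun_prop : Continuous fun s => φ s * (s / κ))).const_mul (b t)
  have i3 := (hγ.integrable_of_continuous ε
    (by fun_prop : Continuous fun s => φ s * (bump κ s - bumpMean κ γ ε))).const_mul (ρ t)
  have i12 : Integrable (fun s => m * φ s + b t * (φ s * (s / κ))) (γ ε) := i1.add i2
  rw [← integral_const_mul, ← integral_const_mul, ← integral_const_mul, ← integral_add i1 i2,
    ← integral_add i12 i3]
  congr 1
  ext s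
  rw [recovery_eq]
  ring

/-- The time derivative of the profile combines `s / κ` and `bump - μ`, both of mean zero: the first
by evenness, the second by the choice of `μ`. Hence minus its left mean is a flux with no leakage at
the ends. -/
theorem IsConcentrating.continuityEquation {κ : ℝ} {γ : ℝ → Measure ℝ}
    (hγ : IsConcentrating κ γ) (ε : ℝ) {T m : ℝ} (hT : 0 < T) {b ρ : ℝ → ℝ} (hb : ContDiff ℝ 1 b)
    (hρ : ContDiff ℝ 1 ρ)
    (hpos : ∀ t ∈ Icc 0 T, ∀ s ∈ Icc (-κ) κ, 0 ≤ recovery κ m (bumpMean κ γ ε) b ρ t s) :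
    ContinuityEquation κ T (γ ε) (recovery κ m (bumpMean κ γ ε) b ρ)
      (recoveryFlux κ (bumpMean κ γ ε) (γ ε) b ρ) where
  nonneg := hpos
  integrable_density t _ := by
    exact hγ.integrable_of_continuous ε (contDiff_profile _ _ _ _).continuous
  weakly_continuous φ hφ := by
    simp only [hγ.setIntegral, hγ.integral_recovery ε m b ρ _ hφ]
    have := hb.continuous
    have := hρ.continuous
    fun_prop
  integrable_flux := by
    have := hγ.prob ε
    have hbump := continuous_bump κ
    have c1 : Continuous fun r : ℝ => r / κ := by fun_prop
    have c2 : Continuous fun r : ℝ => bump κ r - bumpMean κ γ ε := by fun_prop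
    have key : ∀ (c f : ℝ → ℝ), Continuous c → Continuous f →
        IntegrableOn (fun p : ℝ × ℝ => c p.1 * leftMean (γ ε) f p.2) (Icc 0 T ×ˢ Icc (-κ) κ) := by
      intro c f hc hf
      obtain ⟨C, hC⟩ := (isCompact_Icc (a := -κ) (b := κ)).exists_bound_of_continuousOn
        hf.continuousOn
      have hi : IntegrableOn (leftMean (γ ε) f) (Icc (-κ) κ) :=
        Integrable.of_bound (measurable_leftMean _ hf.measurable).aestronglyMeasurable C
          (Eventually.of_forall fun s => abs_leftMean_le ((hγ.ae_mem ε).mono hC) s)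
      rw [IntegrableOn, Measure.volume_eq_prod, ← Measure.prod_restrict]
      exact (hc.continuousOn.integrableOn_Icc).mul_prod hi
    exact ((key _ _ (hb.continuous_deriv le_rfl) c1).add
      (key _ _ (hρ.continuous_deriv le_rfl) c2)).neg
  weak_eq φ hφ hφc hφs := by
    have := hγ.prob ε
    have hbump := continuous_bump κ
    set μ := bumpMean κ γ ε with hμ
    have c1 : Continuous fun r : ℝ => r / κ := by fun_prop
    have c2 : Continuous fun r : ℝ => bump κ r - μ := by fun_prop
    have hφ1 : ContDiff ℝ 1 φ := hφ.of_le (by norm_cast)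
    have hu := contDiff_recovery κ m μ hb hρ
    have hflux : ∀ t, ∫ s in Icc (-κ) κ, deriv (fun r => φ (t, r)) s
          * recoveryFlux κ μ (γ ε) b ρ t s
        = ∫ s, φ (t, s) * deriv (fun r => recovery κ m μ b ρ r s) t ∂γ ε := by
      intro t
      have hφt : ContDiff ℝ 1 fun r => φ (t, r) := hφ1.comp (contDiff_prodMk_right t)
      have p1 := integral_deriv_mul_leftMean (hγ.ae_mem ε) c1 (hγ.integrable_of_continuous ε c1)
        (hγ.integral_div_eq_zero ε) hφt
      have p2 := integral_deriv_mul_leftMean (hγ.ae_mem ε) c2 (hγ.integrable_of_continuous ε c2)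
        (hγ.integral_bump_sub ε) hφt
      have hd : Continuous (deriv fun r => φ (t, r)) := hφt.continuous_deriv le_rfl
      have ik : ∀ f : ℝ → ℝ, Continuous f →
          IntegrableOn (fun s => deriv (fun r => φ (t, r)) s * leftMean (γ ε) f s)
            (Icc (-κ) κ) := by
        intro f hf
        obtain ⟨C, hC⟩ := (isCompact_Icc (a := -κ) (b := κ)).exists_bound_of_continuousOn
          hf.continuousOn
        have hi : IntegrableOn (leftMean (γ ε) f) (Icc (-κ) κ) :=
          Integrable.of_bound (measurable_leftMean _ hf.measurable).aestronglyMeasurable C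
            (Eventually.of_forall fun s => abs_leftMean_le ((hγ.ae_mem ε).mono hC) s)
        exact hi.continuousOn_mul hd.continuousOn isCompact_Icc
      have q : ∀ f : ℝ → ℝ, Continuous f → Integrable (fun s => φ (t, s) * f s) (γ ε) :=
        fun f hf => hγ.integrable_of_continuous ε (hφt.continuous.mul hf)
      calc ∫ s in Icc (-κ) κ, deriv (fun r => φ (t, r)) s * recoveryFlux κ μ (γ ε) b ρ t s
          = ∫ s in Icc (-κ) κ,
              (-deriv b t * (deriv (fun r => φ (t, r)) s * leftMean (γ ε) (fun r => r / κ) s)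
              + -deriv ρ t * (deriv (fun r => φ (t, r)) s
                * leftMean (γ ε) (fun r => bump κ r - μ) s)) := by
            congr 1
            ext s
            rw [recoveryFlux]
            ring
        _ = deriv b t * (∫ s, φ (t, s) * (s / κ) ∂γ ε)
              + deriv ρ t * ∫ s, φ (t, s) * (bump κ s - μ) ∂γ ε := by
            rw [integral_add ((ik _ c1).const_mul _) ((ik _ c2).const_mul _), integral_const_mul,
              integral_const_mul, p1, p2]
            ring
        _ = ∫ s, φ (t, s) * deriv (fun r => recovery κ m μ b ρ r s) t ∂γ ε := by
            rw [← integral_const_mul, ← integral_const_mul,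
              ← integral_add ((q _ c1).const_mul _) ((q _ c2).const_mul _)]
            congr 1
            ext s
            rw [deriv_recovery_left κ m μ hb hρ]
            ring
    have d1 : Continuous fun p : ℝ × ℝ =>
        deriv (fun r => φ (r, p.2)) p.1 * recovery κ m μ b ρ p.1 p.2 :=
      (continuous_deriv_left hφ1).mul hu.continuous
    have d2 : Continuous fun p : ℝ × ℝ =>
        φ (p.1, p.2) * deriv (fun r => recovery κ m μ b ρ r p.2) p.1 :=
      hφ1.continuous.mul (continuous_deriv_left hu)
    have I1 := hγ.integrable_prod ε T d1
    have I2 := hγ.integrable_prod ε T d2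
    simp only [hγ.setIntegral, hflux]
    refine Eq.trans (congrArg₂ (· + ·) (integral_prod _ I1).symm (integral_prod _ I2).symm) ?_
    -- Integrating in time first, for fixed `s`, turns the sum into the integral of `∂ₜ (φ u)`; it
    -- vanishes because `φ` is zero at `t = 0` and `t = T`.
    rw [← integral_add' I1 I2, integral_prod_symm _ (I1.add I2)]
    refine integral_eq_zero_of_ae (Eventually.of_forall fun s => ?_)
    have hd : ∀ t, HasDerivAt (fun r => φ (r, s) * recovery κ m μ b ρ r s)
        (deriv (fun r => φ (r, s)) t * recovery κ m μ b ρ t s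
          + φ (t, s) * deriv (fun r => recovery κ m μ b ρ r s) t) t := fun t =>
      (hasDerivAt_left_of_contDiff hφ1 t s).differentiableAt.hasDerivAt.mul
        (hasDerivAt_left_of_contDiff hu t s).differentiableAt.hasDerivAt
    have hz : ∀ t, t ∉ Ioo 0 T → φ (t, s) = 0 := fun t ht =>
      image_eq_zero_of_notMem_tsupport fun h0 => ht (hφs h0).1
    have hftc := intervalIntegral.integral_eq_sub_of_hasDerivAt (a := 0) (b := T)
      (fun t _ => hd t) (((d1.add d2).comp (Continuous.prodMk_left s)).intervalIntegrable 0 T)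
    rw [hz T (by simp), hz 0 (by simp), intervalIntegral.integral_of_le hT.le,
      ← integral_Icc_eq_integral_Ioc] at hftc
    simpa using hftc

theorem measurable_recoveryFlux {κ μ : ℝ} {γ : Measure ℝ} [SFinite γ] {b ρ : ℝ → ℝ} :
    Measurable fun p : ℝ × ℝ => recoveryFlux κ μ γ b ρ p.1 p.2 := by
  have c1 : Measurable fun r : ℝ => r / κ := by fun_prop
  have c2 : Measurable fun r : ℝ => bump κ r - μ := (continuous_bump κ).measurable.sub_const μ
  have m1 := measurable_leftMean γ c1
  have m2 := measurable_leftMean γ c2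
  have d1 := measurable_deriv b
  have d2 := measurable_deriv ρ
  unfold recoveryFlux
  fun_prop

theorem measurable_recovery {κ m μ : ℝ} {b ρ : ℝ → ℝ} (hb : Measurable b) (hρ : Measurable ρ) :
    Measurable fun p : ℝ × ℝ => recovery κ m μ b ρ p.1 p.2 := by
  unfold recovery profile bump
  fun_prop

theorem measurable_profileSlope {κ : ℝ} {b ρ : ℝ → ℝ} (hb : Measurable b) (hρ : Measurable ρ) :
    Measurable fun p : ℝ × ℝ => profileSlope κ (b p.1) (ρ p.1) p.2 := by
  unfold profileSlope
  fun_prop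

/-- The identity `2 |∂ₛ √f|² = f'² / (2 f)` brings the Fisher information into the form used in `M`.
-/
theorem two_mul_deriv_sqrt_sq {f : ℝ → ℝ} {f' s : ℝ} (hf : HasDerivAt f f' s) (hpos : 0 < f s) :
    2 * ENNReal.ofReal ((deriv (fun r => Real.sqrt (f r)) s) ^ 2) = sqDiv f' (f s) / 2 := by
  have h2 : (2 : ℝ≥0∞) = ENNReal.ofReal 2 := by simp
  rw [(hf.sqrt hpos.ne').deriv, sqDiv_of_pos _ hpos, h2, ← ENNReal.ofReal_div_of_pos two_pos,
    ← ENNReal.ofReal_mul two_pos.le]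
  congr 1
  rw [div_pow, mul_pow, Real.sq_sqrt hpos.le]
  field_simp

/-- Every admissible flux agrees almost everywhere with the explicit one, so the infimum runs over a
single value. -/
theorem IsDoubleWell.dissipationHat_recovery {H : ℝ → ℝ} (hH : IsDoubleWell H) (ε : ℝ) {T m : ℝ}
    (hT : 0 < T) {b ρ : ℝ → ℝ} (hb : ContDiff ℝ 1 b) (hρ : ContDiff ℝ 1 ρ)
    (hpos : ∀ t ∈ Icc 0 T, ∀ s ∈ Icc (-kappa H) (kappa H),
      0 < recovery (kappa H) m (bumpMean (kappa H) (gammaHat H) ε) b ρ t s) :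
    dissipationHat H T ε (recovery (kappa H) m (bumpMean (kappa H) (gammaHat H) ε) b ρ)
      = ∫⁻ t in Icc 0 T, ∫⁻ s in Icc (-kappa H) (kappa H),
          costDensity (recoveryFlux (kappa H) (bumpMean (kappa H) (gammaHat H) ε)
            (gammaHat H ε) b ρ t s) (profileSlope (kappa H) (b t) (ρ t) s)
            (recovery (kappa H) m (bumpMean (kappa H) (gammaHat H) ε) b ρ t s) := by
  have hγ := hH.isConcentrating
  have := hγ.prob ε
  set κ := kappa H with hκ
  set μ := bumpMean κ (gammaHat H) ε with hμ
  set u := recovery κ m μ b ρ with hu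
  set w₀ := recoveryFlux κ μ (gammaHat H ε) b ρ with hw₀
  have hCE : ContinuityEquation κ T (gammaHat H ε) u w₀ :=
    hγ.continuityEquation ε hT hb hρ fun t ht s hs => (hpos t ht s hs).le
  have hval : ∀ t ∈ Icc 0 T, ∀ w : ℝ → ℝ,
      (∀ᵐ s ∂volume.restrict (Icc (-κ) κ), w s = w₀ t s) →
      2⁻¹ * (∫⁻ s in Icc (-κ) κ, sqDiv (w s) (u t s))
        + 2 * ∫⁻ s in Icc (-κ) κ, ENNReal.ofReal ((deriv (fun r => Real.sqrt (u t r)) s) ^ 2)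
      = ∫⁻ s in Icc (-κ) κ, costDensity (w₀ t s) (profileSlope κ (b t) (ρ t) s) (u t s) := by
    intro t ht w hw
    have e1 : ∫⁻ s in Icc (-κ) κ, sqDiv (w s) (u t s)
        = ∫⁻ s in Icc (-κ) κ, sqDiv (w₀ t s) (u t s) :=
      lintegral_congr_ae (hw.mono fun s hs => by simp only [hs])
    have hm : Measurable fun s => 2⁻¹ * sqDiv (w₀ t s) (u t s) :=
      ((measurable_recoveryFlux.comp measurable_prodMk_left).sqDiv
        ((measurable_recovery hb.continuous.measurable hρ.continuous.measurable).comp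
          measurable_prodMk_left)).const_mul _
    rw [e1, ← lintegral_const_mul' _ _ (by simp), ← lintegral_const_mul' _ _ (by simp),
      ← lintegral_add_left hm]
    refine setLIntegral_congr_fun measurableSet_Icc fun s hs => ?_
    have hd : HasDerivAt (fun r => u t r) (profileSlope κ (b t) (ρ t) s) s :=
      hasDerivAt_profile _ _ _ _ _
    rw [two_mul_deriv_sqrt_sq hd (hpos t ht s hs), costDensity, mul_comm, ← div_eq_mul_inv]
  apply le_antisymm
  · refine iInf₂_le_of_le w₀ hCE (le_of_eq ?_)
    exact setLIntegral_congr_fun measurableSet_Icc fun t ht =>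
      hval t ht _ (Eventually.of_forall fun _ => rfl)
  · refine le_iInf₂ fun w hw => le_of_eq ?_
    refine lintegral_congr_ae ?_
    filter_upwards [hw.flux_unique hH.kappa_pos hCE, ae_restrict_mem measurableSet_Icc] with t h ht
    exact (hval t ht _ h).symm

/-! ### The limit in `ε` for a fixed smooth profile -/

theorem tendsto_costDensity {ι : Type*} {l : Filter ι} {w p u : ι → ℝ} {w₀ p₀ u₀ : ℝ}
    (hw : Tendsto w l (𝓝 w₀)) (hp : Tendsto p l (𝓝 p₀)) (hu : Tendsto u l (𝓝 u₀))
    (hpos : 0 < u₀) :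
    Tendsto (fun i => costDensity (w i) (p i) (u i)) l (𝓝 (costDensity w₀ p₀ u₀)) := by
  rw [costDensity_of_pos _ _ hpos]
  have h : Tendsto (fun i => ENNReal.ofReal ((w i ^ 2 + p i ^ 2) / (2 * u i))) l
      (𝓝 (ENNReal.ofReal ((w₀ ^ 2 + p₀ ^ 2) / (2 * u₀)))) :=
    ENNReal.tendsto_ofReal (((hw.pow 2).add (hp.pow 2)).div (hu.const_mul 2) (by positivity))
  refine h.congr' ?_
  filter_upwards [hu.eventually_const_lt hpos] with i hi
  rw [costDensity_of_pos _ _ hi]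

theorem abs_div_le_one {κ s : ℝ} (hκ : 0 < κ) (hs : s ∈ Icc (-κ) κ) : |s / κ| ≤ 1 := by
  rw [abs_div, abs_of_pos hκ, div_le_one hκ]
  exact abs_le.2 hs

theorem bump_mem {κ s : ℝ} (hκ : 0 < κ) (hs : s ∈ Icc (-κ) κ) : bump κ s ∈ Icc (0 : ℝ) (1 / 2) := by
  have h : 0 ≤ κ ^ 2 - s ^ 2 := by nlinarith [hs.1, hs.2]
  refine ⟨by unfold bump; positivity, ?_⟩
  rw [bump, div_le_div_iff₀ (by positivity) two_pos]
  nlinarith [sq_nonneg s]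

theorem abs_indicator_le {α : Type*} (A : Set α) (f : α → ℝ) (x : α) :
    |A.indicator f x| ≤ |f x| := by
  by_cases hx : x ∈ A <;> simp [hx]

/-- Dominated convergence for iterated integrals over a rectangle. -/
theorem tendsto_lintegral_lintegral_Icc {a b c d : ℝ} {l : Filter ℝ} [l.IsCountablyGenerated]
    {F : ℝ → ℝ → ℝ → ℝ≥0∞} {G : ℝ → ℝ → ℝ≥0∞} {K : ℝ≥0∞} (hK : K ≠ ⊤)
    (hF : ∀ ε, Measurable (Function.uncurry (F ε)))
    (hle : ∀ᶠ ε in l, ∀ t ∈ Icc a b, ∀ s ∈ Icc c d, F ε t s ≤ K)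
    (hlim : ∀ t ∈ Icc a b, ∀ s ∈ Ioo c d, Tendsto (fun ε => F ε t s) l (𝓝 (G t s))) :
    Tendsto (fun ε => ∫⁻ t in Icc a b, ∫⁻ s in Icc c d, F ε t s) l
      (𝓝 (∫⁻ t in Icc a b, ∫⁻ s in Icc c d, G t s)) := by
  refine tendsto_lintegral_filter_of_dominated_convergence
    (fun _ => ∫⁻ _ in Icc c d, K) ?_ ?_ ?_ ?_
  · exact Eventually.of_forall fun ε => (hF ε).lintegral_prod_right'
  · filter_upwards [hle] with ε hε
    filter_upwards [ae_restrict_mem measurableSet_Icc] with t ht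
    exact setLIntegral_mono' measurableSet_Icc (hε t ht)
  · simp [hK, ENNReal.mul_eq_top]
  · filter_upwards [ae_restrict_mem measurableSet_Icc] with t ht
    refine tendsto_lintegral_filter_of_dominated_convergence (fun _ => K) ?_ ?_ ?_ ?_
    · exact Eventually.of_forall fun ε => (hF ε).comp measurable_prodMk_left
    · filter_upwards [hle] with ε hε
      filter_upwards [ae_restrict_mem measurableSet_Icc] with s hs
      exact hε t ht s hs
    · simp [hK, ENNReal.mul_eq_top]
    -- The end points are null, so convergence at interior `s` suffices; the limit of the flux is
    -- computed only there.
    · rw [← restrict_Ioo_eq_restrict_Icc]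
      filter_upwards [ae_restrict_mem measurableSet_Ioo] with s hs
      exact hlim t ht s hs

/-- An interior half line sees only the left end point, of limit mass `1 / 2`, where `r / κ` equals
`-1`. -/
theorem IsConcentrating.tendsto_leftMean_div {κ : ℝ} {γ : ℝ → Measure ℝ}
    (hγ : IsConcentrating κ γ) (hκ : 0 < κ) {s : ℝ} (hs : s ∈ Ioo (-κ) κ) :
    Tendsto (fun ε => leftMean (γ ε) (fun r => r / κ) s) (𝓝[>] 0) (𝓝 (-1 / 2)) := by
  have h := hγ.tendsto_integral (f := fun _ => (Iio s).indicator fun r => r / κ) (C := 1)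
    (Lm := -1) (Lp := 0) (fun _ => (measurable_id.div_const κ).indicator measurableSet_Iio)
    (Eventually.of_forall fun _ r hr => (abs_indicator_le _ _ _).trans
      (abs_div_le_one hκ hr)) ?_ ?_
  · simpa only [leftMean_eq, add_zero] using h
  · have h1 : Tendsto (fun p : ℝ × ℝ => p.2 / κ) (𝓝[>] 0 ×ˢ 𝓝 (-κ)) (𝓝 (-1)) := by
      have : (-1 : ℝ) = -κ / κ := by field_simp
      rw [this]
      exact tendsto_snd.div_const κ
    refine h1.congr' ?_
    filter_upwards [tendsto_snd.eventually (isOpen_Iio.mem_nhds hs.1)] with p hp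
    exact (indicator_of_mem (s := Iio s) hp fun r => r / κ).symm
  · refine tendsto_const_nhds.congr' ?_
    filter_upwards [tendsto_snd.eventually (isOpen_Ioi.mem_nhds hs.2)] with p hp
    exact (indicator_of_notMem (s := Iio s) (fun h0 : p.2 < s => lt_asymm h0 hp)
      fun r => r / κ).symm

/-- Since `bump` vanishes at both end points and its mean tends to zero, the derivative of `ρ` does
not contribute to the limit flux. -/
theorem IsConcentrating.tendsto_leftMean_bump {κ : ℝ} {γ : ℝ → Measure ℝ}
    (hγ : IsConcentrating κ γ) (hκ : 0 < κ) (s : ℝ) :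
    Tendsto (fun ε => leftMean (γ ε) (fun r => bump κ r - bumpMean κ γ ε) s) (𝓝[>] 0) (𝓝 0) := by
  have hμ := hγ.tendsto_bumpMean
  have hlim : ∀ s₀, bump κ s₀ = 0 →
      Tendsto (Function.uncurry fun ε => (Iio s).indicator fun r => bump κ r - bumpMean κ γ ε)
        (𝓝[>] 0 ×ˢ 𝓝 s₀) (𝓝 0) := by
    intro s₀ h0
    have h1 : Tendsto (fun p : ℝ × ℝ => bump κ p.2 - bumpMean κ γ p.1) (𝓝[>] 0 ×ˢ 𝓝 s₀)
        (𝓝 (bump κ s₀ - 0)) :=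
      (((continuous_bump κ).tendsto s₀).comp tendsto_snd).sub (hμ.comp tendsto_fst)
    rw [h0, sub_zero] at h1
    exact squeeze_zero_norm (fun p => abs_indicator_le (Iio s) (fun r => bump κ r - bumpMean κ γ p.1) p.2)
      ((tendsto_zero_iff_abs_tendsto_zero _).1 h1)
  have h := hγ.tendsto_integral
    (f := fun ε => (Iio s).indicator fun r => bump κ r - bumpMean κ γ ε) (C := 1)
    (fun _ => ((continuous_bump κ).measurable.sub_const _).indicator measurableSet_Iio) ?_
    (hlim _ (bump_left κ)) (hlim _ (bump_right κ))
  · simpa only [leftMean_eq, add_zero, zero_div] using h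
  · filter_upwards [hμ.abs.eventually_lt_const (u := 1 / 2) (by norm_num)] with ε hε r hr
    refine (abs_indicator_le _ _ _).trans ?_
    have h1 := bump_mem hκ hr
    have h2 := abs_lt.1 hε
    rw [abs_le]
    constructor <;> linarith [h1.1, h1.2, h2.1, h2.2]

/-- For a fixed smooth profile the rescaled dissipation converges. -/
theorem IsDoubleWell.tendsto_dissipationHat_recovery {H : ℝ → ℝ} (hH : IsDoubleWell H) {T m δ : ℝ}
    (hT : 0 < T) (hδ : 0 < δ) {b ρ : ℝ → ℝ} (hb : ContDiff ℝ 1 b) (hρ : ContDiff ℝ 1 ρ)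
    (hlow : ∀ᶠ ε in 𝓝[>] 0, ∀ t ∈ Icc 0 T, ∀ s ∈ Icc (-kappa H) (kappa H),
      δ ≤ recovery (kappa H) m (bumpMean (kappa H) (gammaHat H) ε) b ρ t s) :
    Tendsto (fun ε => dissipationHat H T ε
        (recovery (kappa H) m (bumpMean (kappa H) (gammaHat H) ε) b ρ)) (𝓝[>] 0)
      (𝓝 (∫⁻ t in Icc 0 T, ∫⁻ s in Icc (-kappa H) (kappa H),
        costDensity (deriv b t / 2) (profileSlope (kappa H) (b t) (ρ t) s)
          (profile (kappa H) m (b t) (ρ t) s))) := by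
  have hγ := hH.isConcentrating
  have hκ := hH.kappa_pos
  set κ := kappa H with hκdef
  have hμ := hγ.tendsto_bumpMean
  have hbd : Continuous (deriv b) := hb.continuous_deriv le_rfl
  have hρd : Continuous (deriv ρ) := hρ.continuous_deriv le_rfl
  obtain ⟨Cb, hCb⟩ := (isCompact_Icc (a := 0) (b := T)).exists_bound_of_continuousOn
    hbd.continuousOn
  obtain ⟨Cρ, hCρ⟩ := (isCompact_Icc (a := 0) (b := T)).exists_bound_of_continuousOn
    hρd.continuousOn
  have hslope : Continuous fun p : ℝ × ℝ => profileSlope κ (b p.1) (ρ p.1) p.2 := by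
    have := hb.continuous
    have := hρ.continuous
    unfold profileSlope
    fun_prop
  obtain ⟨Cs, hCs⟩ := ((isCompact_Icc (a := 0) (b := T)).prod
    (isCompact_Icc (a := -κ) (b := κ))).exists_bound_of_continuousOn hslope.continuousOn
  set K : ℝ≥0∞ := ENNReal.ofReal (((Cb + Cρ) ^ 2 + Cs ^ 2) / (2 * δ)) with hK
  have hsmall := hμ.abs.eventually_lt_const (u := 1 / 2) (by norm_num)
  set F : ℝ → ℝ → ℝ → ℝ≥0∞ := fun ε t s =>
    costDensity (recoveryFlux κ (bumpMean κ (gammaHat H) ε) (gammaHat H ε) b ρ t s)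
      (profileSlope κ (b t) (ρ t) s) (recovery κ m (bumpMean κ (gammaHat H) ε) b ρ t s) with hF
  have hFm : ∀ ε, Measurable (Function.uncurry (F ε)) := fun ε => by
    have := hγ.prob ε
    exact measurable_recoveryFlux.costDensity
      (measurable_profileSlope hb.continuous.measurable hρ.continuous.measurable)
      (measurable_recovery hb.continuous.measurable hρ.continuous.measurable)
  have hFb : ∀ᶠ ε in 𝓝[>] 0, ∀ t ∈ Icc 0 T, ∀ s ∈ Icc (-κ) κ, F ε t s ≤ K := by
    filter_upwards [hlow, hsmall] with ε hε hμε t ht s hs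
    have := hγ.prob ε
    have h1 : |leftMean (gammaHat H ε) (fun r => r / κ) s| ≤ 1 :=
      abs_leftMean_le ((hγ.ae_mem ε).mono fun r hr => abs_div_le_one hκ hr) s
    have h2 : |leftMean (gammaHat H ε) (fun r => bump κ r - bumpMean κ (gammaHat H) ε) s| ≤ 1 := by
      refine abs_leftMean_le ((hγ.ae_mem ε).mono fun r hr => ?_) s
      have h1 := bump_mem hκ hr
      have h2 := abs_lt.1 hμε
      rw [abs_le]
      constructor <;> linarith [h1.1, h1.2, h2.1, h2.2]
    have h3 : |deriv b t| ≤ Cb := hCb t ht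
    have h4 : |deriv ρ t| ≤ Cρ := hCρ t ht
    have h5 : |profileSlope κ (b t) (ρ t) s| ≤ Cs := hCs (t, s) ⟨ht, hs⟩
    have h6 : |recoveryFlux κ (bumpMean κ (gammaHat H) ε) (gammaHat H ε) b ρ t s| ≤ Cb + Cρ := by
      rw [recoveryFlux, abs_neg]
      refine (abs_add_le _ _).trans (add_le_add ?_ ?_)
      · rw [abs_mul]
        exact (mul_le_of_le_one_right (abs_nonneg _) h1).trans h3
      · rw [abs_mul]
        exact (mul_le_of_le_one_right (abs_nonneg _) h2).trans h4
    have h7 := hε t ht s hs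
    simp only [hF]
    rw [costDensity_of_pos _ _ (hδ.trans_le h7)]
    refine ENNReal.ofReal_le_ofReal ?_
    have h8 := sq_le_sq' (neg_le_of_abs_le h6) (le_of_abs_le h6)
    have h9 := sq_le_sq' (neg_le_of_abs_le h5) (le_of_abs_le h5)
    gcongr
  have hu : ∀ t s, Tendsto (fun ε => recovery κ m (bumpMean κ (gammaHat H) ε) b ρ t s) (𝓝[>] 0)
      (𝓝 (profile κ m (b t) (ρ t) s)) := by
    intro t s
    have h1 := ((hμ.const_sub (bump κ s)).const_mul (ρ t)).const_add (m + b t * (s / κ))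
    simp only [recovery_eq]
    simpa [profile] using h1
  have hlim : ∀ t ∈ Icc 0 T, ∀ s ∈ Ioo (-κ) κ, Tendsto (fun ε => F ε t s) (𝓝[>] 0)
      (𝓝 (costDensity (deriv b t / 2) (profileSlope κ (b t) (ρ t) s)
        (profile κ m (b t) (ρ t) s))) := by
    intro t ht s hs
    have h0 : δ ≤ profile κ m (b t) (ρ t) s :=
      ge_of_tendsto (hu t s) (hlow.mono fun ε h => h t ht s (Ioo_subset_Icc_self hs))
    refine tendsto_costDensity ?_ tendsto_const_nhds (hu t s) (hδ.trans_le h0)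
    have h1 := (((hγ.tendsto_leftMean_div hκ hs).const_mul (deriv b t)).add
      ((hγ.tendsto_leftMean_bump hκ s).const_mul (deriv ρ t))).neg
    have e : -(deriv b t * (-1 / 2) + deriv ρ t * 0) = deriv b t / 2 := by ring
    rwa [e] at h1
  have hmain : Tendsto (fun ε => ∫⁻ t in Icc 0 T, ∫⁻ s in Icc (-κ) κ, F ε t s) (𝓝[>] 0)
      (𝓝 (∫⁻ t in Icc 0 T, ∫⁻ s in Icc (-κ) κ, costDensity (deriv b t / 2)
        (profileSlope κ (b t) (ρ t) s) (profile κ m (b t) (ρ t) s))) := by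
    exact tendsto_lintegral_lintegral_Icc ENNReal.ofReal_ne_top hFm hFb hlim
  refine hmain.congr' ?_
  filter_upwards [hlow] with ε hε
  exact (hH.dissipationHat_recovery ε hT hb hρ fun t ht s hs => hδ.trans_le (hε t ht s hs)).symm

/-- For a fixed profile the free energy converges. -/
theorem IsDoubleWell.tendsto_energyHat_recovery {H : ℝ → ℝ} (hH : IsDoubleWell H) (m t : ℝ)
    (b ρ : ℝ → ℝ) :
    Tendsto (fun ε => energyHat H ε
        (recovery (kappa H) m (bumpMean (kappa H) (gammaHat H) ε) b ρ t)) (𝓝[>] 0)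
      (𝓝 (energyZero (m - b t) (m + b t))) := by
  have hγ := hH.isConcentrating
  have hκ := hH.kappa_pos
  set κ := kappa H with hκdef
  have hμ := hγ.tendsto_bumpMean
  have hbc := continuous_bump κ
  -- The mass is exactly `m` for every `ε`, so the second term of the free energy is constant.
  have hmass : ∀ ε, ∫ s, recovery κ m (bumpMean κ (gammaHat H) ε) b ρ t s ∂gammaHat H ε = m := by
    intro ε
    have := hγ.prob ε
    have h := hγ.integral_recovery ε m b ρ t (φ := fun _ => 1) continuous_const
    simp only [one_mul, hγ.integral_div_eq_zero, hγ.integral_bump_sub] at h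
    simpa using h
  -- The function `x log x` is continuous on the whole line, so joint continuity in the mean `μ` of
  -- `bump` and in `s` needs no positivity of the profile.
  have hcont : Continuous fun p : ℝ × ℝ => (m + b t * (p.2 / κ) + ρ t * (bump κ p.2 - p.1))
      * Real.log (m + b t * (p.2 / κ) + ρ t * (bump κ p.2 - p.1)) := by
    exact Real.continuous_mul_log.comp (by fun_prop)
  obtain ⟨C, hC⟩ := ((isCompact_Icc (a := (-1 : ℝ)) (b := 1)).prod
    (isCompact_Icc (a := -κ) (b := κ))).exists_bound_of_continuousOn hcont.continuousOn
  have hlim : ∀ s₀, Tendsto (Function.uncurry fun ε s =>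
      recovery κ m (bumpMean κ (gammaHat H) ε) b ρ t s
        * Real.log (recovery κ m (bumpMean κ (gammaHat H) ε) b ρ t s)) (𝓝[>] 0 ×ˢ 𝓝 s₀)
      (𝓝 (profile κ m (b t) (ρ t) s₀ * Real.log (profile κ m (b t) (ρ t) s₀))) := by
    intro s₀
    have h1 := (hcont.tendsto (0, s₀)).comp
      (Tendsto.prodMk_nhds (hμ.comp (tendsto_fst (g := 𝓝 s₀))) tendsto_snd)
    simp only [sub_zero] at h1
    simp only [recovery_eq]
    exact h1
  have h := hγ.tendsto_integral (f := fun ε s => recovery κ m (bumpMean κ (gammaHat H) ε) b ρ t s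
      * Real.log (recovery κ m (bumpMean κ (gammaHat H) ε) b ρ t s)) (C := C) ?_ ?_
      (hlim (-κ)) (hlim κ)
  · simp only [energyHat, hmass]
    rw [profile_left hκ, profile_right hκ] at h
    convert h.sub_const (m * Real.log m) using 2
    rw [energyZero]
    have e : (m - b t + (m + b t)) / 2 = m := by ring
    rw [e]
    ring
  · intro ε
    simp only [recovery_eq]
    exact (Real.continuous_mul_log.comp (by fun_prop : Continuous fun s =>
      m + b t * (s / κ) + ρ t * (bump κ s - bumpMean κ (gammaHat H) ε))).measurable
  · filter_upwards [hμ.abs.eventually_lt_const (u := 1) (by norm_num)] with ε hε s hs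
    simp only [recovery_eq]
    exact hC (bumpMean κ (gammaHat H) ε, s) ⟨abs_le.1 hε.le, hs⟩

/-! ### Mollification of paths in time -/

/-- The mollification of `g` by the normalised bump function `φ`. -/
noncomputable def mollify (φ : ContDiffBump (0 : ℝ)) (g : ℝ → ℝ) : ℝ → ℝ :=
  convolution (φ.normed volume) g (ContinuousLinearMap.lsmul ℝ ℝ) volume

theorem mollify_apply (φ : ContDiffBump (0 : ℝ)) (g : ℝ → ℝ) (t : ℝ) :
    mollify φ g t = ∫ r, φ.normed volume r * g (t - r) := rfl

theorem integrable_mollify (φ : ContDiffBump (0 : ℝ)) {g : ℝ → ℝ} (hg : LocallyIntegrable g)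
    (t : ℝ) : Integrable fun r => φ.normed volume r * g (t - r) :=
  φ.hasCompactSupport_normed.convolutionExists_left (ContinuousLinearMap.lsmul ℝ ℝ)
    φ.continuous_normed hg t

theorem contDiff_mollify (φ : ContDiffBump (0 : ℝ)) {g : ℝ → ℝ} (hg : LocallyIntegrable g) :
    ContDiff ℝ 1 (mollify φ g) := by
  have : ContDiff ℝ ((1 : ℕ∞) : WithTop ℕ∞) (mollify φ g) :=
    φ.hasCompactSupport_normed.contDiff_convolution_left _ φ.contDiff_normed hg
  exact this

theorem abs_mollify_le (φ : ContDiffBump (0 : ℝ)) {g : ℝ → ℝ} {C : ℝ} (hC : ∀ t, |g t| ≤ C)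
    (t : ℝ) : |mollify φ g t| ≤ C := by
  rw [mollify_apply]
  have hi : Integrable fun r => φ.normed volume r * C :=
    (φ.integrable_normed (μ := volume)).mul_const C
  have h := norm_integral_le_of_norm_le (f := fun r => φ.normed volume r * g (t - r)) hi
    (Eventually.of_forall fun r => ?_)
  · refine h.trans (le_of_eq ?_)
    rw [integral_mul_const, φ.integral_normed, one_mul]
  · rw [norm_mul, Real.norm_of_nonneg (φ.nonneg_normed r)]
    exact mul_le_mul_of_nonneg_left (hC _) (φ.nonneg_normed r)

/-- The mollification of a primitive is a primitive of the mollification. -/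
theorem deriv_mollify (φ : ContDiffBump (0 : ℝ)) {b β : ℝ → ℝ} (hβ : Integrable β)
    (hbc : Continuous b) (hb : ∀ s t, b t - b s = ∫ r in s..t, β r) :
    deriv (mollify φ b) = mollify φ β := by
  have hcont : Continuous (mollify φ β) := (contDiff_mollify φ hβ.locallyIntegrable).continuous
  -- Fubini's theorem gives the integrated identity; as the mollified velocity is continuous, it can
  -- be differentiated at every `t`.
  have key : ∀ t, mollify φ b t = mollify φ b 0 + ∫ τ in (0 : ℝ)..t, mollify φ β τ := by
    intro t
    have hprod : Integrable (Function.uncurry fun τ r => φ.normed volume r * β (τ - r))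
        ((volume.restrict (uIoc 0 t)).prod volume) := by
      have h := (φ.integrable_normed (μ := volume)).convolution_integrand
        (ContinuousLinearMap.mul ℝ ℝ) hβ
      exact h.mono_measure (Measure.prod_mono Measure.restrict_le_self le_rfl)
    have h1 := integrable_mollify φ hbc.locallyIntegrable t
    have h2 := integrable_mollify φ hbc.locallyIntegrable 0
    simp only [mollify_apply]
    rw [intervalIntegral_integral_swap hprod, ← sub_eq_iff_eq_add', ← integral_sub h1 h2]
    congr 1
    ext r
    rw [intervalIntegral.integral_const_mul, intervalIntegral.integral_comp_sub_right,
      ← hb, mul_sub]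
  have h3 : mollify φ b = fun t => mollify φ b 0 + ∫ τ in (0 : ℝ)..t, mollify φ β τ := funext key
  ext t
  rw [h3]
  exact ((intervalIntegral.integral_hasDerivAt_right (hcont.intervalIntegrable _ _)
    (hcont.stronglyMeasurableAtFilter _ _) hcont.continuousAt).const_add _).deriv

theorem eq_of_sub_eq_integral_left {T : ℝ} {b β : ℝ → ℝ} (hb : ∀ s t, b t - b s = ∫ r in s..t, β r)
    (hβ : ∀ t, t ∉ Icc 0 T → β t = 0) {t : ℝ} (ht : t < 0) : b t = b 0 := by
  rw [← sub_eq_zero, hb]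
  rw [intervalIntegral.integral_symm, intervalIntegral.integral_of_le ht.le,
    ← restrict_Ioo_eq_restrict_Ioc, setIntegral_eq_zero_of_forall_eq_zero, neg_zero]
  exact fun r hr => hβ r fun hr' => not_le.2 hr.2 hr'.1

theorem eq_of_sub_eq_integral_right {T : ℝ} {b β : ℝ → ℝ}
    (hb : ∀ s t, b t - b s = ∫ r in s..t, β r) (hβ : ∀ t, t ∉ Icc 0 T → β t = 0) {t : ℝ}
    (ht : T < t) : b t = b T := by
  rw [← sub_eq_zero, hb, intervalIntegral.integral_of_le ht.le,
    setIntegral_eq_zero_of_forall_eq_zero]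
  exact fun r hr => hβ r fun hr' => not_le.2 hr.1 hr'.2

/-- Data `u^± = m ± b` with values in `[0, 2m]` and integrable velocity `β`, at rest outside
`[0, T]`. -/
structure IsPath (T m : ℝ) (b β : ℝ → ℝ) : Prop where
  measurable : Measurable β
  integrable : Integrable β
  sub_eq : ∀ s t, b t - b s = ∫ r in s..t, β r
  bound : ∀ t, |b t| ≤ m
  rest : ∀ t, t ∉ Icc 0 T → β t = 0

/-- The curvature coefficient of the optimal profile along a path. -/
noncomputable def pathCoeff (κ m : ℝ) (b β : ℝ → ℝ) (t : ℝ) : ℝ :=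
  optCoeff κ (β t / 2) (m - b t) (m + b t)

/-- The dissipation density of the optimal profiles along a path. -/
noncomputable def pathDensity (κ m : ℝ) (b β : ℝ → ℝ) (t s : ℝ) : ℝ≥0∞ :=
  costDensity (β t / 2) (profileSlope κ (b t) (pathCoeff κ m b β t) s)
    (profile κ m (b t) (pathCoeff κ m b β t) s)

theorem optCost_eq_lintegral_pathDensity (κ m : ℝ) (b β : ℝ → ℝ) (t : ℝ) :
    optCost κ (β t / 2) (m - b t) (m + b t) = ∫⁻ s in Icc (-κ) κ, pathDensity κ m b β t s := by
  have e1 : (m - b t + (m + b t)) / 2 = m := by ring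
  have e2 : (m + b t - (m - b t)) / 2 = b t := by ring
  simp only [optCost, optSlope, optProfile, pathDensity, pathCoeff, e1, e2]

namespace IsPath

variable {T m κ : ℝ} {b β : ℝ → ℝ}

theorem continuous (h : IsPath T m b β) : Continuous b := by
  have e : b = fun t => b 0 + ∫ r in (0 : ℝ)..t, β r := by
    ext t
    rw [← h.sub_eq 0 t]
    ring
  rw [e]
  exact continuous_const.add (intervalIntegral.continuous_primitive
    (fun _ _ => h.integrable.intervalIntegrable) 0)

theorem sub_nonneg (h : IsPath T m b β) (t : ℝ) : 0 ≤ m - b t := by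
  linarith [(abs_le.1 (h.bound t)).2]

theorem add_nonneg (h : IsPath T m b β) (t : ℝ) : 0 ≤ m + b t := by
  linarith [(abs_le.1 (h.bound t)).1]

theorem nonneg (h : IsPath T m b β) : 0 ≤ m := (abs_nonneg _).trans (h.bound 0)

theorem measurable_coeff (h : IsPath T m b β) : Measurable (pathCoeff κ m b β) := by
  have h1 := h.continuous.measurable
  have h2 := h.measurable
  unfold pathCoeff optCoeff
  fun_prop

/-- The square root is at most `m + κ |β| / 2`, so `ρ` grows only linearly in the integrable
velocity and can be mollified. -/
theorem locallyIntegrable_coeff (h : IsPath T m b β) (hκ : 0 < κ) :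
    LocallyIntegrable (pathCoeff κ m b β) := by
  have hdom : LocallyIntegrable fun t => 2 * m + κ / 2 * |β t| :=
    (locallyIntegrable_const (2 * m)).add (h.integrable.abs.const_mul (κ / 2)).locallyIntegrable
  refine hdom.mono h.measurable_coeff.aestronglyMeasurable (Eventually.of_forall fun t => ?_)
  have h1 := h.sub_nonneg t
  have h2 := h.add_nonneg t
  have hm := h.nonneg
  have h3 : Real.sqrt ((m - b t) * (m + b t) + κ ^ 2 * (β t / 2) ^ 2) ≤ m + κ / 2 * |β t| := by
    rw [Real.sqrt_le_left (by positivity)]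
    have h4 : 0 ≤ m * (κ / 2 * |β t|) := by positivity
    have h5 := sq_abs (β t)
    nlinarith [sq_nonneg (b t)]
  have h4 := Real.sqrt_nonneg ((m - b t) * (m + b t) + κ ^ 2 * (β t / 2) ^ 2)
  have h5 : 0 ≤ κ / 2 * |β t| := by positivity
  rw [Real.norm_eq_abs, Real.norm_eq_abs, abs_of_nonneg (by positivity : 0 ≤ 2 * m + κ / 2 * |β t|),
    pathCoeff, optCoeff, abs_le]
  constructor <;> linarith

theorem profile_nonneg (h : IsPath T m b β) (hκ : 0 < κ) (t : ℝ) {s : ℝ} (hs : s ∈ Icc (-κ) κ) :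
    0 ≤ profile κ m (b t) (pathCoeff κ m b β t) s := by
  have h0 := optProfile_nonneg hκ (β t / 2) (h.sub_nonneg t) (h.add_nonneg t) hs
  have e1 : (m - b t + (m + b t)) / 2 = m := by ring
  have e2 : (m + b t - (m - b t)) / 2 = b t := by ring
  rwa [optProfile, e1, e2] at h0

theorem measurable_pathDensity (h : IsPath T m b β) :
    Measurable fun p : ℝ × ℝ => pathDensity κ m b β p.1 p.2 := by
  have h1 := h.continuous.measurable
  have h2 := h.measurable
  have h3 := h.measurable_coeff (κ := κ)
  unfold pathDensity
  refine Measurable.costDensity (by fun_prop) ?_ ?_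
  · unfold profileSlope
    fun_prop
  · unfold profile bump
    fun_prop

end IsPath

/-- The slope is linear in the pair `(b, ρ)`, so mollifying the coefficients is the same as
averaging the slopes. The profile is affine in that pair, and the same holds there because the
kernel has integral one. -/
theorem mollify_profileSlope (φ : ContDiffBump (0 : ℝ)) {κ : ℝ} {b ρ : ℝ → ℝ}
    (hb : LocallyIntegrable b) (hρ : LocallyIntegrable ρ) (t s : ℝ) :
    profileSlope κ (mollify φ b t) (mollify φ ρ t) s
      = ∫ r, φ.normed volume r * profileSlope κ (b (t - r)) (ρ (t - r)) s := by
  have i1 := integrable_mollify φ hb t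
  have i2 := integrable_mollify φ hρ t
  rw [profileSlope, mollify_apply, mollify_apply, ← integral_div, ← integral_mul_const,
    ← integral_div, ← integral_sub (i1.div_const _) ((i2.mul_const _).div_const _)]
  congr 1
  ext r
  rw [profileSlope]
  ring

theorem integrable_mollify_profile (φ : ContDiffBump (0 : ℝ)) {κ m : ℝ} {b ρ : ℝ → ℝ}
    (hb : LocallyIntegrable b) (hρ : LocallyIntegrable ρ) (t s : ℝ) :
    Integrable fun r => φ.normed volume r * profile κ m (b (t - r)) (ρ (t - r)) s := by
  have i0 := (φ.integrable_normed (μ := volume)).mul_const m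
  have i1 := (integrable_mollify φ hb t).mul_const (s / κ)
  have i2 := (integrable_mollify φ hρ t).mul_const (bump κ s)
  refine ((i0.add i1).add i2).congr (Eventually.of_forall fun r => ?_)
  simp only [Pi.add_apply, profile]
  ring

theorem integrable_mollify_profileSlope (φ : ContDiffBump (0 : ℝ)) {κ : ℝ} {b ρ : ℝ → ℝ}
    (hb : LocallyIntegrable b) (hρ : LocallyIntegrable ρ) (t s : ℝ) :
    Integrable fun r => φ.normed volume r * profileSlope κ (b (t - r)) (ρ (t - r)) s := by
  have i1 := (integrable_mollify φ hb t).div_const κ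
  have i2 := ((integrable_mollify φ hρ t).mul_const s).div_const (κ ^ 2)
  refine (i1.sub i2).congr (Eventually.of_forall fun r => ?_)
  simp only [Pi.sub_apply, profileSlope]
  ring

theorem mollify_profile (φ : ContDiffBump (0 : ℝ)) {κ m : ℝ} {b ρ : ℝ → ℝ}
    (hb : LocallyIntegrable b) (hρ : LocallyIntegrable ρ) (t s : ℝ) :
    profile κ m (mollify φ b t) (mollify φ ρ t) s
      = ∫ r, φ.normed volume r * profile κ m (b (t - r)) (ρ (t - r)) s := by
  have i0 : Integrable fun r => φ.normed volume r * m :=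
    (φ.integrable_normed (μ := volume)).mul_const m
  have i1 := (integrable_mollify φ hb t).mul_const (s / κ)
  have i2 := (integrable_mollify φ hρ t).mul_const (bump κ s)
  have e0 : ∫ r, φ.normed volume r * m = m := by
    rw [integral_mul_const, φ.integral_normed, one_mul]
  have i01 : Integrable fun r => φ.normed volume r * m
      + φ.normed volume r * b (t - r) * (s / κ) := i0.add i1
  rw [profile, mollify_apply, mollify_apply, ← integral_mul_const, ← integral_mul_const]
  nth_rewrite 1 [← e0]
  rw [← integral_add i0 i1, ← integral_add i01 i2]
  congr 1
  ext r
  rw [profile]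
  ring

/-- After Tonelli's theorem, each shift by `r` in the support of the kernel moves `[0, T]` within
the enlarged interval, and the kernel has total mass one. -/
theorem lintegral_mollify_le (φ : ContDiffBump (0 : ℝ)) (T : ℝ) {G : ℝ → ℝ≥0∞}
    (hG : Measurable G) :
    ∫⁻ t in Icc 0 T, ∫⁻ r, ENNReal.ofReal (φ.normed volume r) * G (t - r)
      ≤ ∫⁻ t in Icc (-φ.rOut) (T + φ.rOut), G t := by
  have hη : Measurable (φ.normed volume) := φ.continuous_normed.measurable
  have hone : ∫⁻ r, ENNReal.ofReal (φ.normed volume r) = 1 := by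
    rw [← ofReal_integral_eq_lintegral_ofReal φ.integrable_normed
      (Eventually.of_forall φ.nonneg_normed), φ.integral_normed, ENNReal.ofReal_one]
  have hη' : Measurable fun p : ℝ × ℝ => ENNReal.ofReal (φ.normed volume p.2) :=
    (hη.comp measurable_snd).ennreal_ofReal
  have hm : Measurable fun p : ℝ × ℝ => ENNReal.ofReal (φ.normed volume p.2) * G (p.1 - p.2) :=
    hη'.mul (hG.comp (measurable_fst.sub measurable_snd))
  calc ∫⁻ t in Icc 0 T, ∫⁻ r, ENNReal.ofReal (φ.normed volume r) * G (t - r)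
      = ∫⁻ r, ∫⁻ t in Icc 0 T, ENNReal.ofReal (φ.normed volume r) * G (t - r) :=
        lintegral_lintegral_swap (f := fun t r => ENNReal.ofReal (φ.normed volume r) * G (t - r))
          hm.aemeasurable
    _ ≤ ∫⁻ r, ENNReal.ofReal (φ.normed volume r)
          * ∫⁻ t in Icc (-φ.rOut) (T + φ.rOut), G t := by
        refine lintegral_mono fun r => ?_
        rw [lintegral_const_mul' _ _ ENNReal.ofReal_ne_top]
        by_cases hr : r ∈ Metric.ball (0 : ℝ) φ.rOut
        · refine mul_le_mul_right ?_ _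
          rw [Metric.mem_ball, Real.dist_eq, sub_zero, abs_lt] at hr
          rw [← lintegral_indicator measurableSet_Icc, ← lintegral_indicator measurableSet_Icc,
            ← lintegral_sub_right_eq_self ((Icc (-φ.rOut) (T + φ.rOut)).indicator G) r]
          refine lintegral_mono fun t => ?_
          by_cases ht : t ∈ Icc 0 T
          · rw [indicator_of_mem ht, indicator_of_mem]
            constructor <;> linarith [ht.1, ht.2]
          · rw [indicator_of_notMem ht]
            exact zero_le
        · have : φ.normed volume r = 0 := by
            rw [← φ.support_normed_eq (μ := volume)] at hr
            exact Function.notMem_support.1 hr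
          simp [this]
    _ = ∫⁻ t in Icc (-φ.rOut) (T + φ.rOut), G t := by
        rw [lintegral_mul_const _ hη.ennreal_ofReal, hone, one_mul]

theorem sqDiv_anti {w u v : ℝ} (h : u ≤ v) : sqDiv w v ≤ sqDiv w u :=
  ENNReal.div_le_div_left (ENNReal.ofReal_le_ofReal h) _

/-- Lifting the profile by a constant keeps its slope and can only lower the cost. -/
theorem costDensity_anti {w p u v : ℝ} (h : u ≤ v) : costDensity w p v ≤ costDensity w p u :=
  add_le_add (ENNReal.div_le_div_right (sqDiv_anti h) _)
    (ENNReal.div_le_div_right (sqDiv_anti h) _)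

namespace IsPath

variable {T m κ : ℝ} {b β : ℝ → ℝ}

theorem profile_mollify_nonneg (h : IsPath T m b β) (hκ : 0 < κ) (φ : ContDiffBump (0 : ℝ)) (t : ℝ)
    {s : ℝ} (hs : s ∈ Icc (-κ) κ) :
    0 ≤ profile κ m (mollify φ b t) (mollify φ (pathCoeff κ m b β) t) s := by
  rw [mollify_profile φ h.continuous.locallyIntegrable (h.locallyIntegrable_coeff hκ)]
  exact integral_nonneg fun r => mul_nonneg (φ.nonneg_normed r) (h.profile_nonneg hκ _ hs)

/-- Jensen's inequality: mollification in time decreases the dissipation. -/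
theorem costDensity_mollify_le (h : IsPath T m b β) (hκ : 0 < κ) (φ : ContDiffBump (0 : ℝ)) (t : ℝ)
    {s : ℝ} (hs : s ∈ Icc (-κ) κ) :
    costDensity (mollify φ β t / 2)
        (profileSlope κ (mollify φ b t) (mollify φ (pathCoeff κ m b β) t) s)
        (profile κ m (mollify φ b t) (mollify φ (pathCoeff κ m b β) t) s)
      ≤ ∫⁻ r, ENNReal.ofReal (φ.normed volume r) * pathDensity κ m b β (t - r) s := by
  have hb := h.continuous.locallyIntegrable (μ := volume)
  have hρ := h.locallyIntegrable_coeff hκ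
  have hw : mollify φ β t / 2 = ∫ r, φ.normed volume r * (β (t - r) / 2) := by
    rw [mollify_apply, ← integral_div]
    congr 1
    ext r
    ring
  have iw : Integrable fun r => φ.normed volume r * (β (t - r) / 2) := by
    refine ((integrable_mollify φ h.integrable.locallyIntegrable t).div_const 2).congr
      (Eventually.of_forall fun r => ?_)
    simp only []
    ring
  rw [hw, mollify_profile φ hb hρ, mollify_profileSlope φ hb hρ]
  refine (costDensity_integral_le iw (integrable_mollify_profileSlope φ hb hρ t s)
    (integrable_mollify_profile φ hb hρ t s)
    fun r => mul_nonneg (φ.nonneg_normed r) (h.profile_nonneg hκ _ hs)).trans (le_of_eq ?_)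
  congr 1
  ext r
  rw [costDensity_mul (φ.nonneg_normed r)]
  rfl

theorem lintegral_costDensity_mollify_le (h : IsPath T m b β) (hκ : 0 < κ)
    (φ : ContDiffBump (0 : ℝ)) :
    ∫⁻ t in Icc 0 T, ∫⁻ s in Icc (-κ) κ, costDensity (mollify φ β t / 2)
        (profileSlope κ (mollify φ b t) (mollify φ (pathCoeff κ m b β) t) s)
        (profile κ m (mollify φ b t) (mollify φ (pathCoeff κ m b β) t) s)
      ≤ ∫⁻ t in Icc (-φ.rOut) (T + φ.rOut), ∫⁻ s in Icc (-κ) κ, pathDensity κ m b β t s := by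
  have hdm := h.measurable_pathDensity (κ := κ)
  have hG : Measurable fun t => ∫⁻ s in Icc (-κ) κ, pathDensity κ m b β t s :=
    hdm.lintegral_prod_right'
  refine le_trans (lintegral_mono fun t => ?_) (lintegral_mollify_le φ T hG)
  have hη : Measurable fun p : ℝ × ℝ => ENNReal.ofReal (φ.normed volume p.2) :=
    (φ.continuous_normed.measurable.comp measurable_snd).ennreal_ofReal
  have hshift : Measurable fun p : ℝ × ℝ => (t - p.2, p.1) :=
    (measurable_const.sub measurable_snd).prodMk measurable_fst
  have hd : Measurable fun p : ℝ × ℝ => pathDensity κ m b β (t - p.2) p.1 := by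
    simpa only [Function.comp_def] using hdm.comp hshift
  have hm : Measurable fun p : ℝ × ℝ =>
      ENNReal.ofReal (φ.normed volume p.2) * pathDensity κ m b β (t - p.2) p.1 := hη.mul hd
  calc ∫⁻ s in Icc (-κ) κ, costDensity (mollify φ β t / 2)
          (profileSlope κ (mollify φ b t) (mollify φ (pathCoeff κ m b β) t) s)
          (profile κ m (mollify φ b t) (mollify φ (pathCoeff κ m b β) t) s)
      ≤ ∫⁻ s in Icc (-κ) κ, ∫⁻ r,
          ENNReal.ofReal (φ.normed volume r) * pathDensity κ m b β (t - r) s :=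
        setLIntegral_mono' measurableSet_Icc fun s hs => h.costDensity_mollify_le hκ φ t hs
    _ = ∫⁻ r, ∫⁻ s in Icc (-κ) κ,
          ENNReal.ofReal (φ.normed volume r) * pathDensity κ m b β (t - r) s :=
        lintegral_lintegral_swap (f := fun s r =>
          ENNReal.ofReal (φ.normed volume r) * pathDensity κ m b β (t - r) s) hm.aemeasurable
    _ = ∫⁻ r, ENNReal.ofReal (φ.normed volume r)
          * ∫⁻ s in Icc (-κ) κ, pathDensity κ m b β (t - r) s :=
        lintegral_congr fun r => lintegral_const_mul' _ _ ENNReal.ofReal_ne_top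

end IsPath
/-- Lower semicontinuity of the dissipation under almost everywhere convergence. -/
theorem lintegral_costDensity_le_liminf {a b c d : ℝ} {w : ℕ → ℝ → ℝ} {p u : ℕ → ℝ → ℝ → ℝ}
    {w₀ : ℝ → ℝ} {p₀ u₀ : ℝ → ℝ → ℝ}
    (hm : ∀ n, Measurable fun x : ℝ × ℝ => costDensity (w n x.1) (p n x.1 x.2) (u n x.1 x.2))
    (hpos : ∀ n t, ∀ s ∈ Icc c d, 0 ≤ u n t s)
    (hlim : ∀ᵐ t, ∀ s ∈ Icc c d, Tendsto (fun n => w n t) atTop (𝓝 (w₀ t)) ∧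
      Tendsto (fun n => p n t s) atTop (𝓝 (p₀ t s)) ∧
      Tendsto (fun n => u n t s) atTop (𝓝 (u₀ t s))) :
    ∫⁻ t in Icc a b, ∫⁻ s in Icc c d, costDensity (w₀ t) (p₀ t s) (u₀ t s)
      ≤ liminf (fun n => ∫⁻ t in Icc a b, ∫⁻ s in Icc c d,
          costDensity (w n t) (p n t s) (u n t s)) atTop := by
  have hm' : ∀ n t, Measurable fun s => costDensity (w n t) (p n t s) (u n t s) := fun n t =>
    (hm n).of_uncurry_left (f := fun t s => costDensity (w n t) (p n t s) (u n t s))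
  have hm'' : ∀ n, Measurable fun t => ∫⁻ s in Icc c d, costDensity (w n t) (p n t s) (u n t s) :=
    fun n => (hm n).lintegral_prod_right'
  refine le_trans ?_ (lintegral_liminf_le hm'')
  refine lintegral_mono_ae (ae_restrict_of_ae ?_)
  filter_upwards [hlim] with t ht
  refine le_trans ?_ (lintegral_liminf_le fun n => hm' n t)
  refine setLIntegral_mono' measurableSet_Icc fun s hs => ?_
  obtain ⟨h1, h2, h3⟩ := ht s hs
  exact costDensity_le_liminf h1 h2 h3 fun n => hpos n t s hs

namespace IsPath

variable {T m κ : ℝ} {b β : ℝ → ℝ}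

/-- Outside `[0, T]` the path is at rest, so its cost rate there is constant in time and has no
flux; by `optCost_zero_lt_top` the two extra layers are negligible as `d → 0`. -/
theorem lintegral_enlarge_le (h : IsPath T m b β) (d : ℝ) :
    ∫⁻ t in Icc (-d) (T + d), ∫⁻ s in Icc (-κ) κ, pathDensity κ m b β t s
      ≤ optCost κ 0 (m - b 0) (m + b 0) * ENNReal.ofReal d
        + (∫⁻ t in Icc 0 T, ∫⁻ s in Icc (-κ) κ, pathDensity κ m b β t s)
        + optCost κ 0 (m - b T) (m + b T) * ENNReal.ofReal d := by
  have hsub : Icc (-d) (T + d) ⊆ Ico (-d) 0 ∪ Icc 0 T ∪ Ioc T (T + d) := by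
    intro t ht
    rcases lt_or_ge t 0 with h0 | h0
    · exact Or.inl (Or.inl ⟨ht.1, h0⟩)
    · rcases le_or_gt t T with h1 | h1
      · exact Or.inl (Or.inr ⟨h0, h1⟩)
      · exact Or.inr ⟨h1, ht.2⟩
  refine (lintegral_mono_set hsub).trans ((lintegral_union_le _ _ _).trans
    (add_le_add ((lintegral_union_le _ _ _).trans (add_le_add ?_ le_rfl)) ?_))
  · have e : ∀ t ∈ Ico (-d) 0, ∫⁻ s in Icc (-κ) κ, pathDensity κ m b β t s
        = optCost κ 0 (m - b 0) (m + b 0) := by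
      intro t ht
      rw [← optCost_eq_lintegral_pathDensity,
        eq_of_sub_eq_integral_left h.sub_eq h.rest ht.2,
        h.rest t fun ht' => not_le.2 ht.2 ht'.1, zero_div]
    rw [setLIntegral_congr_fun measurableSet_Ico e, setLIntegral_const, Real.volume_Ico]
    simp
  · have e : ∀ t ∈ Ioc T (T + d), ∫⁻ s in Icc (-κ) κ, pathDensity κ m b β t s
        = optCost κ 0 (m - b T) (m + b T) := by
      intro t ht
      rw [← optCost_eq_lintegral_pathDensity,
        eq_of_sub_eq_integral_right h.sub_eq h.rest ht.1,
        h.rest t fun ht' => not_le.2 ht.1 ht'.2, zero_div]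
    rw [setLIntegral_congr_fun measurableSet_Ioc e, setLIntegral_const, Real.volume_Ioc]
    simp

/-- Approximation of the optimal profiles of a path by smooth and strictly positive ones. -/
theorem exists_approx (h : IsPath T m b β) (hκ : 0 < κ) :
    ∃ (δ : ℕ → ℝ) (bn ρn : ℕ → ℝ → ℝ), (∀ n, 0 < δ n) ∧ Tendsto δ atTop (𝓝 0) ∧
      (∀ n, ContDiff ℝ 1 (bn n)) ∧ (∀ n, ContDiff ℝ 1 (ρn n)) ∧ (∀ n t, |bn n t| ≤ m) ∧
      (∀ t, Tendsto (fun n => bn n t) atTop (𝓝 (b t))) ∧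
      (∀ n t, ∀ s ∈ Icc (-κ) κ, δ n ≤ profile κ (m + δ n) (bn n t) (ρn n t) s) ∧
      Tendsto (fun n => ∫⁻ t in Icc 0 T, ∫⁻ s in Icc (-κ) κ,
          costDensity (deriv (bn n) t / 2) (profileSlope κ (bn n t) (ρn n t) s)
            (profile κ (m + δ n) (bn n t) (ρn n t) s)) atTop
        (𝓝 (∫⁻ t in Icc 0 T, ∫⁻ s in Icc (-κ) κ, pathDensity κ m b β t s)) := by
  set δ : ℕ → ℝ := fun n => 1 / ((n : ℝ) + 1) with hδdef
  have hδ : ∀ n, 0 < δ n := fun n => Nat.one_div_pos_of_nat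
  have hδ0 : Tendsto δ atTop (𝓝 0) := tendsto_one_div_add_atTop_nhds_zero_nat
  let φ : ℕ → ContDiffBump (0 : ℝ) := fun n =>
    ⟨δ n / 2, δ n, half_pos (hδ n), half_lt_self (hδ n)⟩
  have hφ : Tendsto (fun n => (φ n).rOut) atTop (𝓝 0) := hδ0
  -- A bounded ratio of outer to inner radius is what the Lebesgue differentiation theorem requires
  -- for almost everywhere convergence of the mollified `β` and `ρ`.
  have hφK : ∀ᶠ n in atTop, (φ n).rOut ≤ 2 * (φ n).rIn := Eventually.of_forall fun n => by
    change δ n ≤ 2 * (δ n / 2)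
    linarith
  have hbc := h.continuous
  have hbl : LocallyIntegrable b := hbc.locallyIntegrable
  have hρl := h.locallyIntegrable_coeff hκ
  have hdb : ∀ n, deriv (mollify (φ n) b) = mollify (φ n) β := fun n =>
    deriv_mollify (φ n) h.integrable hbc h.sub_eq
  set ρ := pathCoeff κ m b β with hρdef
  have hshift : ∀ n t s, profile κ (m + δ n) (mollify (φ n) b t) (mollify (φ n) ρ t) s
      = profile κ m (mollify (φ n) b t) (mollify (φ n) ρ t) s + δ n := fun n t s => by
    simp only [profile]
    ring
  have hnn : ∀ n t, ∀ s ∈ Icc (-κ) κ,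
      0 ≤ profile κ m (mollify (φ n) b t) (mollify (φ n) ρ t) s := fun n t s hs =>
    h.profile_mollify_nonneg hκ (φ n) t hs
  have hblim : ∀ t, Tendsto (fun n => mollify (φ n) b t) atTop (𝓝 (b t)) := fun t =>
    ContDiffBump.convolution_tendsto_right_of_continuous hφ hbc t
  refine ⟨δ, fun n => mollify (φ n) b, fun n => mollify (φ n) ρ, hδ, hδ0,
    fun n => contDiff_mollify _ hbl, fun n => contDiff_mollify _ hρl,
    fun n t => abs_mollify_le _ h.bound t, hblim, fun n t s hs => ?_, ?_⟩
  · rw [hshift]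
    linarith [hnn n t s hs]
  simp only [hdb]
  refine tendsto_of_le_liminf_of_limsup_le ?_ ?_
  · -- Fatou's lemma
    have hβlim := ContDiffBump.ae_convolution_tendsto_right_of_locallyIntegrable (μ := volume)
      hφ hφK h.integrable.locallyIntegrable
    have hρlim := ContDiffBump.ae_convolution_tendsto_right_of_locallyIntegrable (μ := volume)
      hφ hφK hρl
    have hm : Tendsto (fun n => m + δ n) atTop (𝓝 m) := by simpa using hδ0.const_add m
    refine lintegral_costDensity_le_liminf (fun n => ?_) (fun n t s hs => ?_) ?_
    · have m1 := (contDiff_mollify (φ n) hbl).continuous.measurable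
      have m2 := (contDiff_mollify (φ n) hρl).continuous.measurable
      have m3 := (contDiff_mollify (φ n) h.integrable.locallyIntegrable).continuous.measurable
      refine Measurable.costDensity (by fun_prop) ?_ ?_
      · unfold profileSlope
        fun_prop
      · unfold profile bump
        fun_prop
    · rw [hshift]
      linarith [hnn n t s hs, hδ n]
    · filter_upwards [hβlim, hρlim] with t h1 h2 s _
      exact ⟨h1.div_const 2, tendsto_profileSlope (hblim t) h2 s,
        tendsto_profile hm (hblim t) h2 s⟩
  · -- Jensen's inequality
    have hC0 := (optCost_zero_lt_top hκ (h.sub_nonneg 0) (h.add_nonneg 0)).ne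
    have hCT := (optCost_zero_lt_top hκ (h.sub_nonneg T) (h.add_nonneg T)).ne
    have hle : ∀ n, ∫⁻ t in Icc 0 T, ∫⁻ s in Icc (-κ) κ, costDensity (mollify (φ n) β t / 2)
        (profileSlope κ (mollify (φ n) b t) (mollify (φ n) ρ t) s)
        (profile κ (m + δ n) (mollify (φ n) b t) (mollify (φ n) ρ t) s)
        ≤ optCost κ 0 (m - b 0) (m + b 0) * ENNReal.ofReal (δ n)
        + (∫⁻ t in Icc 0 T, ∫⁻ s in Icc (-κ) κ, pathDensity κ m b β t s)
        + optCost κ 0 (m - b T) (m + b T) * ENNReal.ofReal (δ n) := by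
      intro n
      refine le_trans (lintegral_mono fun t => lintegral_mono fun s => ?_)
        ((h.lintegral_costDensity_mollify_le hκ (φ n)).trans (h.lintegral_enlarge_le _))
      refine costDensity_anti ?_
      rw [hshift]
      linarith [hδ n]
    have hδE : Tendsto (fun n => ENNReal.ofReal (δ n)) atTop (𝓝 0) := by
      simpa using ENNReal.tendsto_ofReal hδ0
    have hlim : Tendsto (fun n => optCost κ 0 (m - b 0) (m + b 0) * ENNReal.ofReal (δ n)
        + (∫⁻ t in Icc 0 T, ∫⁻ s in Icc (-κ) κ, pathDensity κ m b β t s)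
        + optCost κ 0 (m - b T) (m + b T) * ENNReal.ofReal (δ n)) atTop
        (𝓝 (∫⁻ t in Icc 0 T, ∫⁻ s in Icc (-κ) κ, pathDensity κ m b β t s)) := by
      have h1 := ENNReal.Tendsto.const_mul hδE (Or.inr hC0)
      have h2 := ENNReal.Tendsto.const_mul hδE (Or.inr hCT)
      simpa using (h1.add tendsto_const_nhds).add h2
    rw [← hlim.limsup_eq]
    exact limsup_le_limsup (Eventually.of_forall hle)

end IsPath

/-! ### From finite dissipation to a path -/

theorem optCost_neg (κ w um up : ℝ) : optCost κ (-w) um up = optCost κ w um up := by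
  simp [optCost, optSlope, optProfile, optCoeff, costDensity, sqDiv_neg]

/-- Boundary data of finite dissipation come from a path. -/
theorem exists_isPath {H : ℝ → ℝ} (hκ : 0 < kappa H) {T : ℝ} (hT : 0 < T) {um up : ℝ → ℝ}
    (hJ : dissipationZero H T um up < (⊤ : ℝ≥0∞)) :
    ∃ (m : ℝ) (b β : ℝ → ℝ), IsPath T m b β ∧ (∀ t ∈ Icc 0 T, um t = m - b t ∧ up t = m + b t) ∧
      dissipationZero H T um up
        = ∫⁻ t in Icc 0 T, ∫⁻ s in Icc (-kappa H) (kappa H), pathDensity (kappa H) m b β t s := by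
  rw [dissipationZero] at hJ ⊢
  split_ifs at hJ ⊢ with hcond
  swap
  · exact absurd hJ (lt_irrefl _)
  obtain ⟨hum, hup, hnn, hd⟩ := hcond
  set m := (um 0 + up 0) / 2 with hm
  -- The velocity is extended by zero, which makes `b` constant before `0` and after `T`, ready for
  -- mollification on the whole line.
  set β : ℝ → ℝ := (Icc 0 T).indicator fun t => -deriv um t with hβ
  set b : ℝ → ℝ := fun t => (up 0 - um 0) / 2 + ∫ r in (0 : ℝ)..t, β r with hb
  have hβi : Integrable β := by
    have h1 := hum.intervalIntegrable_deriv
    rw [intervalIntegrable_iff_integrableOn_Icc_of_le hT.le] at h1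
    exact h1.neg.integrable_indicator measurableSet_Icc
  have hβm : Measurable β := (measurable_deriv um).neg.indicator measurableSet_Icc
  have hsub : ∀ s t, b t - b s = ∫ r in s..t, β r := by
    intro s t
    simp only [hb]
    rw [add_sub_add_left_eq_sub, intervalIntegral.integral_interval_sub_left
      hβi.intervalIntegrable hβi.intervalIntegrable]
  have hrest : ∀ t, t ∉ Icc 0 T → β t = 0 := fun t ht => indicator_of_notMem ht _
  have hval : ∀ t ∈ Icc 0 T, um t = m - b t ∧ up t = m + b t := by
    intro t ht
    have hsubset : uIcc 0 t ⊆ uIcc 0 T := by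
      rw [uIcc_of_le ht.1, uIcc_of_le hT.le]
      exact Icc_subset_Icc_right ht.2
    have e1 := (hum.mono hsubset).integral_deriv_eq_sub
    have e2 := (hup.mono hsubset).integral_deriv_eq_sub
    have e3 : ∫ r in (0 : ℝ)..t, β r = -∫ r in (0 : ℝ)..t, deriv um r := by
      rw [← intervalIntegral.integral_neg]
      refine intervalIntegral.integral_congr fun r hr => ?_
      have hr' := hsubset hr
      rw [uIcc_of_le hT.le] at hr'
      exact indicator_of_mem hr' _
    have e4 : ∫ r in (0 : ℝ)..t, deriv um r = -∫ r in (0 : ℝ)..t, deriv up r := by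
      rw [← intervalIntegral.integral_neg]
      refine intervalIntegral.integral_congr_ae ?_
      rw [ae_restrict_iff' measurableSet_Icc] at hd
      filter_upwards [hd] with r hr hr'
      rw [uIoc_of_le ht.1] at hr'
      exact hr ⟨hr'.1.le, hr'.2.trans ht.2⟩
    constructor <;> simp only [hb, hm] <;> linarith
  have h0mem : (0 : ℝ) ∈ Icc 0 T := ⟨le_rfl, hT.le⟩
  have hTmem : T ∈ Icc 0 T := ⟨hT.le, le_rfl⟩
  have hbound : ∀ t ∈ Icc 0 T, |b t| ≤ m := by
    intro t ht
    have h1 := hval t ht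
    have h2 := hnn t ht
    rw [abs_le]
    constructor <;> linarith [h1.1, h1.2, h2.1, h2.2]
  refine ⟨m, b, β, ⟨hβm, hβi, hsub, fun t => ?_, hrest⟩, hval, ?_⟩
  · rcases lt_or_ge t 0 with h0 | h0
    · rw [eq_of_sub_eq_integral_left hsub hrest h0]
      exact hbound 0 h0mem
    · rcases le_or_gt t T with h1 | h1
      · exact hbound t ⟨h0, h1⟩
      · rw [eq_of_sub_eq_integral_right hsub hrest h1]
        exact hbound T hTmem
  · refine setLIntegral_congr_fun measurableSet_Icc fun t ht => ?_
    have h1 := hval t ht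
    have h2 := hnn t ht
    have h3 : β t = -deriv um t := indicator_of_mem ht _
    -- The definition of `J₀` uses `½ u̇⁻`, whereas the flux to the right is `β / 2 = -½ u̇⁻`; the
    -- cost is even in the flux.
    rw [M_eq_optCost hκ _ h2.1 h2.2, ← optCost_eq_lintegral_pathDensity, ← h1.1, ← h1.2, h3,
      neg_div, optCost_neg]

/-! ### The diagonal argument and the conclusion -/

theorem tendsto_eLpNorm_one_Icc {ι : Type*} {l : Filter ι} [l.IsCountablyGenerated] {T C : ℝ}
    {f : ι → ℝ → ℝ} {g : ℝ → ℝ}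
    (hf : ∀ i, AEStronglyMeasurable (f i) (volume.restrict (Icc 0 T)))
    (hC : ∀ᶠ i in l, ∀ t ∈ Icc 0 T, |f i t| ≤ C)
    (hlim : ∀ t ∈ Icc 0 T, Tendsto (fun i => f i t) l (𝓝 (g t))) :
    Tendsto (fun i => eLpNorm (f i) 1 (volume.restrict (Icc 0 T))) l
      (𝓝 (eLpNorm g 1 (volume.restrict (Icc 0 T)))) := by
  simp only [eLpNorm_one_eq_lintegral_enorm]
  refine tendsto_lintegral_filter_of_dominated_convergence' (fun _ => ENNReal.ofReal C)
    (Eventually.of_forall fun i => (hf i).enorm) ?_ (by simp [ENNReal.mul_eq_top]) ?_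
  · filter_upwards [hC] with i hi
    filter_upwards [ae_restrict_mem measurableSet_Icc] with t ht
    rw [← ofReal_norm]
    exact ENNReal.ofReal_le_ofReal (hi t ht)
  · filter_upwards [ae_restrict_mem measurableSet_Icc] with t ht
    exact (hlim t ht).enorm

/-- Diagonal selection along `ε ↓ 0`. -/
theorem exists_diagonal {X : Type*} [TopologicalSpace X] {a : X} [(𝓝 a).IsCountablyGenerated]
    {f : ℕ → ℝ → X} {A : ℕ → X} (hf : ∀ n, Tendsto (f n) (𝓝[>] 0) (𝓝 (A n)))
    (hA : Tendsto A atTop (𝓝 a)) :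
    ∃ N : ℝ → ℕ, Tendsto (fun ε => f (N ε) ε) (𝓝[>] 0) (𝓝 a) := by
  classical
  obtain ⟨B, hB⟩ := (𝓝 a).exists_antitone_basis
  have hsel : ∀ k, ∃ n, ∀ᶠ ε in 𝓝[>] (0 : ℝ), f n ε ∈ B k := by
    intro k
    -- Choosing `A n` in the interior of `B k` ensures that `f n ε` itself lies in `B k` for small
    -- `ε`.
    have h1 : ∀ᶠ x in 𝓝 a, B k ∈ 𝓝 x := eventually_mem_nhds_iff.2 (hB.1.mem_of_mem trivial)
    obtain ⟨n, hn⟩ := (hA.eventually h1).exists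
    exact ⟨n, hf n hn⟩
  choose n hn using hsel
  -- The largest index `k ≤ ⌊1 / ε⌋` that already works at `ε`: the cap makes a largest index exist,
  -- and it tends to infinity with `1 / ε`. The default value `0` only matters while no index works.
  refine ⟨fun ε => n (Nat.findGreatest (fun k => f (n k) ε ∈ B k) ⌊ε⁻¹⌋₊), ?_⟩
  rw [hB.1.tendsto_right_iff]
  intro k _
  have hfloor : ∀ᶠ ε : ℝ in 𝓝[>] 0, k ≤ ⌊ε⁻¹⌋₊ :=
    (tendsto_nat_floor_atTop.comp tendsto_inv_nhdsGT_zero).eventually_ge_atTop k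
  filter_upwards [hn k, hfloor] with ε h1 h2
  have h3 : f (n (Nat.findGreatest (fun k => f (n k) ε ∈ B k) ⌊ε⁻¹⌋₊)) ε
      ∈ B (Nat.findGreatest (fun k => f (n k) ε ∈ B k) ⌊ε⁻¹⌋₊) :=
    Nat.findGreatest_spec (P := fun k => f (n k) ε ∈ B k) h2 h1
  exact hB.2 (Nat.le_findGreatest h2 h1) h3

open Classical in
/-- The recovery profile at scale `ε`, replaced by `0` as long as it is not nonnegative. -/
noncomputable def recoverySeq (H : ℝ → ℝ) (T m : ℝ) (b ρ : ℝ → ℝ) (ε : ℝ) : ℝ → ℝ → ℝ :=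
  if ∀ t ∈ Icc 0 T, ∀ s ∈ Icc (-kappa H) (kappa H),
      0 ≤ recovery (kappa H) m (bumpMean (kappa H) (gammaHat H) ε) b ρ t s
  then recovery (kappa H) m (bumpMean (kappa H) (gammaHat H) ε) b ρ
  else fun _ _ => 0

theorem recoverySeq_admissible (H : ℝ → ℝ) (T m : ℝ) {b ρ : ℝ → ℝ} (hb : ContDiff ℝ 1 b)
    (hρ : ContDiff ℝ 1 ρ) (ε : ℝ) :
    ContDiffOn ℝ 1 (Function.uncurry (recoverySeq H T m b ρ ε))
        (Icc 0 T ×ˢ Icc (-kappa H) (kappa H)) ∧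
      ∀ t ∈ Icc 0 T, ∀ s ∈ Icc (-kappa H) (kappa H), 0 ≤ recoverySeq H T m b ρ ε t s := by
  rw [recoverySeq]
  split_ifs with h
  · exact ⟨(contDiff_recovery _ _ _ hb hρ).contDiffOn, h⟩
  · exact ⟨contDiffOn_const, fun _ _ _ _ => le_rfl⟩

/-- The quantities whose limits are computed along a family `u`. -/
noncomputable def limitData (H : ℝ → ℝ) (T : ℝ) (um up : ℝ → ℝ) (ε : ℝ) (u : ℝ → ℝ → ℝ) :
    ℝ≥0∞ × ℝ≥0∞ × ℝ × ℝ × ℝ≥0∞ :=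
  (eLpNorm (fun t => u t (-kappa H) - um t) 1 (volume.restrict (Icc 0 T)),
    eLpNorm (fun t => u t (kappa H) - up t) 1 (volume.restrict (Icc 0 T)),
    energyHat H ε (u 0), energyHat H ε (u T), dissipationHat H T ε u)

/-- All five limits are stated as one limit in a product space, so that a single diagonal choice
treats them simultaneously. -/
theorem IsDoubleWell.tendsto_limitData {H : ℝ → ℝ} (hH : IsDoubleWell H) {T m δ : ℝ} (hT : 0 < T)
    (hδ : 0 < δ) {um up : ℝ → ℝ} (hum : ContinuousOn um (Icc 0 T)) (hup : ContinuousOn up (Icc 0 T))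
    {b ρ : ℝ → ℝ} (hb : ContDiff ℝ 1 b) (hρ : ContDiff ℝ 1 ρ)
    (hlow : ∀ t, ∀ s ∈ Icc (-kappa H) (kappa H), δ ≤ profile (kappa H) m (b t) (ρ t) s) :
    Tendsto (fun ε => limitData H T um up ε (recoverySeq H T m b ρ ε)) (𝓝[>] 0)
      (𝓝 (eLpNorm (fun t => m - b t - um t) 1 (volume.restrict (Icc 0 T)),
        eLpNorm (fun t => m + b t - up t) 1 (volume.restrict (Icc 0 T)),
        energyZero (m - b 0) (m + b 0), energyZero (m - b T) (m + b T),
        ∫⁻ t in Icc 0 T, ∫⁻ s in Icc (-kappa H) (kappa H),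
          costDensity (deriv b t / 2) (profileSlope (kappa H) (b t) (ρ t) s)
            (profile (kappa H) m (b t) (ρ t) s))) := by
  have hγ := hH.isConcentrating
  have hκ := hH.kappa_pos
  set κ := kappa H with hκdef
  have hμ := hγ.tendsto_bumpMean
  obtain ⟨Cρ, hCρ⟩ := (isCompact_Icc (a := 0) (b := T)).exists_bound_of_continuousOn
    hρ.continuous.continuousOn
  -- The mass correction `ρ μ` may consume half of the lower bound `δ`; the other half keeps the
  -- profile positive.
  have hsmall : ∀ᶠ ε in 𝓝[>] 0, Cρ * |bumpMean κ (gammaHat H) ε| < δ / 2 := by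
    have h := hμ.abs.const_mul Cρ
    rw [abs_zero, mul_zero] at h
    exact h.eventually_lt_const (half_pos hδ)
  have hlow' : ∀ᶠ ε in 𝓝[>] 0, ∀ t ∈ Icc 0 T, ∀ s ∈ Icc (-κ) κ,
      δ / 2 ≤ recovery κ m (bumpMean κ (gammaHat H) ε) b ρ t s := by
    filter_upwards [hsmall] with ε hε t ht s hs
    have h1 := hlow t s hs
    have h2 : |ρ t * bumpMean κ (gammaHat H) ε| ≤ Cρ * |bumpMean κ (gammaHat H) ε| := by
      rw [abs_mul]
      exact mul_le_mul_of_nonneg_right (hCρ t ht) (abs_nonneg _)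
    have h3 := (abs_le.1 h2).2
    rw [profile] at h1
    rw [recovery_eq]
    linarith
  have hbound : ∀ᶠ ε in 𝓝[>] 0, |bumpMean κ (gammaHat H) ε| < 1 := by
    have h := hμ.abs
    rw [abs_zero] at h
    exact h.eventually_lt_const one_pos
  -- convergence of the boundary values
  have hbdry : ∀ (c : ℝ → ℝ) (v : ℝ → ℝ), Continuous c → ContinuousOn v (Icc 0 T) →
      Tendsto (fun ε => eLpNorm (fun t => c t - ρ t * bumpMean κ (gammaHat H) ε - v t) 1
        (volume.restrict (Icc 0 T))) (𝓝[>] 0)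
        (𝓝 (eLpNorm (fun t => c t - v t) 1 (volume.restrict (Icc 0 T)))) := by
    intro c v hc hv
    obtain ⟨C, hC⟩ := (isCompact_Icc (a := 0) (b := T)).exists_bound_of_continuousOn
      (hc.continuousOn.sub hv)
    refine tendsto_eLpNorm_one_Icc (C := C + Cρ) (fun ε => ?_) ?_ fun t _ => ?_
    · exact (((hc.sub (hρ.continuous.mul_const _)).continuousOn).sub hv).aestronglyMeasurable
        measurableSet_Icc
    · filter_upwards [hbound] with ε hε t ht
      have h1 : |c t - v t| ≤ C := hC t ht
      have h2 : |ρ t * bumpMean κ (gammaHat H) ε| ≤ Cρ := by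
        rw [abs_mul]
        exact (mul_le_of_le_one_right (abs_nonneg _) hε.le).trans (hCρ t ht)
      have e : c t - ρ t * bumpMean κ (gammaHat H) ε - v t
          = (c t - v t) - ρ t * bumpMean κ (gammaHat H) ε := by ring
      rw [e]
      exact (abs_sub _ _).trans (add_le_add h1 h2)
    · have h := ((hμ.const_mul (ρ t)).const_sub (c t)).sub_const (v t)
      rwa [mul_zero, sub_zero] at h
  have hmain : Tendsto (fun ε => limitData H T um up ε
      (recovery κ m (bumpMean κ (gammaHat H) ε) b ρ)) (𝓝[>] 0)
      (𝓝 (eLpNorm (fun t => m - b t - um t) 1 (volume.restrict (Icc 0 T)),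
        eLpNorm (fun t => m + b t - up t) 1 (volume.restrict (Icc 0 T)),
        energyZero (m - b 0) (m + b 0), energyZero (m - b T) (m + b T),
        ∫⁻ t in Icc 0 T, ∫⁻ s in Icc (-κ) κ,
          costDensity (deriv b t / 2) (profileSlope κ (b t) (ρ t) s)
            (profile κ m (b t) (ρ t) s))) := by
    have h1 := hbdry (fun t => m - b t) um (continuous_const.sub hb.continuous) hum
    have h2 := hbdry (fun t => m + b t) up (continuous_const.add hb.continuous) hup
    refine Tendsto.prodMk_nhds (h1.congr fun ε => ?_) (Tendsto.prodMk_nhds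
      (h2.congr fun ε => ?_) (Tendsto.prodMk_nhds (hH.tendsto_energyHat_recovery m 0 b ρ)
      (Tendsto.prodMk_nhds (hH.tendsto_energyHat_recovery m T b ρ)
        (hH.tendsto_dissipationHat_recovery hT (half_pos hδ) hb hρ hlow'))))
    · congr 1
      ext t
      rw [recovery, profile_left hκ]
      ring
    · congr 1
      ext t
      rw [recovery, profile_right hκ]
      ring
  refine hmain.congr' ?_
  filter_upwards [hlow'] with ε hε
  rw [recoverySeq, if_pos fun t ht s hs => (half_pos hδ).le.trans (hε t ht s hs)]

theorem continuous_energyZero : Continuous fun p : ℝ × ℝ => energyZero p.1 p.2 := by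
  have h1 := Real.continuous_mul_log.comp (continuous_snd (X := ℝ) (Y := ℝ))
  have h2 := Real.continuous_mul_log.comp (continuous_fst (X := ℝ) (Y := ℝ))
  have h3 := Real.continuous_mul_log.comp
    ((continuous_fst.add continuous_snd).div_const 2 : Continuous fun p : ℝ × ℝ => (p.1 + p.2) / 2)
  exact ((h1.add h2).div_const 2).sub h3

end Kramers

theorem mainTheorem4 (H : ℝ → ℝ) (hH : Kramers.IsDoubleWell H) (T : ℝ) (hT : 0 < T)
    (um up : ℝ → ℝ)
    (hum : AbsolutelyContinuousOnInterval um 0 T)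
    (hup : AbsolutelyContinuousOnInterval up 0 T)
    (hJ : Kramers.dissipationZero H T um up < (⊤ : ℝ≥0∞)) :
    ∃ u : ℝ → ℝ → ℝ → ℝ,
      (∀ ε : ℝ, 0 < ε →
        ContDiffOn ℝ 1 (Function.uncurry (u ε))
          (Icc 0 T ×ˢ Icc (-Kramers.kappa H) (Kramers.kappa H)) ∧
        ∀ t ∈ Icc 0 T, ∀ s ∈ Icc (-Kramers.kappa H) (Kramers.kappa H), 0 ≤ u ε t s) ∧
      Tendsto (fun ε => eLpNorm (fun t => u ε t (-Kramers.kappa H) - um t) 1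
        (volume.restrict (Icc 0 T))) (𝓝[>] 0) (𝓝 0) ∧
      Tendsto (fun ε => eLpNorm (fun t => u ε t (Kramers.kappa H) - up t) 1
        (volume.restrict (Icc 0 T))) (𝓝[>] 0) (𝓝 0) ∧
      Tendsto (fun ε => Kramers.energyHat H ε (u ε 0)) (𝓝[>] 0)
        (𝓝 (Kramers.energyZero (um 0) (up 0))) ∧
      Tendsto (fun ε => Kramers.energyHat H ε (u ε T)) (𝓝[>] 0)
        (𝓝 (Kramers.energyZero (um T) (up T))) ∧
      Tendsto (fun ε => Kramers.dissipationHat H T ε (u ε)) (𝓝[>] 0)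
        (𝓝 (Kramers.dissipationZero H T um up)) := by
  have hκ := hH.kappa_pos
  obtain ⟨m, b, β, hpath, hval, hdiss⟩ := Kramers.exists_isPath hκ hT hJ
  obtain ⟨δ, bn, ρn, hδ, hδ0, hbn, hρn, hbound, hblim, hlow, hcost⟩ := hpath.exists_approx hκ
  have hum' : ContinuousOn um (Icc 0 T) := by simpa [uIcc_of_le hT.le] using hum.continuousOn
  have hup' : ContinuousOn up (Icc 0 T) := by simpa [uIcc_of_le hT.le] using hup.continuousOn
  have hmn : Tendsto (fun n => m + δ n) atTop (𝓝 m) := by simpa using hδ0.const_add m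
  have hδle : ∀ᶠ n in atTop, δ n ≤ 1 := (hδ0.eventually_lt_const one_pos).mono fun n h => h.le
  -- The sign `σ` is `-1` for the left boundary value and `1` for the right one.
  have hbdry : ∀ (σ : ℝ) (v : ℝ → ℝ), |σ| = 1 → ContinuousOn v (Icc 0 T) →
      (∀ t ∈ Icc 0 T, v t = m + σ * b t) →
      Tendsto (fun n => eLpNorm (fun t => m + δ n + σ * bn n t - v t) 1
        (volume.restrict (Icc 0 T))) atTop (𝓝 0) := by
    intro σ v hσ hv hvb
    have h := Kramers.tendsto_eLpNorm_one_Icc (l := atTop) (T := T) (C := 1 + 2 * m)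
      (f := fun n t => m + δ n + σ * bn n t - v t) (g := fun _ => 0) (fun n => ?_) ?_ fun t ht => ?_
    · simpa using h
    · exact ((continuous_const.add
        ((hbn n).continuous.const_mul σ)).continuousOn.sub hv).aestronglyMeasurable
          measurableSet_Icc
    · filter_upwards [hδle] with n hn t ht
      have e : m + δ n + σ * bn n t - v t = δ n + σ * (bn n t - b t) := by
        rw [hvb t ht]
        ring
      rw [e]
      refine (abs_add_le _ _).trans ?_
      rw [abs_mul, hσ, one_mul, abs_of_pos (hδ n)]
      have h1 := abs_sub (bn n t) (b t)
      have h2 := hbound n t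
      have h3 := hpath.bound t
      linarith
    · have h1 := (hmn.add ((hblim t).const_mul σ)).sub_const (v t)
      rwa [← hvb t ht, sub_self] at h1
  have hleft := hbdry (-1) um (by simp) hum' fun t ht => by rw [(hval t ht).1]; ring
  have hright := hbdry 1 up (by simp) hup' fun t ht => by rw [(hval t ht).2]; ring
  have hen : ∀ t ∈ Icc 0 T, Tendsto (fun n => Kramers.energyZero (m + δ n - bn n t)
      (m + δ n + bn n t)) atTop (𝓝 (Kramers.energyZero (um t) (up t))) := by
    intro t ht
    have h := (Kramers.continuous_energyZero.tendsto (m - b t, m + b t)).comp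
      (Tendsto.prodMk_nhds (hmn.sub (hblim t)) (hmn.add (hblim t)))
    rw [(hval t ht).1, (hval t ht).2]
    exact h
  rw [← hdiss] at hcost
  have hA := Tendsto.prodMk_nhds hleft (Tendsto.prodMk_nhds hright
    (Tendsto.prodMk_nhds (hen 0 ⟨le_rfl, hT.le⟩)
      (Tendsto.prodMk_nhds (hen T ⟨hT.le, le_rfl⟩) hcost)))
  have hf := fun n => hH.tendsto_limitData hT (hδ n) hum' hup' (hbn n) (hρn n)
    (m := m + δ n) (hlow n)
  -- For each `n` the limit in `ε` is given by `hf`, and these limits converge in `n` by `hA`; the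
  -- product space is first countable, as the selection requires.
  obtain ⟨N, hN⟩ := Kramers.exists_diagonal hf (by
    simpa only [neg_one_mul, one_mul, ← sub_eq_add_neg] using hA)
  refine ⟨fun ε => Kramers.recoverySeq H T (m + δ (N ε)) (bn (N ε)) (ρn (N ε)) ε,
    fun ε _ => Kramers.recoverySeq_admissible H T _ (hbn _) (hρn _) ε, ?_⟩
  have h1 := (continuous_fst.tendsto _).comp hN
  have h1' := (continuous_snd.tendsto _).comp hN
  have h2 := (continuous_fst.tendsto _).comp h1'
  have h2' := (continuous_snd.tendsto _).comp h1'
  have h3 := (continuous_fst.tendsto _).comp h2'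
  have h3' := (continuous_snd.tendsto _).comp h2'
  exact ⟨h1, h2, h3, (continuous_fst.tendsto _).comp h3', (continuous_snd.tendsto _).comp h3'⟩
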